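/- A real or $\mathbb R^n$-valued Lévy process is a process $(X(t))_{t\ge 0}$ with $X(0)=0$ a.s. that has stationary and independent increments and is stochastically continuous. Let $U$ be a separable real Banach space with dual $U^*$ and let $(\Omega,\mathcal F,P)$ be a probability space with a filtration $(\mathcal F_t)_{t\ge 0}$. Let $L=(L(t))_{t\ge 0}$ be a weakly cylindrical Lévy process in $U$: each $L(t):U^*\to L^0(\Omega,\mathcal F,P)$ is linear, $L(t)a$ is $\mathcal F_t$-measurable, and $(L(t)a_1,\dots,L(t)a_n)_{t\ge 0}$ is a Lévy process in $\mathbb R^n$ for all $n$ and $a_1,\dots,a_n\in U^*$. Assume that $L$ is weakly càdlàg (for every $a\in U^*$ the process $L(\cdot)a$ has càdlàg paths a.s.) and of weak order $2$ ($E|L(t)a|^2<\infty$ for all $t\ge0$, $a\in U^*$). For $a\in U^*$, $t\ge 0$ and Borel $B\subseteq\mathbb R\setminus\{0\}$ put $$N_a(t,B)=\sum_{0\le s\le t}\mathbf 1_B(\Delta L(s)a),\qquad \nu_a(B)=E[N_a(1,B)],\qquad \tilde N_a(t,B)=N_a(t,B)-t\,\nu_a(B),$$ and let $$M_2(t)a=\int_{\mathbb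 R\setminus\{0\}}\beta\,\tilde N_a(t,d\beta)=\lim_{\varepsilon\downarrow 0}\int_{|\beta|>\varepsilon}\beta\,\tilde N_a(t,d\beta)\in L^2(\Omega,\mathcal F,P).$$ Assume that $M_2$ is strong, i.e. its covariance operator maps $U^*$ to $U$: there is $Q_2:U^*\to U$ with $\langle Q_2a,b\rangle=E[(M_2(1)a)(M_2(1)b)]$ for all $a,b\in U^*$. Then: (i) For all $t\ge 0$ and $a\in U^*$ the limit defining $M_2(t)a$ exists in $L^2(\Omega,\mathcal F,P)$. (ii) There exist a real Hilbert space $H$ with an orthonormal basis $(e_k)_{k\in\mathbb N}$, a bounded linear operator $F:H\to U$, and square integrable, pairwise uncorrelated real càdlàg Lévy processes $(m_k)_{k\in\mathbb N}$ (that is, $\operatorname{Cov}(m_k(s),m_l(t))=0$ for all $s,t\ge0$ and $k\ne l$) such that $$M_2(t)a=\sum_{k}\langle Fe_k,a\rangle\,m_k(t)\quad\text{in }L^2(\Omega,\mathcal F,P)\text{, unconditionally, for all }t\ge 0,\ a\in U^*.\qquad(*)$$ (iii) Let $H_{Q_2}$ be the reproducing kernel Hilbert space of $Q_2$: the Hilbert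 space continuously embedded in $U$ by an injection $i:H_{Q_2}\to U$ that contains $Q_2(U^*)$ as a dense subset and satisfies $[Q_2a,Q_2b]_{H_{Q_2}}=\langle Q_2a,b\rangle$. This space exists, and it has a countable (finite or infinite) orthonormal basis $(e_k)_k$ of the form $i e_k=Q_2a_k$ with $a_k\in U^*$, such that there are square integrable, pairwise uncorrelated real càdlàg Lévy processes $m_k$ with $m_k(t)=M_2(t)a_k$ a.s. for every $t\ge0$ and $(*)$ holds with $F=i$. -/

import Mathlib

open MeasureTheory ProbabilityTheory Filter Topology
open scoped NNReal ENNReal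

universe u v

namespace CylLevy

noncomputable section

/-- Right-continuous with left limits at every time `t ≥ 0` (no condition from the left at `0`,
where `𝓝[<] 0 = ⊥`). -/
def IsCadlag (f : ℝ≥0 → ℝ) : Prop :=
  ∀ t, ContinuousWithinAt f (Set.Ici t) t ∧ ∃ l, Tendsto f (𝓝[<] t) (𝓝 l)

/-- Lévy process: starts at zero almost surely, has independent and stationary increments, and is
stochastically continuous. No path regularity is part of the definition. -/
structure IsLevyProcess {Ω : Type*} [MeasurableSpace Ω] (P : Measure Ω) {E : Type*}
    [NormedAddCommGroup E] [MeasurableSpace E] (X : ℝ≥0 → Ω → E) : Prop where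
  aemeasurable : ∀ t, AEMeasurable (X t) P
  zero : ∀ᵐ ω ∂P, X 0 ω = 0
  indep : HasIndepIncrements X P
  stationary : ∀ s h, IdentDistrib (X (s + h) - X s) (X h - X 0) P P
  stochCont : ∀ t, TendstoInMeasure P X (𝓝 t) (X t)

/-! ### Cylindrical processes -/

section Cylindrical

variable {Ω : Type v} {mΩ : MeasurableSpace Ω} {U : Type u} [NormedAddCommGroup U]
  [NormedSpace ℝ U]

/-- A cylindrical process, given by representatives `L t a : Ω → ℝ` of the random variables: for
every `t`, the map `a ↦ [L t a]` is a linear map from the dual of `U` to `L⁰(Ω, P)`. -/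
structure IsCylindricalProcess (P : Measure Ω) (L : ℝ≥0 → StrongDual ℝ U → Ω → ℝ) : Prop where
  aemeasurable : ∀ t a, AEMeasurable (L t a) P
  map_add : ∀ t a b, L t (a + b) =ᵐ[P] L t a + L t b
  map_smul : ∀ t (c : ℝ) a, L t (c • a) =ᵐ[P] c • L t a

/-- Weakly cylindrical Lévy process: a cylindrical process adapted to `𝓕` all of whose
finite-dimensional projections are Lévy processes in `ℝⁿ`. -/
structure IsWeaklyCylindricalLevyProcess (P : Measure Ω) (𝓕 : Filtration ℝ≥0 mΩ)
    (L : ℝ≥0 → StrongDual ℝ U → Ω → ℝ) : Prop extends IsCylindricalProcess P L where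
  adapted : ∀ t a, AEStronglyMeasurable[𝓕 t] (L t a) P
  levy : ∀ (n : ℕ) (a : Fin n → StrongDual ℝ U),
    IsLevyProcess P (fun t ω (i : Fin n) => L t (a i) ω)

/-- Weakly càdlàg: for each `a`, almost all paths of `L(·)a` are càdlàg. -/
def IsWeaklyCadlag (P : Measure Ω) (L : ℝ≥0 → StrongDual ℝ U → Ω → ℝ) : Prop :=
  ∀ a, ∀ᵐ ω ∂P, IsCadlag (fun t => L t a ω)

/-- Weak order `2`: `E |L(t)a|² < ∞` for all `t` and `a`. -/
def IsWeakOrderTwo (P : Measure Ω) (L : ℝ≥0 → StrongDual ℝ U → Ω → ℝ) : Prop :=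
  ∀ t a, MemLp (L t a) 2 P

end Cylindrical

/-! ### Jumps and the compensated Poisson integral of a real process -/

/-- The jump `Δf(s) = f(s) - f(s-)`; it is `0` at `s = 0`. -/
def jump (f : ℝ≥0 → ℝ) (s : ℝ≥0) : ℝ := f s - Function.leftLim f s

/-- The counting measure `N(t, ·)` of the nonzero jumps of the path `f` during `[0, t]`:
`N(t, B) = ∑_{0 ≤ s ≤ t} 1_B(Δf(s))` for `B ⊆ ℝ ∖ {0}`, and `N(t, {0}) = 0`. -/
def jumpMeasure (f : ℝ≥0 → ℝ) (t : ℝ≥0) : Measure ℝ :=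
  Measure.sum fun s : {s : ℝ≥0 // s ≤ t ∧ jump f s ≠ 0} => Measure.dirac (jump f s)

section Jumps

variable {Ω : Type v} [MeasurableSpace Ω]

/-- The Lévy measure `ν(B) = E[N(1, B)]`. -/
def levyMeasure (P : Measure Ω) (X : ℝ≥0 → Ω → ℝ) : Measure ℝ :=
  P.bind fun ω => jumpMeasure (fun s => X s ω) 1

/-- `∫_{|β| > ε} β Ñ(t, dβ)`, where `Ñ(t, dβ) = N(t, dβ) - t ν(dβ)`. -/
def truncatedJumpIntegral (P : Measure Ω) (X : ℝ≥0 → Ω → ℝ) (ε : ℝ) (t : ℝ≥0) (ω : Ω) : ℝ :=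
  (∫ β in {β : ℝ | ε < |β|}, β ∂(jumpMeasure (fun s => X s ω) t))
    - t * ∫ β in {β : ℝ | ε < |β|}, β ∂(levyMeasure P X)

/-- `Y = ∫_{ℝ∖{0}} β Ñ(t, dβ)`: `Y` is the limit in `L²(Ω, P)`, as `ε ↓ 0`, of the integrals over
`{|β| > ε}`. -/
def IsCompensatedJumpIntegral (P : Measure Ω) (X : ℝ≥0 → Ω → ℝ) (t : ℝ≥0) (Y : Lp ℝ 2 P) : Prop :=
  Tendsto (fun ε : ℝ => eLpNorm (fun ω => truncatedJumpIntegral P X ε t ω - Y ω) 2 P)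
    (𝓝[>] 0) (𝓝 0)

open Classical in
/-- The element `∫_{ℝ∖{0}} β Ñ(t, dβ)` of `L²(Ω, P)` (and `0` if the `L²`-limit did not exist). -/
def compensatedJumpIntegral (P : Measure Ω) (X : ℝ≥0 → Ω → ℝ) (t : ℝ≥0) : Lp ℝ 2 P :=
  if h : ∃ Y, IsCompensatedJumpIntegral P X t Y then h.choose else 0

variable {U : Type u} [NormedAddCommGroup U] [NormedSpace ℝ U]

/-- `M₂(t)a = ∫_{ℝ∖{0}} β Ñ_a(t, dβ)`, where `Ñ_a` is built from the jumps of `L(·)a`. -/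
def M₂ (P : Measure Ω) (L : ℝ≥0 → StrongDual ℝ U → Ω → ℝ) (t : ℝ≥0) (a : StrongDual ℝ U) :
    Lp ℝ 2 P :=
  compensatedJumpIntegral P (fun s => L s a) t

/-- `Q : U* → U` is the covariance operator of `M₂`: `⟨Qa, b⟩ = E[(M₂(1)a)(M₂(1)b)]`. The process
`M₂` is strong when such a `U`-valued `Q` exists. -/
def IsCovarianceOperator (P : Measure Ω) (L : ℝ≥0 → StrongDual ℝ U → Ω → ℝ)
    (Q : StrongDual ℝ U → U) : Prop :=
  ∀ a b : StrongDual ℝ U, b (Q a) = ∫ ω, M₂ P L 1 a ω * M₂ P L 1 b ω ∂P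

/-- `M₂` is strong: its covariance operator maps `U*` to `U`. -/
def IsStrong (P : Measure Ω) (L : ℝ≥0 → StrongDual ℝ U → Ω → ℝ) : Prop :=
  ∃ Q : StrongDual ℝ U → U, IsCovarianceOperator P L Q

/-- `H`, embedded in `U` by `i`, is the reproducing kernel Hilbert space of `Q`: a Hilbert subspace
of `U` that contains `Q(U*)` as a dense subset and satisfies `[Qa, Qb]_H = ⟨Qa, b⟩`. -/
structure IsReproducingKernelHilbertSpace {H : Type*} [NormedAddCommGroup H]
    [InnerProductSpace ℝ H] [CompleteSpace H] (Q : StrongDual ℝ U → U) (i : H →L[ℝ] U) : Prop where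
  injective : Function.Injective i
  range_subset : ∀ a, ∃ h, i h = Q a
  dense : Dense {h : H | ∃ a, i h = Q a}
  inner_eq : ∀ (a b : StrongDual ℝ U) (h k : H), i h = Q a → i k = Q b → inner ℝ h k = b (Q a)

/-- The `m k` are pairwise uncorrelated square integrable real càdlàg Lévy processes with
`M₂(t)a = ∑ₖ ⟨F eₖ, a⟩ mₖ(t)` in `L²(Ω, P)` for all `t` and `a` (unconditionally, in particular
along the partial sums of an enumeration). -/
structure IsSeriesRepresentation {ι H : Type*} [NormedAddCommGroup H] [InnerProductSpace ℝ H]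
    (P : Measure Ω) (L : ℝ≥0 → StrongDual ℝ U → Ω → ℝ) (e : HilbertBasis ι ℝ H)
    (F : H →L[ℝ] U) (m : ι → ℝ≥0 → Ω → ℝ) : Prop where
  levy : ∀ k, IsLevyProcess P (m k)
  cadlag : ∀ k ω, IsCadlag (fun t => m k t ω)
  memLp : ∀ k t, MemLp (m k t) 2 P
  uncorrelated : ∀ k l, k ≠ l → ∀ s t, cov[m k s, m l t; P] = 0
  hasSum : ∀ (t : ℝ≥0) (a : StrongDual ℝ U),
    HasSum (fun k => a (F (e k)) • (memLp k t).toLp (m k t)) (M₂ P L t a)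

end Jumps

end

end CylLevy

open CylLevy

/-! Let `T a = M₂(1)a` and let `K` be the closure of the range of `T` in `L²(P)`. Strongness says
that `b (Q a) = ⟨T a, T b⟩` with `Q a` a vector of `U`. The closed graph theorem then makes `T`
bounded (`continuous_of_covariance`), and `T a ↦ Q a` extends to a bounded injection `i : K → U`
with `b (i k) = ⟨k, T b⟩` (`exists_kernel_embedding`). Hence `K` is a copy of the reproducing kernel
Hilbert space. A sequence in the dual that separates the points of the separable space `U` has a
total image under `T`, and Gram–Schmidt turns it into an orthonormal basis `T (a k)` that stays
inside the range of `T`. Expanding `T b` in this basis is the series at `t = 1`, with coefficients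
`⟨T (a k), T b⟩ = b (i (e k))`. The identity `E[M₂(s)a M₂(t)b] = min(s, t) E[M₂(1)a M₂(1)b]`
(`inner_M₂`) carries the series to every `t` and makes the processes `M₂(·)(a k)` uncorrelated.

The probabilistic input is that `M₂(t)a` exists, is linear in `a`, has this covariance, and has a
càdlàg Lévy version in `t`. No Poisson law is used. Finitely many functionals are realised by one
càdlàg process `Z` in `ℝᵈ`, and everything is expressed by sums of `g(ΔZ)`. For continuous `g`
vanishing near `0` these are limits of sums of `g` over the increments along uniform partitions
(`IsCadlagPath.tendsto_gridSum`), so they inherit independence, stationarity and the bound `Var ∑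
g(ΔZ) ≤ E ∑ g(ΔZ)²` (`IsRegularLevy.memLp_jumpFunctional`), which replaces the isometry of Poisson
integrals. The quadratic variation of the jumps has an integrable majorant
(`IsRegularLevy.exists_dominating`), so dominated convergence on the right-hand side yields both the
`L²`-limit and its linearity (`IsRegularLevy.tendsto_centeredLp_zero`). Kolmogorov's maximal
inequality and Borel–Cantelli make a subsequence converge locally uniformly, which gives the càdlàg
version (`IsJumpLimit.exists_cadlag_version`). -/

open CylLevy

/-! ### Jumps of càdlàg paths in `ℝᵈ` -/

section Paths

variable {d : ℕ}

/-- All coordinates of the path `f` are càdlàg. -/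
def IsCadlagPath (f : ℝ≥0 → Fin d → ℝ) : Prop := ∀ i, IsCadlag (fun t => f t i)

/-- The vector of the jumps of the coordinates of `f`. -/
noncomputable def jumpVec (f : ℝ≥0 → Fin d → ℝ) (r : ℝ≥0) : Fin d → ℝ :=
  fun i => jump (fun t => f t i) r

/-- The sum of `g (Δf(r))` over `s < r ≤ t`. -/
noncomputable def jumpSum (g : (Fin d → ℝ) → ℝ) (f : ℝ≥0 → Fin d → ℝ) (s t : ℝ≥0) : ℝ :=
  ∑' r, (Set.Ioc s t).indicator (fun r => g (jumpVec f r)) r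

/-- The points of the uniform partition of `[s, t]` into `n` intervals. -/
noncomputable def grid (s t : ℝ≥0) (n i : ℕ) : ℝ≥0 := s + (i / n) * (t - s)

/-- The sum of `g` over the increments of `f` along the uniform partition. -/
noncomputable def gridSum (g : (Fin d → ℝ) → ℝ) (f : ℝ≥0 → Fin d → ℝ) (s t : ℝ≥0) (n : ℕ) : ℝ :=
  ∑ i ∈ Finset.range n, g (f (grid s t n (i + 1)) - f (grid s t n i))

lemma CylLevy.IsCadlag.tendsto_leftLim {f : ℝ≥0 → ℝ} (hf : IsCadlag f) (r : ℝ≥0) :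
    Tendsto f (𝓝[<] r) (𝓝 (Function.leftLim f r)) := by
  obtain ⟨l, hl⟩ := (hf r).2
  exact tendsto_leftLim_of_tendsto ⟨l, hl⟩

lemma jump_zero (f : ℝ≥0 → ℝ) : jump f 0 = 0 := by
  have : Function.leftLim f 0 = f 0 := leftLim_eq_of_isBot (isBot_bot)
  simp [jump, this]

lemma jumpVec_zero (f : ℝ≥0 → Fin d → ℝ) : jumpVec f 0 = 0 := by
  ext i; exact jump_zero _

lemma IsCadlagPath.tendsto_right {f : ℝ≥0 → Fin d → ℝ} (hf : IsCadlagPath f) (r : ℝ≥0) :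
    Tendsto f (𝓝[≥] r) (𝓝 (f r)) :=
  tendsto_pi_nhds.2 fun i => (hf i r).1

lemma IsCadlagPath.tendsto_left {f : ℝ≥0 → Fin d → ℝ} (hf : IsCadlagPath f) (r : ℝ≥0) :
    Tendsto f (𝓝[<] r) (𝓝 (f r - jumpVec f r)) :=
  tendsto_pi_nhds.2 fun i => by
    simpa [jumpVec, jump] using CylLevy.IsCadlag.tendsto_leftLim (hf i) r

/-- Around `r`, increments that do not cross `r` are small, and those that cross `r` are close to
the jump at `r`. -/
lemma IsCadlagPath.exists_increment_control {f : ℝ≥0 → Fin d → ℝ} (hf : IsCadlagPath f)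
    (r : ℝ≥0) {η : ℝ} (hη : 0 < η) : ∃ W, IsOpen W ∧ r ∈ W ∧ ∀ u ∈ W, ∀ v ∈ W,
      (r ≤ u → r ≤ v → ‖f v - f u‖ ≤ η) ∧ (u < r → v < r → ‖f v - f u‖ ≤ η) ∧
      (u < r → r ≤ v → ‖f v - f u - jumpVec f r‖ ≤ η) := by
  have h1 : ∀ᶠ u in 𝓝[≥] r, dist (f u) (f r) < η / 2 :=
    (Metric.tendsto_nhds.1 (hf.tendsto_right r)) _ (half_pos hη)
  have h2 : ∀ᶠ u in 𝓝[<] r, dist (f u) (f r - jumpVec f r) < η / 2 :=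
    (Metric.tendsto_nhds.1 (hf.tendsto_left r)) _ (half_pos hη)
  rw [eventually_nhdsWithin_iff] at h1 h2
  obtain ⟨W, hW, hWo, hrW⟩ := eventually_nhds_iff.1 (h1.and h2)
  refine ⟨W, hWo, hrW, fun u hu v hv => ⟨fun h h' => ?_, fun h h' => ?_, fun h h' => ?_⟩⟩
  · have a := (hW u hu).1 h
    have b := (hW v hv).1 h'
    rw [← dist_eq_norm]
    linarith [dist_triangle_right (f v) (f u) (f r)]
  · have a := (hW u hu).2 h
    have b := (hW v hv).2 h'
    rw [← dist_eq_norm]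
    linarith [dist_triangle_right (f v) (f u) (f r - jumpVec f r)]
  · have a := (hW u hu).2 h
    have b := (hW v hv).1 h'
    have e : f v - f u - jumpVec f r = (f v - f r) - (f u - (f r - jumpVec f r)) := by abel
    rw [e]
    rw [dist_eq_norm] at a b
    linarith [norm_sub_le (f v - f r) (f u - (f r - jumpVec f r))]

lemma norm_jumpVec_le {f : ℝ≥0 → Fin d → ℝ} (hf : IsCadlagPath f) {u : ℝ≥0} (hu : 0 < u) {c : ℝ}
    (h : ∀ᶠ v in 𝓝[<] u, ‖f u - f v‖ ≤ c) : ‖jumpVec f u‖ ≤ c := by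
  have : (𝓝[<] u).NeBot := nhdsLT_neBot_of_exists_lt ⟨0, hu⟩
  have : Tendsto (fun v => ‖f u - f v‖) (𝓝[<] u) (𝓝 ‖f u - (f u - jumpVec f u)‖) :=
    (tendsto_const_nhds.sub (hf.tendsto_left u)).norm
  rw [sub_sub_cancel] at this
  exact le_of_tendsto this h

/-- On a bounded interval a càdlàg path has finitely many jumps larger than `ε`. -/
lemma IsCadlagPath.finite_bigJumps {f : ℝ≥0 → Fin d → ℝ} (hf : IsCadlagPath f) {ε : ℝ}
    (hε : 0 < ε) (s t : ℝ≥0) : {r ∈ Set.Ioc s t | ε < ‖jumpVec f r‖}.Finite := by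
  by_contra hinf
  obtain ⟨x, hx, hacc⟩ := Set.Infinite.exists_accPt_of_subset_isCompact hinf
    (isCompact_Icc (a := s) (b := t)) (fun r hr => Set.Ioc_subset_Icc_self hr.1)
  rw [accPt_iff_frequently_nhdsNE] at hacc
  refine hacc ?_
  -- Close to an accumulation point `x`, the jump at `u ≠ x` is a limit of increments that do not
  -- cross `x`, so it cannot exceed `ε`.
  obtain ⟨W, hWo, hxW, hW⟩ := hf.exists_increment_control x hε
  filter_upwards [nhdsWithin_le_nhds (hWo.mem_nhds hxW), self_mem_nhdsWithin] with u huW hux hu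
  have hu0 : 0 < u := lt_of_le_of_lt (zero_le) hu.1.1
  refine not_le.2 hu.2 (norm_jumpVec_le hf hu0 ?_)
  have hWu : ∀ᶠ v in 𝓝[<] u, v ∈ W := nhdsWithin_le_nhds (hWo.mem_nhds huW)
  rcases lt_or_gt_of_ne hux with h | h
  · filter_upwards [hWu, self_mem_nhdsWithin] with v hv hvu
    exact (hW v hv u huW).2.1 (lt_trans hvu h) h
  · filter_upwards [hWu, nhdsWithin_le_nhds (lt_mem_nhds h)] with v hv hxv
    exact (hW v hv u huW).1 hxv.le h.le

/-- Take `δ` a Lebesgue number of the cover by the neighbourhoods of `exists_increment_control`. A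
short interval then sees a single centre `r`, and its increment is within `ε / 2` either of `0` or
of the jump at `r`. -/
lemma IsCadlagPath.exists_mesh {f : ℝ≥0 → Fin d → ℝ} (hf : IsCadlagPath f) {ε : ℝ}
    (hε : 0 < ε) (s t : ℝ≥0) : ∃ δ > 0, ∀ u v, s ≤ u → u ≤ v → v ≤ t → dist v u < δ →
      ‖f v - f u‖ ≤ ε ∨ ∃ r ∈ {r ∈ Set.Ioc s t | ε / 2 < ‖jumpVec f r‖}, r ∈ Set.Ioc u v := by
  choose W hWo hW hWp using fun r => hf.exists_increment_control r (half_pos hε)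
  obtain ⟨δ, hδ, H⟩ := lebesgue_number_lemma_of_metric (isCompact_Icc (a := s) (b := t))
    (c := W) hWo (fun r _ => Set.mem_iUnion.2 ⟨r, hW r⟩)
  refine ⟨δ, hδ, fun u v hu huv hv hd => ?_⟩
  obtain ⟨r, hr⟩ := H u ⟨hu, huv.trans hv⟩
  have hu' : u ∈ W r := hr (Metric.mem_ball_self hδ)
  have hv' : v ∈ W r := hr hd
  obtain ⟨h1, h2, h3⟩ := hWp r u hu' v hv'
  rcases le_or_gt r u with h | h
  · left; linarith [h1 h (h.trans huv)]
  rcases lt_or_ge v r with h' | h'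
  · left; linarith [h2 h h']
  by_cases hJ : ε / 2 < ‖jumpVec f r‖
  · right; exact ⟨r, ⟨⟨hu.trans_lt h, h'.trans hv⟩, hJ⟩, h, h'⟩
  · left
    have := norm_add_le (f v - f u - jumpVec f r) (jumpVec f r)
    rw [sub_add_cancel] at this
    linarith [h3 h h']

lemma jumpSum_eq_sum {g : (Fin d → ℝ) → ℝ} {f : ℝ≥0 → Fin d → ℝ} {ε : ℝ} {s t : ℝ≥0}
    (hg : ∀ x, ‖x‖ ≤ ε → g x = 0) (hR : {r ∈ Set.Ioc s t | ε < ‖jumpVec f r‖}.Finite) :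
    jumpSum g f s t = ∑ r ∈ hR.toFinset, g (jumpVec f r) := by
  unfold jumpSum
  rw [tsum_eq_sum (s := hR.toFinset)]
  · refine Finset.sum_congr rfl fun r hr => ?_
    rw [Set.indicator_of_mem]
    exact (hR.mem_toFinset.1 hr).1
  · intro r hr
    rw [Set.indicator_apply_eq_zero]
    intro hr'
    refine hg _ (not_lt.1 fun h => hr (hR.mem_toFinset.2 ⟨hr', h⟩))

lemma grid_zero (s t : ℝ≥0) (n : ℕ) : grid s t n 0 = s := by simp [grid]

lemma grid_self {s t : ℝ≥0} (h : s ≤ t) {n : ℕ} (hn : n ≠ 0) : grid s t n n = t := by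
  have : (n : ℝ≥0) ≠ 0 := by exact_mod_cast hn
  simp [grid, div_self this, add_tsub_cancel_of_le h]

lemma grid_succ (s t : ℝ≥0) (n i : ℕ) : grid s t n (i + 1) = grid s t n i + (t - s) / n := by
  simp only [grid]; push_cast; ring

lemma grid_mono (s t : ℝ≥0) (n : ℕ) : Monotone (grid s t n) :=
  monotone_nat_of_le_succ fun i => by rw [grid_succ]; exact le_self_add

lemma dist_grid_succ (s t : ℝ≥0) (n i : ℕ) :
    dist (grid s t n (i + 1)) (grid s t n i) = ((t - s : ℝ≥0) : ℝ) / n := by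
  rw [grid_succ, NNReal.dist_eq]; push_cast
  rw [add_sub_cancel_left, abs_of_nonneg (by positivity)]

lemma exists_grid_interval {s t : ℝ≥0} (h : s ≤ t) {n : ℕ} (hn : n ≠ 0) {r : ℝ≥0}
    (hr : r ∈ Set.Ioc s t) : ∃ i < n, r ∈ Set.Ioc (grid s t n i) (grid s t n (i + 1)) := by
  classical
  have hex : ∃ k, r ≤ grid s t n k := ⟨n, by rw [grid_self h hn]; exact hr.2⟩
  have h0 : Nat.find hex ≠ 0 := by
    intro h0
    have := Nat.find_spec hex
    rw [h0, grid_zero] at this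
    exact absurd hr.1 (not_lt.2 this)
  obtain ⟨i, hi⟩ := Nat.exists_eq_succ_of_ne_zero h0
  refine ⟨i, ?_, ?_, ?_⟩
  · have : Nat.find hex ≤ n := Nat.find_min' hex (by rw [grid_self h hn]; exact hr.2)
    omega
  · exact not_le.1 (Nat.find_min hex (by omega))
  · have := Nat.find_spec hex
    rwa [hi] at this

/-- For a continuous `g` that vanishes near `0`, the sums of `g` over the increments along uniform
partitions converge to the sum of `g` over the jumps. -/
lemma IsCadlagPath.tendsto_gridSum {f : ℝ≥0 → Fin d → ℝ} (hf : IsCadlagPath f)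
    {g : (Fin d → ℝ) → ℝ} (hg : Continuous g) {ε : ℝ} (hε : 0 < ε)
    (hg0 : ∀ x, ‖x‖ ≤ ε → g x = 0) {s t : ℝ≥0} (hst : s ≤ t) :
    Tendsto (gridSum g f s t) atTop (𝓝 (jumpSum g f s t)) := by
  classical
  have hR := hf.finite_bigJumps (half_pos hε) s t
  set R := hR.toFinset with hRdef
  have hmemR : ∀ r, r ∈ R ↔ r ∈ {r ∈ Set.Ioc s t | ε / 2 < ‖jumpVec f r‖} :=
    fun r => hR.mem_toFinset
  rw [jumpSum_eq_sum (fun x hx => hg0 x (by linarith)) hR]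
  -- The grid interval that contains the big jump time `r`, made total in `n` and `r` with default
  -- value `0`.
  have hidx : ∀ (n : ℕ) (r : ℝ≥0), ∃ i : ℕ, n ≠ 0 → r ∈ R →
      i < n ∧ r ∈ Set.Ioc (grid s t n i) (grid s t n (i + 1)) := by
    intro n r
    by_cases h : n ≠ 0 ∧ r ∈ R
    · obtain ⟨i, hi⟩ := exists_grid_interval hst h.1 ((hmemR r).1 h.2).1
      exact ⟨i, fun _ _ => hi⟩
    · exact ⟨0, fun h1 h2 => absurd ⟨h1, h2⟩ h⟩
  choose idx hidx using hidx
  have hmesh : Tendsto (fun n : ℕ => ((t - s : ℝ≥0) : ℝ) / n) atTop (𝓝 0) :=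
    tendsto_const_div_atTop_nhds_zero_nat _
  obtain ⟨δ, hδ, Hδ⟩ := hf.exists_mesh hε s t
  -- Once the mesh is below the gaps between big jump times, no grid interval contains two of them.
  have hinj : ∀ᶠ n : ℕ in atTop, ∀ r ∈ R, ∀ r' ∈ R, r ≠ r' →
      ((t - s : ℝ≥0) : ℝ) / n < dist r r' := by
    rw [Filter.eventually_all_finset]; intro r _
    rw [Filter.eventually_all_finset]; intro r' _
    by_cases h : r = r'
    · simp [h]
    · filter_upwards [(tendsto_order.1 hmesh).2 _ (dist_pos.2 h)] with n hn _ using hn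
  have hEq : (fun n => ∑ r ∈ R, g (f (grid s t n (idx n r + 1)) - f (grid s t n (idx n r))))
      =ᶠ[atTop] gridSum g f s t := by
    filter_upwards [hinj, (tendsto_order.1 hmesh).2 _ hδ, eventually_ne_atTop 0]
      with n hn hnδ hn0
    have hI : Set.InjOn (idx n) R := by
      intro r hr r' hr' he
      by_contra hne
      have h1 := (hidx n r hn0 hr).2
      have h2 := (hidx n r' hn0 hr').2
      rw [← he] at h2
      refine absurd (hn r hr r' hr' hne) (not_lt.2 ?_)
      rw [← dist_grid_succ s t n (idx n r), NNReal.dist_eq, NNReal.dist_eq, abs_le]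
      have a1 : (grid s t n (idx n r) : ℝ) < r := by exact_mod_cast h1.1
      have a2 : (r : ℝ) ≤ grid s t n (idx n r + 1) := by exact_mod_cast h1.2
      have a3 : (grid s t n (idx n r) : ℝ) < r' := by exact_mod_cast h2.1
      have a4 : (r' : ℝ) ≤ grid s t n (idx n r + 1) := by exact_mod_cast h2.2
      rw [abs_of_nonneg (by linarith)]
      constructor <;> linarith
    rw [← Finset.sum_image (f := fun i => g (f (grid s t n (i + 1)) - f (grid s t n i))) hI]
    refine Finset.sum_subset ?_ ?_
    · intro i hi
      obtain ⟨r, hr, rfl⟩ := Finset.mem_image.1 hi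
      exact Finset.mem_range.2 (hidx n r hn0 hr).1
    -- An interval not of the form `idx n r` contains no big jump, so its increment is at most `ε`,
    -- where `g` vanishes.
    · intro i hi hni
      refine hg0 _ ?_
      have hin : i + 1 ≤ n := Finset.mem_range.1 hi
      refine (Hδ _ _ ?_ (grid_mono s t n (Nat.le_succ i)) ?_ ?_).resolve_right ?_
      · exact (grid_zero s t n).symm.le.trans (grid_mono s t n (Nat.zero_le i))
      · exact (grid_mono s t n hin).trans (grid_self hst hn0).le
      · rw [dist_grid_succ]; exact hnδ
      · rintro ⟨r, hr, hri⟩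
        have hrR := (hmemR r).2 hr
        have h1 := (hidx n r hn0 hrR).2
        refine hni (Finset.mem_image.2 ⟨r, hrR, ?_⟩)
        by_contra hne
        rcases lt_or_gt_of_ne hne with h | h
        · have := grid_mono s t n (show idx n r + 1 ≤ i from h)
          exact absurd (hri.1.trans_le (h1.2.trans this)) (lt_irrefl _)
        · have := grid_mono s t n (show i + 1 ≤ idx n r from h)
          exact absurd (h1.1.trans_le (hri.2.trans this)) (lt_irrefl _)
  -- The sum now runs over the fixed finite set `R`, and the increment across `r` tends to the jump
  -- at `r`.
  refine Tendsto.congr' hEq (tendsto_finsetSum _ fun r hr => ?_)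
  refine (hg.tendsto _).comp ?_
  rw [Metric.tendsto_nhds]
  intro η hη
  obtain ⟨W, hWo, hrW, hW⟩ := hf.exists_increment_control r (half_pos hη)
  obtain ⟨ρ, hρ, hball⟩ := Metric.isOpen_iff.1 hWo r hrW
  filter_upwards [(tendsto_order.1 hmesh).2 _ hρ, eventually_ne_atTop 0] with n hn hn0
  have h1 := (hidx n r hn0 hr).2
  have a1 : (grid s t n (idx n r) : ℝ) < r := by exact_mod_cast h1.1
  have a2 : (r : ℝ) ≤ grid s t n (idx n r + 1) := by exact_mod_cast h1.2
  rw [← dist_grid_succ s t n (idx n r), NNReal.dist_eq, abs_of_nonneg (by linarith)] at hn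
  have := (hW (grid s t n (idx n r)) (hball ?_) (grid s t n (idx n r + 1)) (hball ?_)).2.2
    h1.1 h1.2
  · rw [dist_eq_norm]; linarith
  · rw [Metric.mem_ball, NNReal.dist_eq, abs_lt]; constructor <;> linarith
  · rw [Metric.mem_ball, NNReal.dist_eq, abs_lt]; constructor <;> linarith

end Paths

/-! ### Limits of independent families, moments of limits -/

section Limits

variable {Ω : Type*} {mΩ : MeasurableSpace Ω} {P : Measure Ω}

/-- Grouping an independent family gives an independent family. -/
lemma iIndepFun.curry {ι : Type*} {κ : ι → Type*} {𝓧 : (i : ι) → κ i → Type*}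
    {m𝓧 : ∀ i j, MeasurableSpace (𝓧 i j)} {X : (i : ι) → (j : κ i) → Ω → 𝓧 i j}
    (mX : ∀ i j, Measurable (X i j))
    (h : iIndepFun (fun (p : (i : ι) × (κ i)) ω ↦ X p.1 p.2 ω) P) :
    iIndepFun (fun i ω ↦ (X i · ω)) P := by
  have := h.isProbabilityMeasure
  have : ∀ i j, IsProbabilityMeasure (P.map (X i j)) :=
    fun i j ↦ Measure.isProbabilityMeasure_map (mX i j).aemeasurable
  have e : (MeasurableEquiv.piCurry 𝓧) ∘ (fun ω p ↦ X p.1 p.2 ω) = fun ω i j ↦ X i j ω := by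
    ext; simp [Sigma.curry]
  rw [iIndepFun_iff_map_fun_eq_infinitePi_map (by fun_prop), ← e,
    ← Measure.map_map (by fun_prop) (by fun_prop),
    (iIndepFun_iff_map_fun_eq_infinitePi_map (by fun_prop)).1 h,
    Measure.infinitePi_map_piCurry (fun i j ↦ P.map (X i j))]
  congr 1
  funext i
  have hi : iIndepFun (X i) P :=
    h.precomp (g := fun j : κ i => (⟨i, j⟩ : (i : ι) × κ i)) sigma_mk_injective
  rw [(iIndepFun_iff_map_fun_eq_infinitePi_map (by fun_prop)).1 hi]

variable [IsProbabilityMeasure P]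

lemma tendsto_charFun_map {E : Type*} [NormedAddCommGroup E] [InnerProductSpace ℝ E]
    [MeasurableSpace E] [BorelSpace E] [SecondCountableTopology E]
    {Y : ℕ → Ω → E} {Z : Ω → E} (hY : ∀ n, AEMeasurable (Y n) P) (hZ : AEMeasurable Z P)
    (h : ∀ᵐ ω ∂P, Tendsto (fun n => Y n ω) atTop (𝓝 (Z ω))) (t : E) :
    Tendsto (fun n => charFun (P.map (Y n)) t) atTop (𝓝 (charFun (P.map Z) t)) := by
  have hc : Continuous fun x : E => Complex.exp ((inner ℝ x t : ℝ) * Complex.I) := by fun_prop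
  simp only [charFun_apply]
  rw [integral_map hZ hc.aestronglyMeasurable]
  simp_rw [fun n => integral_map (hY n)
    (hc.aestronglyMeasurable (μ := P.map (Y n)))]
  refine tendsto_integral_of_dominated_convergence (fun _ => 1) (fun n => ?_)
    (integrable_const _) (fun n => ?_) ?_
  · exact (hc.measurable.comp_aemeasurable (hY n)).aestronglyMeasurable
  · exact ae_of_all _ fun ω => (Complex.norm_exp_ofReal_mul_I _).le
  · filter_upwards [h] with ω hω using (hc.tendsto _).comp hω

/-- Independence is the factorisation of the joint characteristic function, and this survives almost
sure limits. -/
lemma iIndepFun_of_tendsto_ae {ι : Type*} [Fintype ι] {Y : ℕ → ι → Ω → ℝ} {Z : ι → Ω → ℝ}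
    (hY : ∀ n i, AEMeasurable (Y n i) P) (hind : ∀ n, iIndepFun (Y n) P)
    (h : ∀ i, ∀ᵐ ω ∂P, Tendsto (fun n => Y n i ω) atTop (𝓝 (Z i ω))) : iIndepFun Z P := by
  have hZ : ∀ i, AEMeasurable (Z i) P :=
    fun i => aemeasurable_of_tendsto_metrizable_ae' (fun n => hY n i) (h i)
  rw [iIndepFun_iff_charFun_pi hZ]
  intro t
  have h1 : Tendsto (fun n => charFun (P.map (fun ω ↦ WithLp.toLp 2 (Y n · ω))) t) atTop
      (𝓝 (charFun (P.map (fun ω ↦ WithLp.toLp 2 (Z · ω))) t)) := by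
    refine tendsto_charFun_map (fun n => ?_) ?_ ?_ t
    · exact (WithLp.measurable_toLp 2 _).comp_aemeasurable (aemeasurable_pi_lambda _ (hY n))
    · exact (WithLp.measurable_toLp 2 _).comp_aemeasurable (aemeasurable_pi_lambda _ hZ)
    · filter_upwards [ae_all_iff.2 h] with ω hω
      exact ((PiLp.continuous_toLp 2 _).tendsto _).comp (tendsto_pi_nhds.2 hω)
  have h2 : Tendsto (fun n => ∏ i, charFun (P.map (Y n i)) (t i)) atTop
      (𝓝 (∏ i, charFun (P.map (Z i)) (t i))) :=
    tendsto_finsetProd _ fun i _ => tendsto_charFun_map (fun n => hY n i) (hZ i) (h i) _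
  refine tendsto_nhds_unique h1 (h2.congr fun n => ?_)
  exact ((iIndepFun_iff_charFun_pi (hY n)).1 (hind n) t).symm

lemma identDistrib_of_tendsto_ae {Y Y' : ℕ → Ω → ℝ} {Z Z' : Ω → ℝ}
    (hid : ∀ n, IdentDistrib (Y n) (Y' n) P P)
    (h : ∀ᵐ ω ∂P, Tendsto (fun n => Y n ω) atTop (𝓝 (Z ω)))
    (h' : ∀ᵐ ω ∂P, Tendsto (fun n => Y' n ω) atTop (𝓝 (Z' ω))) : IdentDistrib Z Z' P P := by
  have hZ := aemeasurable_of_tendsto_metrizable_ae' (fun n => (hid n).aemeasurable_fst) h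
  have hZ' := aemeasurable_of_tendsto_metrizable_ae' (fun n => (hid n).aemeasurable_snd) h'
  have := Measure.isProbabilityMeasure_map hZ
  have := Measure.isProbabilityMeasure_map hZ'
  refine ⟨hZ, hZ', Measure.ext_of_charFun (funext fun t => ?_)⟩
  refine tendsto_nhds_unique
    (tendsto_charFun_map (fun n => (hid n).aemeasurable_fst) hZ h t) ?_
  refine (tendsto_charFun_map (fun n => (hid n).aemeasurable_snd) hZ' h' t).congr fun n => ?_
  rw [(hid n).map_eq]

omit [IsProbabilityMeasure P] in
lemma memLp_two_of_lintegral_sq_lt_top {Y : Ω → ℝ} (hY : AEStronglyMeasurable Y P)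
    (h : ∫⁻ ω, ENNReal.ofReal (Y ω ^ 2) ∂P < ∞) : MemLp Y 2 P := by
  rw [memLp_two_iff_integrable_sq hY]
  refine ⟨(hY.pow 2), ?_⟩
  rw [hasFiniteIntegral_iff_ofReal (ae_of_all _ fun ω => sq_nonneg _)]
  exact h

omit [IsProbabilityMeasure P] in
/-- Fatou's lemma for second moments. -/
lemma memLp_two_of_tendsto_ae {Y : ℕ → Ω → ℝ} {Z : Ω → ℝ} {c : ℕ → ℝ} {b : ℝ}
    (hY : ∀ n, MemLp (Y n) 2 P) (h : ∀ᵐ ω ∂P, Tendsto (fun n => Y n ω) atTop (𝓝 (Z ω)))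
    (hc : ∀ n, ∫ ω, Y n ω ^ 2 ∂P ≤ c n) (hcb : Tendsto c atTop (𝓝 b)) :
    MemLp Z 2 P ∧ ∫ ω, Z ω ^ 2 ∂P ≤ b := by
  have hZ : AEStronglyMeasurable Z P :=
    (aemeasurable_of_tendsto_metrizable_ae' (fun n => (hY n).1.aemeasurable) h).aestronglyMeasurable
  have hb : 0 ≤ b := ge_of_tendsto' hcb fun n => (integral_nonneg fun ω => sq_nonneg _).trans (hc n)
  have key : ∫⁻ ω, ENNReal.ofReal (Z ω ^ 2) ∂P ≤ ENNReal.ofReal b := by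
    calc ∫⁻ ω, ENNReal.ofReal (Z ω ^ 2) ∂P
        = ∫⁻ ω, liminf (fun n => ENNReal.ofReal (Y n ω ^ 2)) atTop ∂P := by
          refine lintegral_congr_ae ?_
          filter_upwards [h] with ω hω
          exact ((ENNReal.tendsto_ofReal (hω.pow 2)).liminf_eq).symm
      _ ≤ liminf (fun n => ∫⁻ ω, ENNReal.ofReal (Y n ω ^ 2) ∂P) atTop :=
          lintegral_liminf_le' fun n => ((hY n).1.aemeasurable.pow_const 2).ennreal_ofReal
      _ ≤ liminf (fun n => ENNReal.ofReal (c n)) atTop := by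
          refine liminf_le_liminf (Eventually.of_forall fun n => ?_)
          rw [← ofReal_integral_eq_lintegral_ofReal (hY n).integrable_sq
            (ae_of_all _ fun ω => sq_nonneg _)]
          exact ENNReal.ofReal_le_ofReal (hc n)
      _ = ENNReal.ofReal b := (ENNReal.tendsto_ofReal hcb).liminf_eq
  have hZm := memLp_two_of_lintegral_sq_lt_top hZ (key.trans_lt ENNReal.ofReal_lt_top)
  refine ⟨hZm, ?_⟩
  rw [← ofReal_integral_eq_lintegral_ofReal hZm.integrable_sq
    (ae_of_all _ fun ω => sq_nonneg _)] at key
  exact (ENNReal.ofReal_le_ofReal_iff hb).1 key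

lemma abs_sub_clip_le {K : ℝ} (hK : 0 < K) (y : ℝ) : |y - max (-K) (min y K)| ≤ y ^ 2 / K := by
  rw [le_div_iff₀ hK]
  rcases le_total y K with h | h
  · rw [min_eq_left h]
    rcases le_total (-K) y with h' | h'
    · rw [max_eq_right h']; simp; positivity
    · rw [max_eq_left h', abs_of_nonpos (by linarith)]; nlinarith
  · rw [min_eq_right h, max_eq_right (by linarith), abs_of_nonneg (by linarith)]; nlinarith

lemma abs_clip_le {K : ℝ} (hK : 0 < K) (y : ℝ) : |max (-K) (min y K)| ≤ K := by
  rw [abs_le]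
  exact ⟨le_max_left _ _, max_le (by linarith) (min_le_right _ _)⟩

/-- Expectations converge along an almost surely convergent `L²`-bounded sequence. -/
lemma tendsto_integral_of_sq_bounded {Y : ℕ → Ω → ℝ} {Z : Ω → ℝ} {C : ℝ}
    (hY : ∀ n, MemLp (Y n) 2 P) (h : ∀ᵐ ω ∂P, Tendsto (fun n => Y n ω) atTop (𝓝 (Z ω)))
    (hC : ∀ n, ∫ ω, Y n ω ^ 2 ∂P ≤ C) :
    Tendsto (fun n => ∫ ω, Y n ω ∂P) atTop (𝓝 (∫ ω, Z ω ∂P)) := by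
  obtain ⟨hZ, hZC⟩ := memLp_two_of_tendsto_ae hY h hC tendsto_const_nhds
  have hC0 : 0 ≤ C := (integral_nonneg fun ω => sq_nonneg _).trans (hC 0)
  have hmeas : ∀ (K : ℝ) {X : Ω → ℝ}, MemLp X 2 P →
      AEStronglyMeasurable (fun ω => max (-K) (min (X ω) K)) P := fun K X hX =>
    (by fun_prop : Continuous fun y : ℝ => max (-K) (min y K)).comp_aestronglyMeasurable hX.1
  have hint : ∀ {K : ℝ}, 0 < K → ∀ {X : Ω → ℝ}, MemLp X 2 P →
      Integrable (fun ω => max (-K) (min (X ω) K)) P := fun {K} hK X hX =>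
    Integrable.of_bound (hmeas K hX) K (ae_of_all _ fun ω => abs_clip_le hK _)
  -- Clipping at `±K` costs at most `C / K` in expectation, uniformly in `n` and also for the limit,
  -- by Fatou. The clipped variables converge boundedly.
  have hdiff : ∀ {K : ℝ}, 0 < K → ∀ {X : Ω → ℝ}, MemLp X 2 P → ∫ ω, X ω ^ 2 ∂P ≤ C →
      |∫ ω, X ω ∂P - ∫ ω, max (-K) (min (X ω) K) ∂P| ≤ C / K := by
    intro K hK X hX hXC
    rw [← integral_sub (hX.integrable (by norm_num)) (hint hK hX)]
    refine (abs_integral_le_integral_abs).trans ?_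
    calc ∫ ω, |X ω - max (-K) (min (X ω) K)| ∂P ≤ ∫ ω, X ω ^ 2 / K ∂P :=
          integral_mono_of_nonneg (ae_of_all _ fun ω => abs_nonneg _) (hX.integrable_sq.div_const K)
            (ae_of_all _ fun ω => abs_sub_clip_le hK _)
      _ = (∫ ω, X ω ^ 2 ∂P) / K := integral_div _ _
      _ ≤ C / K := by gcongr
  rw [Metric.tendsto_atTop]
  intro η hη
  obtain ⟨K, hK, hKη⟩ : ∃ K : ℝ, 0 < K ∧ C / K < η / 3 := by
    refine ⟨3 * (C + 1) / η, by positivity, ?_⟩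
    rw [div_lt_iff₀ (by positivity)]
    have : η / 3 * (3 * (C + 1) / η) = C + 1 := by field_simp
    rw [this]; linarith
  have hlim : Tendsto (fun n => ∫ ω, max (-K) (min (Y n ω) K) ∂P) atTop
      (𝓝 (∫ ω, max (-K) (min (Z ω) K) ∂P)) := by
    refine tendsto_integral_of_dominated_convergence (fun _ => K) (fun n => hmeas K (hY n))
      (integrable_const _) (fun n => ae_of_all _ fun ω => abs_clip_le hK _) ?_
    filter_upwards [h] with ω hω
    exact ((by fun_prop : Continuous fun y : ℝ => max (-K) (min y K)).tendsto _).comp hω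
  obtain ⟨N, hN⟩ := (Metric.tendsto_atTop.1 hlim) (η / 3) (by positivity)
  refine ⟨N, fun n hn => ?_⟩
  have h1 := hdiff hK (hY n) (hC n)
  have h2 := hdiff hK hZ hZC
  have h3 := hN n hn
  rw [Real.dist_eq, abs_lt] at *
  rw [abs_le] at h1 h2
  constructor <;> linarith

/-- A nonnegative additive function on `ℝ≥0` is linear. -/
lemma eq_mul_of_additive {φ : ℝ≥0 → ℝ} (h0 : ∀ t, 0 ≤ φ t) (hadd : ∀ s t, φ (s + t) = φ s + φ t)
    (t : ℝ≥0) : φ t = t * φ 1 := by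
  have hmono : Monotone φ := fun s t h => by
    obtain ⟨r, rfl⟩ := exists_add_of_le h
    rw [hadd]; linarith [h0 r]
  have hz : φ 0 = 0 := by have := hadd 0 0; simp at this; exact this
  have hnat : ∀ (n : ℕ) (s : ℝ≥0), φ (n * s) = n * φ s := by
    intro n s
    induction n with
    | zero => simp [hz]
    | succ k ih => push_cast; rw [add_mul, hadd, ih]; simp; ring
  -- With `k = ⌊n t⌋`, both `φ (n t) = n φ t` and `n t φ 1` lie between `k φ 1` and `(k + 1) φ 1`.
  have hb : ∀ n : ℕ, 0 < n → |φ t - t * φ 1| ≤ φ 1 / n := by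
    intro n hn
    have hn' : (0 : ℝ) < n := by exact_mod_cast hn
    set k := ⌊(n : ℝ≥0) * t⌋₊
    have hk1 : (k : ℝ≥0) ≤ n * t := Nat.floor_le (zero_le)
    have hk2 : (n : ℝ≥0) * t ≤ (k + 1 : ℕ) := by
      push_cast; exact (Nat.lt_floor_add_one _).le
    have e1 := hmono hk1
    have e2 := hmono hk2
    rw [hnat] at e1 e2
    have e3 : φ (k : ℝ≥0) = k * φ 1 := by simpa using hnat k 1
    have e4 : φ ((k + 1 : ℕ) : ℝ≥0) = (k + 1) * φ 1 := by simpa using hnat (k + 1) 1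
    rw [e3] at e1
    rw [e4] at e2
    have hk1' : (k : ℝ) ≤ n * t := by exact_mod_cast hk1
    have hk2' : (n : ℝ) * t ≤ k + 1 := by exact_mod_cast hk2
    have hp := h0 1
    rw [le_div_iff₀ hn', ← abs_of_pos hn', ← abs_mul, abs_le]
    constructor <;> nlinarith
  have hlim : Tendsto (fun n : ℕ => φ 1 / n) atTop (𝓝 0) := tendsto_const_div_atTop_nhds_zero_nat _
  have : |φ t - t * φ 1| ≤ 0 :=
    ge_of_tendsto hlim ((eventually_gt_atTop 0).mono fun n hn => hb n hn)
  linarith [abs_nonpos_iff.1 this]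

end Limits

/-! ### Algebra and convergence of jump sums -/

section JumpSums

variable {d : ℕ} {f : ℝ≥0 → Fin d → ℝ} {s t u : ℝ≥0}

/-- `g` vanishes in a neighbourhood of `0`. -/
def VanishesNearZero (g : (Fin d → ℝ) → ℝ) : Prop := ∃ ε > 0, ∀ x, ‖x‖ ≤ ε → g x = 0

/-- The sum of `‖Δf(r)‖²` over `s < r ≤ t`. -/
noncomputable def sqJumps (f : ℝ≥0 → Fin d → ℝ) (s t : ℝ≥0) : ℝ≥0∞ :=
  ∑' r, (Set.Ioc s t).indicator (fun r => ENNReal.ofReal (‖jumpVec f r‖ ^ 2)) r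

lemma IsCadlagPath.summable_jumps (hf : IsCadlagPath f) {g : (Fin d → ℝ) → ℝ}
    (hg : VanishesNearZero g) (s t : ℝ≥0) :
    Summable ((Set.Ioc s t).indicator (fun r => g (jumpVec f r))) := by
  obtain ⟨ε, hε, h0⟩ := hg
  refine summable_of_hasFiniteSupport ((hf.finite_bigJumps hε s t).subset fun r hr => ?_)
  rw [Function.mem_support] at hr
  have hrm := Set.mem_of_indicator_ne_zero hr
  rw [Set.indicator_of_mem hrm] at hr
  exact ⟨hrm, not_le.1 fun h => hr (h0 _ h)⟩

lemma IsCadlagPath.jumpSum_lin (hf : IsCadlagPath f) {g h : (Fin d → ℝ) → ℝ}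
    (hg : VanishesNearZero g) (hh : VanishesNearZero h) (a b : ℝ) (s t : ℝ≥0) :
    jumpSum (fun x => a * g x + b * h x) f s t = a * jumpSum g f s t + b * jumpSum h f s t := by
  unfold jumpSum
  rw [← tsum_mul_left, ← tsum_mul_left, ← Summable.tsum_add
    ((hf.summable_jumps hg s t).mul_left a) ((hf.summable_jumps hh s t).mul_left b)]
  refine tsum_congr fun r => ?_
  by_cases hr : r ∈ Set.Ioc s t <;> simp [hr, -Set.mem_Ioc]

lemma IsCadlagPath.jumpSum_add_interval (hf : IsCadlagPath f) {g : (Fin d → ℝ) → ℝ}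
    (hg : VanishesNearZero g) (hst : s ≤ t) (htu : t ≤ u) :
    jumpSum g f s u = jumpSum g f s t + jumpSum g f t u := by
  unfold jumpSum
  rw [← Summable.tsum_add (hf.summable_jumps hg s t) (hf.summable_jumps hg t u)]
  refine tsum_congr fun r => ?_
  rw [← Set.Ioc_union_Ioc_eq_Ioc hst htu, Set.indicator_union_of_disjoint]
  exact Set.Ioc_disjoint_Ioc_of_le le_rfl

lemma jumpSum_self (g : (Fin d → ℝ) → ℝ) (s : ℝ≥0) : jumpSum g f s s = 0 := by
  simp [jumpSum]

lemma jumpSum_nonneg {g : (Fin d → ℝ) → ℝ} (h : ∀ x, 0 ≤ g x) : 0 ≤ jumpSum g f s t :=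
  tsum_nonneg fun _ => Set.indicator_nonneg (fun _ _ => h _) _

/-- The common neighbourhood of `0` confines all the sums to one finite set of jumps. -/
lemma IsCadlagPath.tendsto_jumpSum (hf : IsCadlagPath f) {g : (Fin d → ℝ) → ℝ}
    {G : ℕ → (Fin d → ℝ) → ℝ} {ε : ℝ} (hε : 0 < ε) (hG : ∀ k x, ‖x‖ ≤ ε → G k x = 0)
    (h : ∀ x, Tendsto (fun k => G k x) atTop (𝓝 (g x))) (s t : ℝ≥0) :
    Tendsto (fun k => jumpSum (G k) f s t) atTop (𝓝 (jumpSum g f s t)) := by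
  have hR := hf.finite_bigJumps hε s t
  have hg : ∀ x, ‖x‖ ≤ ε → g x = 0 := fun x hx =>
    tendsto_nhds_unique (h x) (by simp [hG _ x hx])
  rw [jumpSum_eq_sum hg hR]
  simp_rw [fun k => jumpSum_eq_sum (hG k) hR]
  exact tendsto_finsetSum _ fun r _ => h _

lemma tsum_sq_eq_sqJumps_toReal (h : sqJumps f s t ≠ ∞) :
    HasSum ((Set.Ioc s t).indicator fun r => ‖jumpVec f r‖ ^ 2) (sqJumps f s t).toReal := by
  have := ENNReal.hasSum_toReal h
  convert! this using 1
  · funext r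
    by_cases hr : r ∈ Set.Ioc s t <;> simp [hr, -Set.mem_Ioc]
  · rw [sqJumps, ENNReal.tsum_toReal_eq]
    exact fun r => ENNReal.ne_top_of_tsum_ne_top h r

lemma ofReal_abs_jumpSum_le {g : (Fin d → ℝ) → ℝ} {C : ℝ} (hC : 0 ≤ C)
    (hg : ∀ x, |g x| ≤ C * ‖x‖ ^ 2) :
    ENNReal.ofReal |jumpSum g f s t| ≤ ENNReal.ofReal C * sqJumps f s t := by
  -- Separated because `0 * ∞ = 0`: for `C = 0` an infinite `sqJumps` gives no bound.
  by_cases hC0 : C = 0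
  · have : jumpSum g f s t = 0 := by
      have : ∀ x, g x = 0 := fun x => abs_nonpos_iff.1 (by simpa [hC0] using hg x)
      simp [jumpSum, this]
    simp [this]
  by_cases h : sqJumps f s t = ∞
  · rw [h, ENNReal.mul_top]
    · exact le_top
    · simpa using lt_of_le_of_ne hC (Ne.symm hC0)
  have hs := (tsum_sq_eq_sqJumps_toReal h).mul_left C
  rw [← ENNReal.ofReal_toReal h, ← ENNReal.ofReal_mul hC]
  refine ENNReal.ofReal_le_ofReal ?_
  rw [← Real.norm_eq_abs]
  refine tsum_of_norm_bounded hs fun r => ?_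
  by_cases hr : r ∈ Set.Ioc s t
  · simp only [Set.indicator_of_mem hr]; exact hg _
  · simp [Set.indicator_of_notMem hr]

lemma tendsto_jumpSum_zero {ι : Type*} {l : Filter ι} {h : ι → (Fin d → ℝ) → ℝ} {C : ℝ}
    (hsq : sqJumps f s t ≠ ∞) (hh : ∀ᶠ i in l, ∀ x, |h i x| ≤ C * ‖x‖ ^ 2)
    (hlim : ∀ x, Tendsto (fun i => h i x) l (𝓝 0)) :
    Tendsto (fun i => jumpSum (h i) f s t) l (𝓝 0) := by
  have hs := (tsum_sq_eq_sqJumps_toReal hsq).mul_left C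
  have : Tendsto (fun i => jumpSum (h i) f s t) l (𝓝 (∑' _ : ℝ≥0, (0 : ℝ))) := by
    refine tendsto_tsum_of_dominated_convergence hs.summable (fun r => ?_) ?_
    · by_cases hr : r ∈ Set.Ioc s t
      · simp only [Set.indicator_of_mem hr]; exact hlim _
      · simp only [Set.indicator_of_notMem hr]; exact tendsto_const_nhds
    · filter_upwards [hh] with i hi r
      by_cases hr : r ∈ Set.Ioc s t
      · simp only [Set.indicator_of_mem hr]; exact hi _
      · simp [Set.indicator_of_notMem hr]
  simpa using this

/-- A continuous function that is `0` for `k r ≤ 1` and `1` for `k r ≥ 2`. -/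
noncomputable def cutoff (k r : ℝ) : ℝ := max 0 (min 1 (k * r - 1))

lemma cutoff_nonneg (k r : ℝ) : 0 ≤ cutoff k r := le_max_left _ _

lemma cutoff_le_one (k r : ℝ) : cutoff k r ≤ 1 := max_le zero_le_one (min_le_left _ _)

lemma cutoff_eq_zero {k r : ℝ} (h : k * r ≤ 1) : cutoff k r = 0 :=
  max_eq_left ((min_le_right _ _).trans (by linarith))

lemma cutoff_eq_one {k r : ℝ} (h : 2 ≤ k * r) : cutoff k r = 1 := by
  rw [cutoff, min_eq_left (by linarith), max_eq_right zero_le_one]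

lemma continuous_cutoff (k : ℝ) : Continuous (cutoff k) := by unfold cutoff; fun_prop

lemma eventually_cutoff_eq_one {r : ℝ} (hr : 0 < r) : ∀ᶠ k : ℕ in atTop, cutoff k r = 1 := by
  filter_upwards [eventually_ge_atTop ⌈2 / r⌉₊] with k hk
  refine cutoff_eq_one ?_
  rw [← div_le_iff₀ hr]
  exact (Nat.le_ceil _).trans (by exact_mod_cast hk)

/-- Lower semicontinuity of the quadratic variation along uniform partitions. -/
lemma IsCadlagPath.sqJumps_le_liminf (hf : IsCadlagPath f) (hst : s ≤ t) :
    sqJumps f s t ≤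
      liminf (fun n => ENNReal.ofReal (gridSum (fun x => ‖x‖ ^ 2) f s t n)) atTop := by
  -- `G k` is continuous, vanishes near `0` and increases to `‖x‖ ^ 2`. Its grid sums converge and
  -- lie below those of `‖x‖ ^ 2`; then `k → ∞` in finite partial sums over the jumps.
  set G : ℕ → (Fin d → ℝ) → ℝ := fun k x => cutoff k ‖x‖ * ‖x‖ ^ 2 with hG
  have hG0 : ∀ k x, 0 ≤ G k x := fun k x => mul_nonneg (cutoff_nonneg _ _) (by positivity)
  have hGle : ∀ k x, G k x ≤ ‖x‖ ^ 2 := fun k x =>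
    mul_le_of_le_one_left (by positivity) (cutoff_le_one _ _)
  have hGv : ∀ k : ℕ, ∀ x, ‖x‖ ≤ 1 / (k + 1 : ℝ) → G k x = 0 := fun k x hx => by
    have h1 : ((k : ℝ) + 1) * ‖x‖ ≤ 1 := by
      rw [le_div_iff₀ (by positivity)] at hx; linarith
    rw [hG]; simp only
    rw [cutoff_eq_zero (by nlinarith [norm_nonneg x]), zero_mul]
  have hpos : ∀ k : ℕ, (0 : ℝ) < 1 / (k + 1 : ℝ) := fun k => by positivity
  have key : ∀ k, ENNReal.ofReal (jumpSum (G k) f s t) ≤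
      liminf (fun n => ENNReal.ofReal (gridSum (fun x => ‖x‖ ^ 2) f s t n)) atTop := by
    intro k
    have hc : Continuous (G k) := ((continuous_cutoff k).comp continuous_norm).mul (by fun_prop)
    rw [← (ENNReal.tendsto_ofReal (hf.tendsto_gridSum hc (hpos k) (hGv k) hst)).liminf_eq]
    exact liminf_le_liminf (Eventually.of_forall fun n =>
      ENNReal.ofReal_le_ofReal (Finset.sum_le_sum fun i _ => hGle k _))
  refine ENNReal.summable.tsum_le_of_sum_le fun R => ?_
  have hlim : Tendsto (fun k => ∑ r ∈ R, (Set.Ioc s t).indicator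
      (fun r => ENNReal.ofReal (G k (jumpVec f r))) r) atTop
      (𝓝 (∑ r ∈ R, (Set.Ioc s t).indicator
        (fun r => ENNReal.ofReal (‖jumpVec f r‖ ^ 2)) r)) := by
    refine tendsto_finsetSum _ fun r _ => ?_
    by_cases hr : r ∈ Set.Ioc s t
    · simp only [Set.indicator_of_mem hr]
      refine ENNReal.tendsto_ofReal ?_
      by_cases hx : jumpVec f r = 0
      · simp [hG, hx]
      · refine tendsto_const_nhds.congr' ?_
        filter_upwards [eventually_cutoff_eq_one (norm_pos_iff.2 hx)] with k hk
        simp [hG, hk]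
    · simp only [Set.indicator_of_notMem hr]; exact tendsto_const_nhds
  refine le_of_tendsto' hlim fun k => (le_trans ?_ (key k))
  have hs := hf.summable_jumps ⟨_, hpos k, hGv k⟩ s t
  unfold jumpSum
  refine le_trans (le_of_eq ?_) (ENNReal.ofReal_le_ofReal (hs.sum_le_tsum R
    (fun r _ => Set.indicator_nonneg (fun r _ => hG0 k _) r)))
  rw [ENNReal.ofReal_sum_of_nonneg (fun r _ => Set.indicator_nonneg (fun r _ => hG0 k _) r)]
  refine Finset.sum_congr rfl fun r _ => ?_
  by_cases hr : r ∈ Set.Ioc s t <;> simp [hr, -Set.mem_Ioc]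

end JumpSums

/-! ### Kolmogorov's maximal inequality -/

section Kolmogorov

variable {Ω : Type*} {mΩ : MeasurableSpace Ω} {P : Measure Ω} [IsProbabilityMeasure P]

/-- Kolmogorov's maximal inequality for sums of independent centred random variables. -/
lemma kolmogorov_maximal {ξ : ℕ → Ω → ℝ} (hind : iIndepFun ξ P) (hm : ∀ i, Measurable (ξ i))
    (h2 : ∀ i, MemLp (ξ i) 2 P) (h0 : ∀ i, ∫ ω, ξ i ω ∂P = 0) (n : ℕ) {c : ℝ} (hc : 0 < c) :
    P.real {ω | ∃ k ≤ n, c ≤ |∑ i ∈ Finset.range k, ξ i ω|} ≤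
      (∫ ω, (∑ i ∈ Finset.range n, ξ i ω) ^ 2 ∂P) / c ^ 2 := by
  classical
  set S : ℕ → Ω → ℝ := fun k ω => ∑ i ∈ Finset.range k, ξ i ω with hS
  have hSm : ∀ k, Measurable (S k) := fun k => Finset.measurable_fun_sum _ fun i _ => hm i
  have hS2 : ∀ k, MemLp (S k) 2 P := fun k => memLp_finsetSum _ fun i _ => h2 i
  -- `A k`: the level `c` is reached at step `k` for the first time.
  set A : ℕ → Set Ω := fun k => {ω | c ≤ |S k ω| ∧ ∀ j < k, |S j ω| < c} with hA
  have hAm : ∀ k, MeasurableSet (A k) := fun k => by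
    refine (measurableSet_le measurable_const (hSm k).abs).inter ?_
    have : {ω | ∀ j < k, |S j ω| < c} = ⋂ j, ⋂ (_ : j < k), {ω | |S j ω| < c} := by
      ext; simp
    change MeasurableSet {ω | ∀ j < k, |S j ω| < c}
    rw [this]
    exact MeasurableSet.iInter fun j => MeasurableSet.iInter fun _ =>
      measurableSet_lt (hSm j).abs measurable_const
  have hAd : Pairwise (Function.onFun Disjoint A) := by
    intro j k hjk
    refine Set.disjoint_left.2 fun ω hj hk => ?_
    rcases lt_or_gt_of_ne hjk with h | h
    · exact absurd hj.1 (not_le.2 (hk.2 j h))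
    · exact absurd hk.1 (not_le.2 (hj.2 k h))
  have hU : {ω | ∃ k ≤ n, c ≤ |S k ω|} = ⋃ k ∈ Finset.range (n + 1), A k := by
    ext ω
    simp only [Set.mem_ofPred_eq, Set.mem_iUnion, Finset.mem_range, exists_prop]
    constructor
    · rintro ⟨k, hk, hck⟩
      have hex : ∃ k, c ≤ |S k ω| := ⟨k, hck⟩
      refine ⟨Nat.find hex, ?_, Nat.find_spec hex, fun j hj => not_le.1 (Nat.find_min hex hj)⟩
      have := Nat.find_min' hex hck
      omega
    · rintro ⟨k, hk, hck⟩
      exact ⟨k, by omega, hck.1⟩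
  -- `S k` on `A k` is a function of `ξ i` with `i < k`, while `S n - S k` is centred and uses only
  -- `k ≤ i < n`.
  have hcross : ∀ k ≤ n, ∫ ω, (A k).indicator (S k) ω * (S n ω - S k ω) ∂P = 0 := by
    intro k hk
    have hi := hind.indepFun_finset (Finset.range k) (Finset.Ico k n)
      (Finset.disjoint_left.2 fun i h1 h2 => by
        simp only [Finset.mem_range, Finset.mem_Ico] at h1 h2; omega) hm
    -- Partial sums as functions of the first block of coordinates, so that `A k` becomes the
    -- preimage of a Borel set `B`.
    let Sf : ℕ → ((Finset.range k) → ℝ) → ℝ := fun j v =>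
      ∑ i : (Finset.range k), if (i : ℕ) < j then v i else 0
    have hSf : ∀ j ≤ k, ∀ ω, Sf j (fun i => ξ i ω) = S j ω := by
      intro j hj ω
      simp only [Sf, hS]
      rw [Finset.sum_coe_sort (Finset.range k) (fun i => if i < j then ξ i ω else 0),
        ← Finset.sum_filter]
      congr 1
      ext i; simp; omega
    have hSfm : ∀ j, Measurable (Sf j) := fun j =>
      Finset.measurable_fun_sum _ fun i _ => by
        by_cases h : (i : ℕ) < j
        · simpa [h] using measurable_pi_apply i
        · simp [h]
    let B : Set ((Finset.range k) → ℝ) := {v | c ≤ |Sf k v| ∧ ∀ j < k, |Sf j v| < c}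
    have hB : MeasurableSet B := by
      refine (measurableSet_le measurable_const (hSfm k).abs).inter ?_
      have : {v | ∀ j < k, |Sf j v| < c} = ⋂ j, ⋂ (_ : j < k), {v | |Sf j v| < c} := by
        ext; simp
      change MeasurableSet {v | ∀ j < k, |Sf j v| < c}
      rw [this]
      exact MeasurableSet.iInter fun j => MeasurableSet.iInter fun _ =>
        measurableSet_lt (hSfm j).abs measurable_const
    have hi2 := hi.comp (φ := B.indicator (Sf k))
      (ψ := fun v : (Finset.Ico k n) → ℝ => ∑ i, v i) ((hSfm k).indicator hB)
      (Finset.measurable_fun_sum _ fun i _ => measurable_pi_apply i)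
    have e1 : B.indicator (Sf k) ∘ (fun ω (i : Finset.range k) => ξ i ω) =
        (A k).indicator (S k) := by
      funext ω
      have hmem : (fun i : Finset.range k => ξ i ω) ∈ B ↔ ω ∈ A k := by
        simp only [B, hA, Set.mem_ofPred_eq, hSf k le_rfl]
        refine and_congr_right fun _ => forall₂_congr fun j hj => ?_
        rw [hSf j hj.le]
      by_cases h : ω ∈ A k
      · rw [Set.indicator_of_mem h, Function.comp, Set.indicator_of_mem (hmem.2 h), hSf k le_rfl]
      · rw [Set.indicator_of_notMem h, Function.comp, Set.indicator_of_notMem (mt hmem.1 h)]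
    have e2 : (fun v : (Finset.Ico k n) → ℝ => ∑ i, v i) ∘ (fun ω (i : Finset.Ico k n) => ξ i ω) =
        fun ω => S n ω - S k ω := by
      funext ω
      simp only [Function.comp, hS]
      rw [Finset.sum_coe_sort (Finset.Ico k n) (fun i => ξ i ω), Finset.sum_Ico_eq_sub _ hk]
    rw [e1, e2] at hi2
    rw [hi2.integral_fun_mul_eq_mul_integral
      ((hSm k).indicator (hAm k)).aestronglyMeasurable
      ((hSm n).sub (hSm k)).aestronglyMeasurable]
    have : ∫ ω, (S n ω - S k ω) ∂P = 0 := by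
      rw [integral_sub ((hS2 n).integrable (by norm_num)) ((hS2 k).integrable (by norm_num))]
      simp only [hS]
      rw [integral_finsetSum _ fun i _ => (h2 i).integrable (by norm_num),
        integral_finsetSum _ fun i _ => (h2 i).integrable (by norm_num)]
      simp [h0]
    rw [this, mul_zero]
  -- From `S n ^ 2 ≥ S k ^ 2 + 2 S k (S n - S k)`, whose cross term integrates to `0` over `A k`.
  have hstep : ∀ k ≤ n, c ^ 2 * P.real (A k) ≤ ∫ ω in A k, S n ω ^ 2 ∂P := by
    intro k hk
    have hind2 : MemLp ((A k).indicator (S k)) 2 P := (hS2 k).indicator (hAm k)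
    have hprod : Integrable (fun ω => (A k).indicator (S k) ω * (S n ω - S k ω)) P :=
      hind2.integrable_mul ((hS2 n).sub (hS2 k))
    calc c ^ 2 * P.real (A k) = ∫ ω in A k, c ^ 2 ∂P := by
          rw [setIntegral_const, smul_eq_mul, mul_comm]
      _ ≤ ∫ ω in A k, S k ω ^ 2 ∂P := by
          refine setIntegral_mono_on (integrable_const _).integrableOn
            (hS2 k).integrable_sq.integrableOn (hAm k) fun ω hω => ?_
          rw [← sq_abs (S k ω)]
          exact pow_le_pow_left₀ hc.le hω.1 2
      _ = ∫ ω in A k, S k ω ^ 2 ∂P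
            + 2 * ∫ ω, (A k).indicator (S k) ω * (S n ω - S k ω) ∂P := by
          rw [hcross k hk]; ring
      _ = ∫ ω, ((A k).indicator (fun ω => S k ω ^ 2) ω
            + 2 * ((A k).indicator (S k) ω * (S n ω - S k ω))) ∂P := by
          rw [integral_add ((hS2 k).integrable_sq.indicator (hAm k)) (hprod.const_mul 2),
            integral_indicator (hAm k), integral_const_mul]
      _ ≤ ∫ ω, (A k).indicator (fun ω => S n ω ^ 2) ω ∂P := by
          refine integral_mono (((hS2 k).integrable_sq.indicator (hAm k)).add (hprod.const_mul 2))
            ((hS2 n).integrable_sq.indicator (hAm k)) fun ω => ?_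
          by_cases h : ω ∈ A k
          · simp only [Set.indicator_of_mem h]
            nlinarith [sq_nonneg (S n ω - S k ω)]
          · simp [Set.indicator_of_notMem h]
      _ = ∫ ω in A k, S n ω ^ 2 ∂P := integral_indicator (hAm k)
  rw [le_div_iff₀ (by positivity)]
  change P.real {ω | ∃ k ≤ n, c ≤ |S k ω|} * c ^ 2 ≤ _
  rw [hU, measureReal_biUnion_finset (fun i _ j _ h => hAd h) (fun k _ => hAm k), Finset.sum_mul]
  calc ∑ k ∈ Finset.range (n + 1), P.real (A k) * c ^ 2
      ≤ ∑ k ∈ Finset.range (n + 1), ∫ ω in A k, S n ω ^ 2 ∂P :=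
        Finset.sum_le_sum fun k hk => by
          rw [mul_comm]; exact hstep k (by simpa [Nat.lt_succ_iff] using hk)
    _ = ∫ ω in ⋃ k ∈ Finset.range (n + 1), A k, S n ω ^ 2 ∂P :=
        (integral_biUnion_finset _ (fun k _ => hAm k) (fun i _ j _ h => hAd h)
          fun k _ => (hS2 n).integrable_sq.integrableOn).symm
    _ ≤ ∫ ω, S n ω ^ 2 ∂P :=
        setIntegral_le_integral (hS2 n).integrable_sq (ae_of_all _ fun ω => sq_nonneg _)

end Kolmogorov

/-! ### Sums over the jumps of a square integrable Lévy process -/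

section LimitsGeneral

variable {Ω : Type*} {mΩ : MeasurableSpace Ω} {P : Measure Ω} [IsProbabilityMeasure P]

lemma iIndepFun_of_tendsto_ae' {ι : Type*} {Y : ℕ → ι → Ω → ℝ} {Z : ι → Ω → ℝ}
    (hY : ∀ n i, AEMeasurable (Y n i) P) (hind : ∀ n, iIndepFun (Y n) P)
    (h : ∀ i, ∀ᵐ ω ∂P, Tendsto (fun n => Y n i ω) atTop (𝓝 (Z i ω))) : iIndepFun Z P := by
  rw [iIndepFun_iff_finset]
  intro s
  refine iIndepFun_of_tendsto_ae (Y := fun n (i : s) => Y n i) (fun n i => hY n i) (fun n => ?_)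
    fun i => h i
  exact iIndepFun_iff_finset.1 (hind n) s

/-- Variances add, and the means contribute `n m²` on the left but `(n m)²` on the right. No
centring is needed, so this applies to the increments along a grid. -/
lemma sum_integral_sq_le {ξ : ℕ → Ω → ℝ} (hind : iIndepFun ξ P) (h2 : ∀ i, MemLp (ξ i) 2 P)
    {m : ℝ} (hm : ∀ i, ∫ ω, ξ i ω ∂P = m) (n : ℕ) :
    ∑ i ∈ Finset.range n, ∫ ω, ξ i ω ^ 2 ∂P ≤
      ∫ ω, (∑ i ∈ Finset.range n, ξ i ω) ^ 2 ∂P := by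
  have hS : MemLp (∑ i ∈ Finset.range n, ξ i) 2 P := memLp_finsetSum' _ fun i _ => h2 i
  have h1 := variance_eq_sub hS
  rw [IndepFun.variance_sum (fun i _ => h2 i) (fun i _ j _ hij => hind.indepFun hij)] at h1
  have h3 : ∫ ω, (∑ i ∈ Finset.range n, ξ i) ω ∂P = n * m := by
    simp only [Finset.sum_apply]
    rw [integral_finsetSum _ fun i _ => (h2 i).integrable (by norm_num)]
    simp [hm]
  have h4 : ∀ i, Var[ξ i; P] = ∫ ω, ξ i ω ^ 2 ∂P - m ^ 2 := fun i => by
    rw [variance_eq_sub (h2 i), hm]; rfl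
  rw [h3] at h1
  simp only [h4, Finset.sum_sub_distrib, Finset.sum_const, Finset.card_range, nsmul_eq_mul] at h1
  have h5 : ∫ ω, (∑ i ∈ Finset.range n, ξ i ω) ^ 2 ∂P = P[(∑ i ∈ Finset.range n, ξ i) ^ 2] := by
    simp [Finset.sum_apply]
  rw [h5]
  have h6 : (n : ℝ) * m ^ 2 ≤ (n * m) ^ 2 := by
    rw [mul_pow]
    refine mul_le_mul_of_nonneg_right ?_ (sq_nonneg m)
    rcases Nat.eq_zero_or_pos n with h | h
    · simp [h]
    · have : (1 : ℝ) ≤ n := by exact_mod_cast h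
      nlinarith
  linarith

end LimitsGeneral

/-! ### Regular Lévy processes, test functions of jumps, and an integrable majorant -/

section Regular

variable {Ω : Type*} {mΩ : MeasurableSpace Ω} {P : Measure Ω} {d : ℕ}

/-- A square integrable Lévy process in `ℝᵈ` with measurable marginals and càdlàg paths. -/
structure IsRegularLevy (P : Measure Ω) (Z : ℝ≥0 → Ω → Fin d → ℝ) : Prop where
  levy : IsLevyProcess P Z
  measurable : ∀ t, Measurable (Z t)
  cadlag : ∀ ω, IsCadlagPath (fun t => Z t ω)
  memLp : ∀ t i, MemLp (fun ω => Z t ω i) 2 P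

/-- The random variable `∑_{s < r ≤ t} g (ΔZ(r))`. -/
noncomputable def jumpFunctional (Z : ℝ≥0 → Ω → Fin d → ℝ) (g : (Fin d → ℝ) → ℝ) (s t : ℝ≥0)
    (ω : Ω) : ℝ := jumpSum g (fun u => Z u ω) s t

/-- `g` is a pointwise limit of continuous functions that vanish on a common neighbourhood of
`0`. -/
def IsJumpTest (g : (Fin d → ℝ) → ℝ) : Prop :=
  ∃ ε > 0, ∃ G : ℕ → (Fin d → ℝ) → ℝ, (∀ k, Continuous (G k)) ∧ (∀ k x, ‖x‖ ≤ ε → G k x = 0) ∧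
    ∀ x, Tendsto (fun k => G k x) atTop (𝓝 (g x))

lemma IsJumpTest.of_continuous {g : (Fin d → ℝ) → ℝ} (hg : Continuous g)
    (h0 : VanishesNearZero g) : IsJumpTest g := by
  obtain ⟨ε, hε, h⟩ := h0
  exact ⟨ε, hε, fun _ => g, fun _ => hg, fun _ => h, fun _ => tendsto_const_nhds⟩

lemma IsJumpTest.vanishes {g : (Fin d → ℝ) → ℝ} (hg : IsJumpTest g) : VanishesNearZero g := by
  obtain ⟨ε, hε, G, -, h0, hlim⟩ := hg
  exact ⟨ε, hε, fun x hx => tendsto_nhds_unique (hlim x) (by simp [h0 _ x hx])⟩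

lemma IsJumpTest.comp {g : (Fin d → ℝ) → ℝ} (hg : IsJumpTest g) {φ : ℝ → ℝ} (hφ : Continuous φ)
    (h0 : φ 0 = 0) : IsJumpTest fun x => φ (g x) := by
  obtain ⟨ε, hε, G, hc, hG, hlim⟩ := hg
  exact ⟨ε, hε, fun k x => φ (G k x), fun k => hφ.comp (hc k),
    fun k x hx => by simp [hG k x hx, h0], fun x => (hφ.tendsto _).comp (hlim x)⟩

lemma IsJumpTest.lin {g h : (Fin d → ℝ) → ℝ} (hg : IsJumpTest g) (hh : IsJumpTest h) (a b : ℝ) :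
    IsJumpTest fun x => a * g x + b * h x := by
  obtain ⟨ε, hε, G, hc, hG, hlim⟩ := hg
  obtain ⟨δ, hδ, H, hc', hH, hlim'⟩ := hh
  refine ⟨min ε δ, lt_min hε hδ, fun k x => a * G k x + b * H k x, fun k => ?_, fun k x hx => ?_,
    fun x => ((hlim x).const_mul a).add ((hlim' x).const_mul b)⟩
  · exact ((hc k).const_mul a).add ((hc' k).const_mul b)
  · simp [hG k x (hx.trans (min_le_left _ _)), hH k x (hx.trans (min_le_right _ _))]

/-- The approximating functions can be chosen bounded and with the same linear growth bound. -/
lemma IsJumpTest.exists_approx {g : (Fin d → ℝ) → ℝ} (hg : IsJumpTest g) {C : ℝ}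
    (hC : ∀ x, |g x| ≤ C * ‖x‖) :
    ∃ ε > 0, ∃ G : ℕ → (Fin d → ℝ) → ℝ, (∀ k, Continuous (G k)) ∧ (∀ k x, ‖x‖ ≤ ε → G k x = 0) ∧
    (∀ k x, |G k x| ≤ k) ∧ (∀ k x, |G k x| ≤ C * ‖x‖) ∧
    ∀ x, Tendsto (fun k => G k x) atTop (𝓝 (g x)) := by
  obtain ⟨ε, hε, G, hc, hG, hlim⟩ := hg
  have hCx : ∀ x : Fin d → ℝ, 0 ≤ C * ‖x‖ := fun x => (abs_nonneg _).trans (hC x)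
  -- Clipping `G k` at `±M k` imposes both bounds and keeps continuity and zeros. At fixed `x` the
  -- cap `k` is eventually inactive, and the cap `C * ‖x‖` does not affect the limit.
  set M : ℕ → (Fin d → ℝ) → ℝ := fun k x => min (C * ‖x‖) k with hM
  have hM0 : ∀ k x, 0 ≤ M k x := fun k x => le_min (hCx x) (Nat.cast_nonneg k)
  have habs : ∀ k x, |max (-M k x) (min (G k x) (M k x))| ≤ M k x := fun k x =>
    abs_le.2 ⟨le_max_left _ _, max_le (by linarith [hM0 k x]) (min_le_right _ _)⟩
  refine ⟨ε, hε, fun k x => max (-M k x) (min (G k x) (M k x)), fun k => ?_, fun k x hx => ?_,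
    fun k x => (habs k x).trans (min_le_right _ _), fun k x => (habs k x).trans (min_le_left _ _),
    fun x => ?_⟩
  · have := hc k
    have : Continuous (M k) := by simp only [hM]; fun_prop
    fun_prop
  · simp only [hG k x hx, min_eq_left (hM0 k x)]
    exact max_eq_right (by linarith [hM0 k x])
  · have h1 : Tendsto (fun k => max (-(C * ‖x‖)) (min (G k x) (C * ‖x‖))) atTop (𝓝 (g x)) := by
      have : max (-(C * ‖x‖)) (min (g x) (C * ‖x‖)) = g x := by
        have := abs_le.1 (hC x)
        rw [min_eq_left this.2, max_eq_right this.1]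
      rw [← this]
      exact tendsto_const_nhds.max ((hlim x).min tendsto_const_nhds)
    refine h1.congr' ?_
    filter_upwards [eventually_ge_atTop ⌈C * ‖x‖⌉₊] with k hk
    have : C * ‖x‖ ≤ k := (Nat.le_ceil _).trans (by exact_mod_cast hk)
    simp only [hM, min_eq_left this]

variable {Z : ℝ≥0 → Ω → Fin d → ℝ} {s t : ℝ≥0}

lemma IsRegularLevy.measurable_gridSum (hZ : IsRegularLevy P Z) {g : (Fin d → ℝ) → ℝ}
    (hg : Continuous g) (s t : ℝ≥0) (n : ℕ) :
    Measurable fun ω => gridSum g (fun u => Z u ω) s t n :=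
  Finset.measurable_fun_sum _ fun _ _ =>
    hg.measurable.comp ((hZ.measurable _).sub (hZ.measurable _))

lemma IsRegularLevy.measurable_jumpFunctional (hZ : IsRegularLevy P Z) {g : (Fin d → ℝ) → ℝ}
    (hg : IsJumpTest g) (hst : s ≤ t) : Measurable (jumpFunctional Z g s t) := by
  obtain ⟨ε, hε, G, hc, hG, hlim⟩ := hg
  refine measurable_of_tendsto_metrizable (fun k => ?_)
    (tendsto_pi_nhds.2 fun ω => (hZ.cadlag ω).tendsto_jumpSum hε hG hlim s t)
  exact measurable_of_tendsto_metrizable (hZ.measurable_gridSum (hc k) s t)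
    (tendsto_pi_nhds.2 fun ω => (hZ.cadlag ω).tendsto_gridSum (hc k) hε (hG k) hst)

lemma IsRegularLevy.iIndepFun_increments (hZ : IsRegularLevy P Z) (s t : ℝ≥0) (n : ℕ) :
    iIndepFun (fun i ω => Z (grid s t n (i + 1)) ω - Z (grid s t n i) ω) P :=
  hZ.levy.indep.nat (grid_mono s t n)

lemma IsRegularLevy.identDistrib_increments (hZ : IsRegularLevy P Z) (s t : ℝ≥0) (n i : ℕ) :
    IdentDistrib (fun ω => Z (grid s t n (i + 1)) ω - Z (grid s t n i) ω)
      (Z ((t - s) / n) - Z 0) P P := by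
  rw [grid_succ]
  exact hZ.levy.stationary _ _

lemma gridSum_coord (f : ℝ≥0 → Fin d → ℝ) (hst : s ≤ t) {n : ℕ} (hn : n ≠ 0) (j : Fin d) :
    ∑ i ∈ Finset.range n, (f (grid s t n (i + 1)) - f (grid s t n i)) j = f t j - f s j := by
  simp only [Pi.sub_apply]
  rw [Finset.sum_range_sub (fun i => f (grid s t n i) j), grid_self hst hn, grid_zero]

lemma norm_sq_le_sum (x : Fin d → ℝ) : ‖x‖ ^ 2 ≤ ∑ j, x j ^ 2 := by
  have : ‖x‖ ≤ √(∑ j, x j ^ 2) := by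
    refine (pi_norm_le_iff_of_nonneg (Real.sqrt_nonneg _)).2 fun j => Real.abs_le_sqrt ?_
    exact Finset.single_le_sum (f := fun j => x j ^ 2) (fun i _ => sq_nonneg _) (Finset.mem_univ j)
  calc ‖x‖ ^ 2 ≤ (√(∑ j, x j ^ 2)) ^ 2 := pow_le_pow_left₀ (norm_nonneg _) this 2
    _ = _ := Real.sq_sqrt (Finset.sum_nonneg fun j _ => sq_nonneg _)

lemma IsRegularLevy.memLp_sub (hZ : IsRegularLevy P Z) (u v : ℝ≥0) :
    MemLp (fun ω => ‖Z u ω - Z v ω‖) 2 P := by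
  have hm : AEStronglyMeasurable (fun ω => ‖Z u ω - Z v ω‖) P :=
    ((hZ.measurable u).sub (hZ.measurable v)).norm.aestronglyMeasurable
  rw [memLp_two_iff_integrable_sq hm]
  refine Integrable.mono' (g := fun ω => ∑ j, (Z u ω j - Z v ω j) ^ 2)
    (integrable_finsetSum _ fun j _ => ((hZ.memLp u j).sub (hZ.memLp v j)).integrable_sq)
    (hm.pow 2) (ae_of_all _ fun ω => ?_)
  rw [Real.norm_of_nonneg (by positivity)]
  exact norm_sq_le_sum _

lemma IsRegularLevy.memLp_comp_sub (hZ : IsRegularLevy P Z) {g : (Fin d → ℝ) → ℝ}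
    (hg : Continuous g) {C : ℝ} (hC : ∀ x, |g x| ≤ C * ‖x‖) (u v : ℝ≥0) :
    MemLp (fun ω => g (Z u ω - Z v ω)) 2 P :=
  ((hZ.memLp_sub u v).const_mul C).mono
    (hg.measurable.comp ((hZ.measurable u).sub (hZ.measurable v))).aestronglyMeasurable
    (ae_of_all _ fun ω => by
      rw [Real.norm_eq_abs, Real.norm_eq_abs]; exact (hC _).trans (le_abs_self _))

/-- `∑ⱼ E[(Zⱼ(t) - Zⱼ(s))²]`. -/
noncomputable def incrementEnergy (P : Measure Ω) (Z : ℝ≥0 → Ω → Fin d → ℝ) (s t : ℝ≥0) : ℝ :=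
  ∑ j, ∫ ω, (Z t ω j - Z s ω j) ^ 2 ∂P

lemma incrementEnergy_nonneg : 0 ≤ incrementEnergy P Z s t :=
  Finset.sum_nonneg fun _ _ => integral_nonneg fun _ => sq_nonneg _

variable [IsProbabilityMeasure P]

/-- The bound is uniform in `n`. In each coordinate the grid increments are independent with equal
means, so `sum_integral_sq_le` compares them with the total increment. -/
lemma IsRegularLevy.sum_integral_norm_sq_le (hZ : IsRegularLevy P Z) (hst : s ≤ t) (n : ℕ) :
    ∑ i ∈ Finset.range n, ∫ ω, ‖Z (grid s t n (i + 1)) ω - Z (grid s t n i) ω‖ ^ 2 ∂P ≤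
      incrementEnergy P Z s t := by
  rcases Nat.eq_zero_or_pos n with rfl | hn
  · simpa using incrementEnergy_nonneg
  calc ∑ i ∈ Finset.range n, ∫ ω, ‖Z (grid s t n (i + 1)) ω - Z (grid s t n i) ω‖ ^ 2 ∂P
      ≤ ∑ i ∈ Finset.range n, ∑ j,
          ∫ ω, ((Z (grid s t n (i + 1)) ω - Z (grid s t n i) ω) j) ^ 2 ∂P := by
        refine Finset.sum_le_sum fun i _ => ?_
        have hi : ∀ j, Integrable (fun ω =>
            ((Z (grid s t n (i + 1)) ω - Z (grid s t n i) ω) j) ^ 2) P := fun j =>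
          ((hZ.memLp _ j).sub (hZ.memLp _ j)).integrable_sq
        rw [← integral_finsetSum _ fun j _ => hi j]
        exact integral_mono (hZ.memLp_sub _ _).integrable_sq (integrable_finsetSum _ fun j _ => hi j)
          fun ω => norm_sq_le_sum _
    _ = ∑ j, ∑ i ∈ Finset.range n,
          ∫ ω, ((Z (grid s t n (i + 1)) ω - Z (grid s t n i) ω) j) ^ 2 ∂P := Finset.sum_comm
    _ ≤ incrementEnergy P Z s t := by
        refine Finset.sum_le_sum fun j _ => ?_
        refine (sum_integral_sq_le
          (ξ := fun i ω => (Z (grid s t n (i + 1)) ω - Z (grid s t n i) ω) j)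
          ((hZ.iIndepFun_increments s t n).comp (fun _ x => x j) fun _ => measurable_pi_apply j)
          (fun i => (hZ.memLp _ j).sub (hZ.memLp _ j))
          (m := ∫ ω, (Z ((t - s) / n) - Z 0) ω j ∂P) (fun i => ?_) n).trans (le_of_eq ?_)
        · exact ((hZ.identDistrib_increments s t n i).comp (measurable_pi_apply j)).integral_eq
        · refine integral_congr_ae (ae_of_all _ fun ω => ?_)
          simp only
          rw [gridSum_coord (fun u => Z u ω) hst hn.ne' j]

/-- The quadratic variation of the jumps is dominated by an integrable random variable. -/
lemma IsRegularLevy.exists_dominating (hZ : IsRegularLevy P Z) (hst : s ≤ t) :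
    ∃ b : Ω → ℝ, Integrable b P ∧ ∀ᵐ ω ∂P, sqJumps (fun u => Z u ω) s t ≠ ∞ ∧
      ∀ C, 0 ≤ C → ∀ g : (Fin d → ℝ) → ℝ, (∀ x, |g x| ≤ C * ‖x‖ ^ 2) →
        |jumpFunctional Z g s t ω| ≤ C * b ω := by
  -- The majorant: the lower limit of the quadratic variations along grids. It dominates `sqJumps`
  -- on every path, and Fatou bounds its mean by `incrementEnergy`.
  set q : Ω → ℝ≥0∞ := fun ω =>
    liminf (fun n => ENNReal.ofReal (gridSum (fun x => ‖x‖ ^ 2) (fun u => Z u ω) s t n)) atTop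
    with hq
  have hcont : Continuous fun x : Fin d → ℝ => ‖x‖ ^ 2 := by fun_prop
  have hm : ∀ n, Measurable fun ω =>
      ENNReal.ofReal (gridSum (fun x => ‖x‖ ^ 2) (fun u => Z u ω) s t n) := fun n =>
    (hZ.measurable_gridSum hcont s t n).ennreal_ofReal
  have hqm : Measurable q := Measurable.liminf hm
  have hqi : ∫⁻ ω, q ω ∂P ≤ ENNReal.ofReal (incrementEnergy P Z s t) := by
    refine (lintegral_liminf_le hm).trans ?_
    refine (liminf_le_liminf (Eventually.of_forall fun n => ?_)).trans_eq
      (liminf_const (f := atTop (α := ℕ)) _)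
    have hi : ∀ i ∈ Finset.range n, Integrable
        (fun ω => ‖Z (grid s t n (i + 1)) ω - Z (grid s t n i) ω‖ ^ 2) P := fun i _ =>
      (hZ.memLp_sub _ _).integrable_sq
    have h1 := integral_finsetSum _ hi
    have h2 := ofReal_integral_eq_lintegral_ofReal (integrable_finsetSum _ hi)
      (ae_of_all _ fun ω => Finset.sum_nonneg fun i _ => by positivity)
    simp only [gridSum]
    rw [← h2, h1]
    exact ENNReal.ofReal_le_ofReal (hZ.sum_integral_norm_sq_le hst n)
  have hqfin : ∫⁻ ω, q ω ∂P ≠ ∞ := (hqi.trans_lt ENNReal.ofReal_lt_top).ne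
  refine ⟨fun ω => (q ω).toReal, integrable_toReal_of_lintegral_ne_top hqm.aemeasurable hqfin, ?_⟩
  filter_upwards [ae_lt_top hqm hqfin] with ω hω
  have hle : sqJumps (fun u => Z u ω) s t ≤ q ω := (hZ.cadlag ω).sqJumps_le_liminf hst
  refine ⟨(hle.trans_lt hω).ne, fun C hC g hg => ?_⟩
  have := (ofReal_abs_jumpSum_le (f := fun u => Z u ω) (s := s) (t := t) hC hg).trans
    (mul_le_mul_right hle _)
  rw [← ENNReal.ofReal_toReal hω.ne, ← ENNReal.ofReal_mul hC] at this
  exact (ENNReal.ofReal_le_ofReal_iff (by positivity)).1 this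

lemma IsRegularLevy.integrable_jumpFunctional (hZ : IsRegularLevy P Z) (hst : s ≤ t)
    {g : (Fin d → ℝ) → ℝ} (hg : IsJumpTest g) {C : ℝ} (hC0 : 0 ≤ C)
    (hC : ∀ x, |g x| ≤ C * ‖x‖ ^ 2) : Integrable (jumpFunctional Z g s t) P := by
  obtain ⟨b, hb, h⟩ := hZ.exists_dominating hst
  refine (hb.const_mul C).mono' (hZ.measurable_jumpFunctional hg hst).aestronglyMeasurable ?_
  filter_upwards [h] with ω hω using hω.2 C hC0 g hC

/-- Dominated convergence for the expected jump sums. -/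
lemma IsRegularLevy.tendsto_integral_jumpFunctional_zero (hZ : IsRegularLevy P Z) (hst : s ≤ t)
    {ι : Type*} {l : Filter ι} [l.IsCountablyGenerated] {h : ι → (Fin d → ℝ) → ℝ} {C : ℝ}
    (hC : 0 ≤ C) (hh : ∀ᶠ i in l, IsJumpTest (h i))
    (hb : ∀ᶠ i in l, ∀ x, |h i x| ≤ C * ‖x‖ ^ 2)
    (hlim : ∀ x, Tendsto (fun i => h i x) l (𝓝 0)) :
    Tendsto (fun i => ∫ ω, jumpFunctional Z (h i) s t ω ∂P) l (𝓝 0) := by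
  obtain ⟨b, hbi, hbd⟩ := hZ.exists_dominating hst
  have : Tendsto (fun i => ∫ ω, jumpFunctional Z (h i) s t ω ∂P) l (𝓝 (∫ _, (0 : ℝ) ∂P)) := by
    refine tendsto_integral_filter_of_dominated_convergence (fun ω => C * b ω) ?_ ?_
      (hbi.const_mul C) ?_
    · filter_upwards [hh] with i hi
      exact (hZ.measurable_jumpFunctional hi hst).aestronglyMeasurable
    · filter_upwards [hb] with i hi
      filter_upwards [hbd] with ω hω using hω.2 C hC _ hi
    · filter_upwards [hbd] with ω hω using tendsto_jumpSum_zero hω.1 hb hlim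
  simpa using this

end Regular

/-! ### Second moments, independence and stationarity of jump sums -/

section RegularL2

variable {Ω : Type*} {mΩ : MeasurableSpace Ω} {P : Measure Ω} {d : ℕ}
  {Z : ℝ≥0 → Ω → Fin d → ℝ} {s t : ℝ≥0} [IsProbabilityMeasure P]

/-- The constant blows up as `ε → 0`. The bound therefore serves for integrability and for means at
fixed `ε`, while the estimates uniform in `ε` use `sq_le_of_abs_le`. -/
lemma abs_le_mul_sq_of_vanishes {g : (Fin d → ℝ) → ℝ} {ε C : ℝ} (hε : 0 < ε) (hC0 : 0 ≤ C)
    (h0 : ∀ x, ‖x‖ ≤ ε → g x = 0) (hC : ∀ x, |g x| ≤ C * ‖x‖) (x : Fin d → ℝ) :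
    |g x| ≤ C / ε * ‖x‖ ^ 2 := by
  rcases le_or_gt ‖x‖ ε with h | h
  · rw [h0 x h, abs_zero]; positivity
  · refine (hC x).trans ?_
    rw [div_mul_eq_mul_div, le_div_iff₀ hε, mul_assoc]
    refine mul_le_mul_of_nonneg_left ?_ hC0
    rw [sq]
    exact mul_le_mul_of_nonneg_left h.le (norm_nonneg x)

lemma sq_le_of_abs_le {g : (Fin d → ℝ) → ℝ} {C : ℝ}
    (hC : ∀ x, |g x| ≤ C * ‖x‖) (x : Fin d → ℝ) : |g x ^ 2| ≤ C ^ 2 * ‖x‖ ^ 2 := by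
  rw [abs_pow, ← mul_pow]
  exact pow_le_pow_left₀ (abs_nonneg _) (hC x) 2

omit [IsProbabilityMeasure P] in
lemma IsRegularLevy.memLp_gridSum (hZ : IsRegularLevy P Z) {g : (Fin d → ℝ) → ℝ}
    (hg : Continuous g) {C : ℝ} (hC : ∀ x, |g x| ≤ C * ‖x‖) (s t : ℝ≥0) (n : ℕ) :
    MemLp (fun ω => gridSum g (fun u => Z u ω) s t n) 2 P :=
  memLp_finsetSum _ fun _ _ => hZ.memLp_comp_sub hg hC _ _

lemma IsRegularLevy.variance_gridSum_le (hZ : IsRegularLevy P Z) {g : (Fin d → ℝ) → ℝ}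
    (hg : Continuous g) {C : ℝ} (hC : ∀ x, |g x| ≤ C * ‖x‖) (s t : ℝ≥0) (n : ℕ) :
    Var[fun ω => gridSum g (fun u => Z u ω) s t n; P] ≤
      ∫ ω, gridSum (fun x => g x ^ 2) (fun u => Z u ω) s t n ∂P := by
  have hm : ∀ i ∈ Finset.range n,
      MemLp (fun ω => g (Z (grid s t n (i + 1)) ω - Z (grid s t n i) ω)) 2 P :=
    fun i _ => hZ.memLp_comp_sub hg hC _ _
  have hind := (hZ.iIndepFun_increments s t n).comp (fun _ => g) fun _ => hg.measurable
  have h1 := IndepFun.variance_sum hm (fun i _ j _ hij => hind.indepFun hij)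
  have h2 : (∑ i ∈ Finset.range n,
      fun ω => g (Z (grid s t n (i + 1)) ω - Z (grid s t n i) ω)) =
      fun ω => gridSum g (fun u => Z u ω) s t n := by
    funext ω; simp [gridSum, Finset.sum_apply]
  rw [h2] at h1
  rw [h1]
  simp only [gridSum]
  rw [integral_finsetSum _ fun i hi => (hm i hi).integrable_sq]
  exact Finset.sum_le_sum fun i hi => variance_le_expectation_sq (hm i hi).1

lemma IsRegularLevy.integral_gridSum_le (hZ : IsRegularLevy P Z) (hst : s ≤ t)
    {g : (Fin d → ℝ) → ℝ} {C : ℝ} (hC0 : 0 ≤ C) (hC : ∀ x, |g x| ≤ C * ‖x‖ ^ 2) (n : ℕ) :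
    |∫ ω, gridSum g (fun u => Z u ω) s t n ∂P| ≤ C * incrementEnergy P Z s t := by
  have hi : ∀ i ∈ Finset.range n, Integrable
      (fun ω => ‖Z (grid s t n (i + 1)) ω - Z (grid s t n i) ω‖ ^ 2) P := fun i _ =>
    (hZ.memLp_sub _ _).integrable_sq
  refine abs_integral_le_integral_abs.trans ?_
  refine (integral_mono_of_nonneg (ae_of_all _ fun ω => abs_nonneg _)
    ((integrable_finsetSum _ hi).const_mul C) (ae_of_all _ fun ω => ?_)).trans ?_
  · simp only [gridSum]
    rw [Finset.mul_sum]
    exact (Finset.abs_sum_le_sum_abs _ _).trans (Finset.sum_le_sum fun i _ => hC _)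
  · rw [integral_const_mul, integral_finsetSum _ hi]
    exact mul_le_mul_of_nonneg_left (hZ.sum_integral_norm_sq_le hst n) hC0

lemma integral_sq_eq_variance_add {Y : Ω → ℝ} (hY : MemLp Y 2 P) :
    ∫ ω, Y ω ^ 2 ∂P = Var[Y; P] + (∫ ω, Y ω ∂P) ^ 2 := by
  rw [variance_eq_sub hY]; simp

/-- The grid sums are bounded in `L²` uniformly in `n`: their variance through `g²`, which has a
quadratic bound, and their mean through the bound of `abs_le_mul_sq_of_vanishes`. Fatou and
convergence of means follow. -/
lemma IsRegularLevy.jumpFunctional_of_continuous (hZ : IsRegularLevy P Z) (hst : s ≤ t)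
    {g : (Fin d → ℝ) → ℝ} (hg : Continuous g) (h0 : VanishesNearZero g) {C : ℝ} (hC0 : 0 ≤ C)
    (hC : ∀ x, |g x| ≤ C * ‖x‖) :
    MemLp (jumpFunctional Z g s t) 2 P ∧
    Tendsto (fun n => ∫ ω, gridSum g (fun u => Z u ω) s t n ∂P) atTop
      (𝓝 (∫ ω, jumpFunctional Z g s t ω ∂P)) := by
  obtain ⟨ε, hε, h0⟩ := h0
  set V := incrementEnergy P Z s t
  have hlim : ∀ᵐ ω ∂P, Tendsto (fun n => gridSum g (fun u => Z u ω) s t n) atTop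
      (𝓝 (jumpFunctional Z g s t ω)) :=
    ae_of_all _ fun ω => (hZ.cadlag ω).tendsto_gridSum hg hε h0 hst
  have hbd : ∀ n, ∫ ω, gridSum g (fun u => Z u ω) s t n ^ 2 ∂P ≤
      C ^ 2 * V + (C / ε * V) ^ 2 := by
    intro n
    rw [integral_sq_eq_variance_add (hZ.memLp_gridSum hg hC s t n)]
    refine add_le_add ?_ ?_
    · exact (hZ.variance_gridSum_le hg hC s t n).trans ((le_abs_self _).trans
        (hZ.integral_gridSum_le hst (sq_nonneg C) (sq_le_of_abs_le hC) n))
    · rw [← sq_abs]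
      exact pow_le_pow_left₀ (abs_nonneg _) (hZ.integral_gridSum_le hst (by positivity)
        (abs_le_mul_sq_of_vanishes hε hC0 h0 hC) n) 2
  exact ⟨(memLp_two_of_tendsto_ae (hZ.memLp_gridSum hg hC s t) hlim hbd tendsto_const_nhds).1,
    tendsto_integral_of_sq_bounded (hZ.memLp_gridSum hg hC s t) hlim hbd⟩

/-- Fatou for the centred grid sums. The bound `B` gives `g²` linear growth, which makes the means
of its grid sums converge as well. -/
lemma IsRegularLevy.variance_jumpFunctional_le_of_continuous (hZ : IsRegularLevy P Z) (hst : s ≤ t)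
    {g : (Fin d → ℝ) → ℝ} (hg : Continuous g) (h0 : VanishesNearZero g) {C B : ℝ} (hC0 : 0 ≤ C)
    (hC : ∀ x, |g x| ≤ C * ‖x‖) (hB : ∀ x, |g x| ≤ B) :
    Var[jumpFunctional Z g s t; P] ≤ ∫ ω, jumpFunctional Z (fun x => g x ^ 2) s t ω ∂P := by
  have hB0 : 0 ≤ B := (abs_nonneg _).trans (hB 0)
  obtain ⟨h1, h2⟩ := hZ.jumpFunctional_of_continuous hst hg h0 hC0 hC
  obtain ⟨ε, hε, hv⟩ := h0
  obtain ⟨-, h3⟩ := hZ.jumpFunctional_of_continuous hst (g := fun x => g x ^ 2) (hg.pow 2)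
    ⟨ε, hε, fun x hx => by simp [hv x hx]⟩ (C := B * C) (by positivity) (fun x => by
      rw [abs_pow, sq, mul_assoc]
      exact mul_le_mul (hB x) (hC x) (abs_nonneg _) hB0)
  have hm := hZ.memLp_gridSum hg hC s t
  have := (memLp_two_of_tendsto_ae
    (Y := fun n ω => gridSum g (fun u => Z u ω) s t n - ∫ ω, gridSum g (fun u => Z u ω) s t n ∂P)
    (Z := fun ω => jumpFunctional Z g s t ω - ∫ ω, jumpFunctional Z g s t ω ∂P)
    (fun n => (hm n).sub (memLp_const _))
    (ae_of_all _ fun ω => ((hZ.cadlag ω).tendsto_gridSum hg hε hv hst).sub h2)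
    (c := fun n => ∫ ω, gridSum (fun x => g x ^ 2) (fun u => Z u ω) s t n ∂P)
    (fun n => ?_) h3).2
  · rwa [variance_eq_integral h1.1.aemeasurable]
  · rw [← variance_eq_integral (hm n).1.aemeasurable]
    exact hZ.variance_gridSum_le hg hC s t n

/-- Sums of `g` over the jumps are square integrable, with variance at most `E ∑ g(ΔZ)²`. -/
lemma IsRegularLevy.memLp_jumpFunctional (hZ : IsRegularLevy P Z) (hst : s ≤ t)
    {g : (Fin d → ℝ) → ℝ} (hg : IsJumpTest g) {C : ℝ} (hC0 : 0 ≤ C)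
    (hC : ∀ x, |g x| ≤ C * ‖x‖) :
    MemLp (jumpFunctional Z g s t) 2 P ∧
    Var[jumpFunctional Z g s t; P] ≤ ∫ ω, jumpFunctional Z (fun x => g x ^ 2) s t ω ∂P := by
  obtain ⟨ε, hε, G, hc, hv, hB, hGC, hlim⟩ := hg.exists_approx hC
  obtain ⟨b, hb, hbd⟩ := hZ.exists_dominating hst
  have hvan : ∀ k, VanishesNearZero (G k) := fun k => ⟨ε, hε, hv k⟩
  have hmem : ∀ k, MemLp (jumpFunctional Z (G k) s t) 2 P := fun k =>
    (hZ.jumpFunctional_of_continuous hst (hc k) (hvan k) hC0 (hGC k)).1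
  have hvar : ∀ k, Var[jumpFunctional Z (G k) s t; P] ≤
      ∫ ω, jumpFunctional Z (fun x => G k x ^ 2) s t ω ∂P := fun k =>
    hZ.variance_jumpFunctional_le_of_continuous hst (hc k) (hvan k) hC0 (hGC k) (hB k)
  have hae : ∀ᵐ ω ∂P, Tendsto (fun k => jumpFunctional Z (G k) s t ω) atTop
      (𝓝 (jumpFunctional Z g s t ω)) :=
    ae_of_all _ fun ω => (hZ.cadlag ω).tendsto_jumpSum hε hv hlim s t
  have hint : ∀ {K : ℝ}, 0 ≤ K → ∀ {h : (Fin d → ℝ) → ℝ}, (∀ x, |h x| ≤ K * ‖x‖ ^ 2) →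
      |∫ ω, jumpFunctional Z h s t ω ∂P| ≤ K * ∫ ω, b ω ∂P := by
    intro K hK h hh
    refine abs_integral_le_integral_abs.trans ?_
    rw [← integral_const_mul]
    refine integral_mono_of_nonneg (ae_of_all _ fun ω => abs_nonneg _) (hb.const_mul K) ?_
    filter_upwards [hbd] with ω hω using hω.2 K hK h hh
  -- Independent of `k`, because all `G k` share the growth constant `C` and the radius `ε`.
  have hsq : ∀ k, ∫ ω, jumpFunctional Z (G k) s t ω ^ 2 ∂P ≤
      C ^ 2 * (∫ ω, b ω ∂P) + (C / ε * ∫ ω, b ω ∂P) ^ 2 := by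
    intro k
    rw [integral_sq_eq_variance_add (hmem k)]
    refine add_le_add ?_ ?_
    · exact (hvar k).trans ((le_abs_self _).trans (hint (sq_nonneg C) (sq_le_of_abs_le (hGC k))))
    · rw [← sq_abs]
      exact pow_le_pow_left₀ (abs_nonneg _) (hint (by positivity)
        (abs_le_mul_sq_of_vanishes hε hC0 (hv k) (hGC k))) 2
  have hM := (memLp_two_of_tendsto_ae hmem hae hsq tendsto_const_nhds).1
  have hE := tendsto_integral_of_sq_bounded hmem hae hsq
  refine ⟨hM, ?_⟩
  have hEsq : Tendsto (fun k => ∫ ω, jumpFunctional Z (fun x => G k x ^ 2) s t ω ∂P) atTop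
      (𝓝 (∫ ω, jumpFunctional Z (fun x => g x ^ 2) s t ω ∂P)) := by
    refine tendsto_integral_of_dominated_convergence (fun ω => C ^ 2 * b ω) (fun k => ?_)
      (hb.const_mul _) (fun k => ?_) (ae_of_all _ fun ω => ?_)
    · exact (hZ.measurable_jumpFunctional (IsJumpTest.of_continuous ((hc k).pow 2)
        ⟨ε, hε, fun x hx => by simp [hv k x hx]⟩) hst).aestronglyMeasurable
    · filter_upwards [hbd] with ω hω using hω.2 _ (sq_nonneg C) _ (sq_le_of_abs_le (hGC k))
    · exact (hZ.cadlag ω).tendsto_jumpSum hε (fun k x hx => by simp [hv k x hx])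
        (fun x => (hlim x).pow 2) s t
  have := (memLp_two_of_tendsto_ae
    (Y := fun k ω => jumpFunctional Z (G k) s t ω - ∫ ω, jumpFunctional Z (G k) s t ω ∂P)
    (Z := fun ω => jumpFunctional Z g s t ω - ∫ ω, jumpFunctional Z g s t ω ∂P)
    (fun k => (hmem k).sub (memLp_const _))
    (by filter_upwards [hae] with ω hω using hω.sub hE)
    (c := fun k => ∫ ω, jumpFunctional Z (fun x => G k x ^ 2) s t ω ∂P)
    (fun k => ?_) hEsq).2
  · rwa [variance_eq_integral hM.1.aemeasurable]
  · rw [← variance_eq_integral (hmem k).1.aemeasurable]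
    exact hvar k

/-- The points of the uniform partitions of the intervals `[τ j, τ (j + 1)]`, in a row. -/
noncomputable def rowGrid (τ : ℕ → ℝ≥0) (n k : ℕ) : ℝ≥0 :=
  grid (τ (k / n)) (τ (k / n + 1)) n (k % n)

/-- At the end of a block the point `τ (k / n + 1)` is both the last point of one grid and the first
of the next. -/
lemma rowGrid_succ {τ : ℕ → ℝ≥0} (hτ : Monotone τ) {n : ℕ} (hn : 0 < n) (k : ℕ) :
    rowGrid τ n (k + 1) = grid (τ (k / n)) (τ (k / n + 1)) n (k % n + 1) := by
  have hk := Nat.div_add_mod k n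
  have hlt := Nat.mod_lt k hn
  rcases Nat.lt_or_ge (k % n + 1) n with h | h
  · have h1 : (k + 1) / n = k / n := by
      rw [← hk, add_assoc, Nat.mul_add_div hn, Nat.div_eq_of_lt h, Nat.mul_add_div hn,
        Nat.div_eq_of_lt hlt]
    have h2 : (k + 1) % n = k % n + 1 := by
      rw [← Nat.mod_add_mod, Nat.mod_eq_of_lt h]
    rw [rowGrid, h1, h2]
  · have he : k % n + 1 = n := by omega
    have hk1 : k + 1 = n * (k / n + 1) := by rw [Nat.mul_add, mul_one]; omega
    have h1 : (k + 1) / n = k / n + 1 := by rw [hk1, Nat.mul_div_cancel_left _ hn]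
    have h2 : (k + 1) % n = 0 := by rw [hk1, Nat.mul_mod_right]
    rw [rowGrid, h1, h2, grid_zero, he, grid_self (hτ (Nat.le_succ _)) hn.ne']

lemma rowGrid_mono {τ : ℕ → ℝ≥0} (hτ : Monotone τ) {n : ℕ} (hn : 0 < n) :
    Monotone (rowGrid τ n) :=
  monotone_nat_of_le_succ fun k => by
    rw [rowGrid_succ hτ hn]; exact grid_mono _ _ _ (Nat.le_succ _)

-- The grids of all the intervals form one increasing sequence of times, so all the small increments
-- are jointly independent. They are then grouped interval by interval.
omit [IsProbabilityMeasure P] in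
lemma IsRegularLevy.iIndepFun_gridSum (hZ : IsRegularLevy P Z) {τ : ℕ → ℝ≥0} (hτ : Monotone τ)
    {g : ℕ → (Fin d → ℝ) → ℝ} (hg : ∀ j, Continuous (g j)) {n : ℕ} (hn : 0 < n) :
    iIndepFun (fun j ω => gridSum (g j) (fun u => Z u ω) (τ j) (τ (j + 1)) n) P := by
  have h1 := hZ.levy.indep.nat (rowGrid_mono hτ hn)
  let idx : ((_ : ℕ) × Fin n) → ℕ := fun p => p.1 * n + p.2
  have hdiv : ∀ p, idx p / n = p.1 := fun p => by
    simp only [idx]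
    rw [mul_comm, Nat.mul_add_div hn, Nat.div_eq_of_lt p.2.2, add_zero]
  have hmod : ∀ p, idx p % n = p.2 := fun p => by
    simp only [idx]
    rw [mul_comm, Nat.mul_add_mod, Nat.mod_eq_of_lt p.2.2]
  have hinj : Function.Injective idx := by
    rintro ⟨j, i⟩ ⟨j', i'⟩ h
    have e1 := hdiv ⟨j, i⟩
    have e2 := hmod ⟨j, i⟩
    rw [h, hdiv] at e1
    rw [h, hmod] at e2
    simp only at e1 e2
    subst e1
    have : i = i' := Fin.ext e2.symm
    rw [this]
  have h2 := h1.precomp hinj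
  have h3 := iIndepFun.curry (X := fun (j : ℕ) (i : Fin n) ω =>
    Z (rowGrid τ n (idx ⟨j, i⟩ + 1)) ω - Z (rowGrid τ n (idx ⟨j, i⟩)) ω)
    (fun j i => (hZ.measurable _).sub (hZ.measurable _)) h2
  have h4 := h3.comp (fun j (v : Fin n → Fin d → ℝ) => ∑ i, g j (v i))
    (fun j => Finset.measurable_fun_sum _ fun i _ => (hg j).measurable.comp (measurable_pi_apply i))
  convert! h4 using 2 with j
  funext ω
  simp only [gridSum, Function.comp]
  rw [Finset.sum_range]
  refine Finset.sum_congr rfl fun i _ => ?_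
  rw [rowGrid_succ hτ hn, rowGrid, hdiv, hmod]

/-- Jump sums over consecutive intervals are independent. -/
lemma IsRegularLevy.iIndepFun_jumpFunctional (hZ : IsRegularLevy P Z) {τ : ℕ → ℝ≥0}
    (hτ : Monotone τ) {g : ℕ → (Fin d → ℝ) → ℝ} (hg : ∀ j, IsJumpTest (g j)) :
    iIndepFun (fun j => jumpFunctional Z (g j) (τ j) (τ (j + 1))) P := by
  choose ε hε G hc hv hlim using hg
  -- Two successive limits: refining the grids for the continuous `G j k`, then `k → ∞`.
  refine iIndepFun_of_tendsto_ae' (Y := fun k j => jumpFunctional Z (G j k) (τ j) (τ (j + 1)))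
    (fun k j => ?_) (fun k => ?_) fun j =>
      ae_of_all _ fun ω => (hZ.cadlag ω).tendsto_jumpSum (hε j) (hv j) (hlim j) _ _
  · exact (hZ.measurable_jumpFunctional (IsJumpTest.of_continuous (hc j k) ⟨_, hε j, hv j k⟩)
      (hτ (Nat.le_succ j))).aemeasurable
  -- The number of grid intervals is `n + 1`, since `iIndepFun_gridSum` needs it positive.
  · refine iIndepFun_of_tendsto_ae'
      (Y := fun n j ω => gridSum (G j k) (fun u => Z u ω) (τ j) (τ (j + 1)) (n + 1))
      (fun n j => (hZ.measurable_gridSum (hc j k) _ _ _).aemeasurable)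
      (fun n => hZ.iIndepFun_gridSum hτ (fun j => hc j k) n.succ_pos) fun j =>
        ae_of_all _ fun ω => ((hZ.cadlag ω).tendsto_gridSum (hc j k) (hε j) (hv j k)
          (hτ (Nat.le_succ j))).comp (tendsto_add_atTop_nat 1)

/-- Jump sums have stationary increments. -/
lemma IsRegularLevy.identDistrib_jumpFunctional (hZ : IsRegularLevy P Z)
    {g : (Fin d → ℝ) → ℝ} (hg : IsJumpTest g) (s h : ℝ≥0) :
    IdentDistrib (jumpFunctional Z g s (s + h)) (jumpFunctional Z g 0 h) P P := by
  obtain ⟨ε, hε, G, hc, hv, hlim⟩ := hg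
  refine identDistrib_of_tendsto_ae (Y := fun k => jumpFunctional Z (G k) s (s + h))
    (Y' := fun k => jumpFunctional Z (G k) 0 h) (fun k => ?_)
    (ae_of_all _ fun ω => (hZ.cadlag ω).tendsto_jumpSum hε hv hlim _ _)
    (ae_of_all _ fun ω => (hZ.cadlag ω).tendsto_jumpSum hε hv hlim _ _)
  refine identDistrib_of_tendsto_ae
    (Y := fun n ω => gridSum (G k) (fun u => Z u ω) s (s + h) n)
    (Y' := fun n ω => gridSum (G k) (fun u => Z u ω) 0 h n) (fun n => ?_)
    (ae_of_all _ fun ω => (hZ.cadlag ω).tendsto_gridSum (hc k) hε (hv k) le_self_add)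
    (ae_of_all _ fun ω => (hZ.cadlag ω).tendsto_gridSum (hc k) hε (hv k) zero_le)
  -- Equal marginals and independence give the whole sequences of increments the same joint law.
  have h1 := IdentDistrib.pi (fun i => ?_) (hZ.iIndepFun_increments s (s + h) n)
    (hZ.iIndepFun_increments 0 h n)
  · exact h1.comp (u := fun v : ℕ → Fin d → ℝ => ∑ i ∈ Finset.range n, G k (v i))
      (Finset.measurable_fun_sum _ fun i _ => (hc k).measurable.comp (measurable_pi_apply i))
  · refine (hZ.identDistrib_increments s (s + h) n i).trans ?_
    have e : s + h - s = h - 0 := by rw [add_tsub_cancel_left, tsub_zero]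
    rw [e]
    exact (hZ.identDistrib_increments 0 h n i).symm

omit [IsProbabilityMeasure P] in
lemma IsRegularLevy.jumpFunctional_add_interval (hZ : IsRegularLevy P Z) {g : (Fin d → ℝ) → ℝ}
    (hg : VanishesNearZero g) {u : ℝ≥0} (hst : s ≤ t) (htu : t ≤ u) (ω : Ω) :
    jumpFunctional Z g s u ω = jumpFunctional Z g s t ω + jumpFunctional Z g t u ω :=
  (hZ.cadlag ω).jumpSum_add_interval hg hst htu

omit [IsProbabilityMeasure P] in
lemma IsRegularLevy.jumpFunctional_lin (hZ : IsRegularLevy P Z) {g h : (Fin d → ℝ) → ℝ}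
    (hg : VanishesNearZero g) (hh : VanishesNearZero h) (a b : ℝ) (s t : ℝ≥0) (ω : Ω) :
    jumpFunctional Z (fun x => a * g x + b * h x) s t ω =
      a * jumpFunctional Z g s t ω + b * jumpFunctional Z h s t ω :=
  (hZ.cadlag ω).jumpSum_lin hg hh a b s t

/-- The mean is additive in time by stationarity. Nonnegativity then forces linearity, with no
continuity argument. -/
lemma IsRegularLevy.integral_jumpFunctional_of_nonneg (hZ : IsRegularLevy P Z)
    {g : (Fin d → ℝ) → ℝ} (hg : IsJumpTest g) {C : ℝ} (hC0 : 0 ≤ C)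
    (hC : ∀ x, |g x| ≤ C * ‖x‖ ^ 2) (h0 : ∀ x, 0 ≤ g x) (t : ℝ≥0) :
    ∫ ω, jumpFunctional Z g 0 t ω ∂P = t * ∫ ω, jumpFunctional Z g 0 1 ω ∂P := by
  refine eq_mul_of_additive (φ := fun t => ∫ ω, jumpFunctional Z g 0 t ω ∂P)
    (fun t => integral_nonneg fun ω => jumpSum_nonneg h0) (fun s h => ?_) t
  rw [← (hZ.identDistrib_jumpFunctional hg s h).integral_eq, ← integral_add
    (hZ.integrable_jumpFunctional zero_le hg hC0 hC)
    (hZ.integrable_jumpFunctional le_self_add hg hC0 hC)]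
  exact integral_congr_ae (ae_of_all _ fun ω =>
    hZ.jumpFunctional_add_interval hg.vanishes zero_le le_self_add ω)

lemma IsRegularLevy.integral_jumpFunctional (hZ : IsRegularLevy P Z)
    {g : (Fin d → ℝ) → ℝ} (hg : IsJumpTest g) {C : ℝ} (hC0 : 0 ≤ C)
    (hC : ∀ x, |g x| ≤ C * ‖x‖ ^ 2) (t : ℝ≥0) :
    ∫ ω, jumpFunctional Z g 0 t ω ∂P = t * ∫ ω, jumpFunctional Z g 0 1 ω ∂P := by
  have hp : IsJumpTest fun x => max (g x) 0 :=
    hg.comp (φ := fun y => max y 0) (by fun_prop) (by simp)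
  have hn : IsJumpTest fun x => max (-g x) 0 :=
    hg.comp (φ := fun y => max (-y) 0) (by fun_prop) (by simp)
  have hpC : ∀ x, |max (g x) 0| ≤ C * ‖x‖ ^ 2 := fun x => by
    refine le_trans ?_ (hC x)
    rw [abs_of_nonneg (le_max_right _ _)]
    exact max_le (le_abs_self _) (abs_nonneg _)
  have hnC : ∀ x, |max (-g x) 0| ≤ C * ‖x‖ ^ 2 := fun x => by
    refine le_trans ?_ (hC x)
    rw [abs_of_nonneg (le_max_right _ _)]
    exact max_le (neg_le_abs _) (abs_nonneg _)
  have e : g = fun x => 1 * max (g x) 0 + (-1) * max (-g x) 0 := by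
    funext x
    rcases le_total (g x) 0 with h | h
    · rw [max_eq_right h, max_eq_left (by linarith)]; ring
    · rw [max_eq_left h, max_eq_right (by linarith)]; ring
  have key : ∀ t, ∫ ω, jumpFunctional Z g 0 t ω ∂P =
      ∫ ω, jumpFunctional Z (fun x => max (g x) 0) 0 t ω ∂P -
        ∫ ω, jumpFunctional Z (fun x => max (-g x) 0) 0 t ω ∂P := by
    intro t
    rw [← integral_sub (hZ.integrable_jumpFunctional zero_le hp hC0 hpC)
      (hZ.integrable_jumpFunctional zero_le hn hC0 hnC)]
    refine integral_congr_ae (ae_of_all _ fun ω => ?_)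
    simp only
    conv_lhs => rw [e]
    rw [hZ.jumpFunctional_lin hp.vanishes hn.vanishes]; ring
  rw [key, key, hZ.integral_jumpFunctional_of_nonneg hp hC0 hpC (fun x => le_max_right _ _),
    hZ.integral_jumpFunctional_of_nonneg hn hC0 hnC (fun x => le_max_right _ _)]
  ring

end RegularL2

/-! ### Truncations and centred jump sums -/

section Truncation

variable {d : ℕ}

/-- `y` if `ε < |y|`, and `0` otherwise. -/
noncomputable def trunc (ε y : ℝ) : ℝ := if ε < |y| then y else 0

lemma trunc_zero (ε : ℝ) : trunc ε 0 = 0 := by simp [trunc]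

lemma abs_trunc_le (ε y : ℝ) : |trunc ε y| ≤ |y| := by
  unfold trunc; split_ifs <;> simp

lemma tendsto_trunc (y : ℝ) : Tendsto (fun ε => trunc ε y) (𝓝[>] 0) (𝓝 y) := by
  by_cases hy : y = 0
  · simp [hy, trunc_zero]
  · refine tendsto_const_nhds.congr' ?_
    filter_upwards [nhdsWithin_le_nhds (gt_mem_nhds (abs_pos.2 hy))] with ε hε
    rw [trunc, if_pos hε]

lemma norm_clm_le {ℓ : (Fin d → ℝ) →L[ℝ] ℝ} {ε : ℝ} {x : Fin d → ℝ}
    (hx : ‖x‖ ≤ ε / (‖ℓ‖ + 1)) : |ℓ x| ≤ ε := by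
  have h1 := ℓ.le_opNorm x
  rw [Real.norm_eq_abs] at h1
  have h2 : ‖ℓ‖ * ‖x‖ ≤ (‖ℓ‖ + 1) * (ε / (‖ℓ‖ + 1)) :=
    mul_le_mul (by linarith) hx (norm_nonneg _) (by positivity)
  rw [mul_div_cancel₀ _ (by positivity)] at h2
  linarith

/-- The strict inequality in `trunc` matters: the indicator of the open set `{ε < |ℓ x|}` is an
everywhere limit of continuous ramps vanishing off that set. -/
lemma isJumpTest_trunc (ℓ : (Fin d → ℝ) →L[ℝ] ℝ) {ε : ℝ} (hε : 0 < ε) :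
    IsJumpTest fun x => trunc ε (ℓ x) := by
  refine ⟨ε / (‖ℓ‖ + 1), by positivity,
    fun k x => ℓ x * max 0 (min 1 (k * (|ℓ x| - ε))), fun k => by fun_prop, fun k x hx => ?_,
    fun x => ?_⟩
  · have := norm_clm_le hx
    change ℓ x * max 0 (min 1 (k * (|ℓ x| - ε))) = 0
    rw [max_eq_left, mul_zero]
    exact (min_le_right _ _).trans
      (mul_nonpos_of_nonneg_of_nonpos (Nat.cast_nonneg k) (by linarith))
  · simp only [trunc]
    split_ifs with h
    · refine tendsto_const_nhds.congr' ?_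
      filter_upwards [eventually_ge_atTop ⌈1 / (|ℓ x| - ε)⌉₊] with k hk
      have h1 : 1 ≤ k * (|ℓ x| - ε) := by
        rw [← div_le_iff₀ (by linarith)]
        exact (Nat.le_ceil _).trans (by exact_mod_cast hk)
      rw [min_eq_left h1, max_eq_right zero_le_one, mul_one]
    · have : ∀ k : ℕ, ℓ x * max 0 (min 1 (k * (|ℓ x| - ε))) = 0 := fun k => by
        rw [max_eq_left, mul_zero]
        exact (min_le_right _ _).trans
          (mul_nonpos_of_nonneg_of_nonpos (Nat.cast_nonneg k) (by linarith))
      simp [this]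

lemma abs_trunc_clm_le (ℓ : (Fin d → ℝ) →L[ℝ] ℝ) (ε : ℝ) (x : Fin d → ℝ) :
    |trunc ε (ℓ x)| ≤ ‖ℓ‖ * ‖x‖ := (abs_trunc_le _ _).trans (ℓ.le_opNorm x)

end Truncation

/-! ### Centred jump sums and their `L²`-limits -/

section Centered

variable {Ω : Type*} {mΩ : MeasurableSpace Ω} {P : Measure Ω} {d : ℕ}
  {Z : ℝ≥0 → Ω → Fin d → ℝ} {s t : ℝ≥0}

/-- The jump sum minus its expectation. -/
noncomputable def centeredJump (P : Measure Ω) (Z : ℝ≥0 → Ω → Fin d → ℝ) (g : (Fin d → ℝ) → ℝ)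
    (s t : ℝ≥0) (ω : Ω) : ℝ :=
  jumpFunctional Z g s t ω - ∫ ω, jumpFunctional Z g s t ω ∂P

open Classical in
/-- The centred jump sum as an element of `L²`. -/
noncomputable def centeredLp (P : Measure Ω) (Z : ℝ≥0 → Ω → Fin d → ℝ) (g : (Fin d → ℝ) → ℝ)
    (s t : ℝ≥0) : Lp ℝ 2 P :=
  if h : MemLp (centeredJump P Z g s t) 2 P then h.toLp else 0

/-- Jump test functions of linear growth. -/
def IsLinearTest (g : (Fin d → ℝ) → ℝ) : Prop :=
  IsJumpTest g ∧ ∃ C, 0 ≤ C ∧ ∀ x, |g x| ≤ C * ‖x‖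

lemma IsLinearTest.lin {g h : (Fin d → ℝ) → ℝ} (hg : IsLinearTest g) (hh : IsLinearTest h)
    (a b : ℝ) : IsLinearTest fun x => a * g x + b * h x := by
  obtain ⟨h1, C, hC, h2⟩ := hg
  obtain ⟨h3, D, hD, h4⟩ := hh
  refine ⟨h1.lin h3 a b, |a| * C + |b| * D, by positivity, fun x => ?_⟩
  refine (abs_add_le _ _).trans ?_
  rw [abs_mul, abs_mul, add_mul, mul_assoc, mul_assoc]
  exact add_le_add (mul_le_mul_of_nonneg_left (h2 x) (abs_nonneg _))
    (mul_le_mul_of_nonneg_left (h4 x) (abs_nonneg _))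

lemma isLinearTest_trunc (ℓ : (Fin d → ℝ) →L[ℝ] ℝ) {ε : ℝ} (hε : 0 < ε) :
    IsLinearTest fun x => trunc ε (ℓ x) :=
  ⟨isJumpTest_trunc ℓ hε, ‖ℓ‖, norm_nonneg _, abs_trunc_clm_le ℓ ε⟩

variable [IsProbabilityMeasure P]

lemma IsRegularLevy.memLp_centeredJump (hZ : IsRegularLevy P Z) (hst : s ≤ t)
    {g : (Fin d → ℝ) → ℝ} (hg : IsLinearTest g) : MemLp (centeredJump P Z g s t) 2 P := by
  obtain ⟨h1, C, hC, h2⟩ := hg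
  exact (hZ.memLp_jumpFunctional hst h1 hC h2).1.sub (memLp_const _)

lemma IsRegularLevy.memLp_jumpFunctional' (hZ : IsRegularLevy P Z) (hst : s ≤ t)
    {g : (Fin d → ℝ) → ℝ} (hg : IsLinearTest g) : MemLp (jumpFunctional Z g s t) 2 P := by
  obtain ⟨h1, C, hC, h2⟩ := hg
  exact (hZ.memLp_jumpFunctional hst h1 hC h2).1

omit [IsProbabilityMeasure P] in
lemma IsRegularLevy.measurable_centeredJump (hZ : IsRegularLevy P Z) (hst : s ≤ t)
    {g : (Fin d → ℝ) → ℝ} (hg : IsLinearTest g) : Measurable (centeredJump P Z g s t) :=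
  (hZ.measurable_jumpFunctional hg.1 hst).sub_const _

lemma IsRegularLevy.centeredLp_coeFn (hZ : IsRegularLevy P Z) (hst : s ≤ t)
    {g : (Fin d → ℝ) → ℝ} (hg : IsLinearTest g) :
    centeredLp P Z g s t =ᵐ[P] centeredJump P Z g s t := by
  rw [centeredLp, dif_pos (hZ.memLp_centeredJump hst hg)]
  exact MemLp.coeFn_toLp _

lemma IsRegularLevy.integral_centeredJump (hZ : IsRegularLevy P Z) (hst : s ≤ t)
    {g : (Fin d → ℝ) → ℝ} (hg : IsLinearTest g) : ∫ ω, centeredJump P Z g s t ω ∂P = 0 := by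
  simp only [centeredJump]
  rw [integral_sub ((hZ.memLp_jumpFunctional' hst hg).integrable (by norm_num))
    (integrable_const _)]
  simp

lemma IsRegularLevy.centeredJump_lin (hZ : IsRegularLevy P Z) (hst : s ≤ t)
    {g h : (Fin d → ℝ) → ℝ} (hg : IsLinearTest g) (hh : IsLinearTest h) (a b : ℝ) (ω : Ω) :
    centeredJump P Z (fun x => a * g x + b * h x) s t ω =
      a * centeredJump P Z g s t ω + b * centeredJump P Z h s t ω := by
  simp only [centeredJump, hZ.jumpFunctional_lin hg.1.vanishes hh.1.vanishes]
  rw [integral_add (((hZ.memLp_jumpFunctional' hst hg).integrable (by norm_num)).const_mul a)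
    (((hZ.memLp_jumpFunctional' hst hh).integrable (by norm_num)).const_mul b),
    integral_const_mul, integral_const_mul]
  ring

lemma IsRegularLevy.centeredLp_lin (hZ : IsRegularLevy P Z) (hst : s ≤ t)
    {g h : (Fin d → ℝ) → ℝ} (hg : IsLinearTest g) (hh : IsLinearTest h) (a b : ℝ) :
    centeredLp P Z (fun x => a * g x + b * h x) s t =
      a • centeredLp P Z g s t + b • centeredLp P Z h s t := by
  refine Lp.ext ?_
  filter_upwards [hZ.centeredLp_coeFn hst (hg.lin hh a b), hZ.centeredLp_coeFn hst hg,
    hZ.centeredLp_coeFn hst hh, Lp.coeFn_add (a • centeredLp P Z g s t) (b • centeredLp P Z h s t),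
    Lp.coeFn_smul a (centeredLp P Z g s t), Lp.coeFn_smul b (centeredLp P Z h s t)]
    with ω h1 h2 h3 h4 h5 h6
  rw [h1, h4, Pi.add_apply, h5, h6, Pi.smul_apply, Pi.smul_apply, h2, h3,
    hZ.centeredJump_lin hst hg hh]
  rfl

lemma IsRegularLevy.centeredJump_add_interval (hZ : IsRegularLevy P Z) {u : ℝ≥0} (hst : s ≤ t)
    (htu : t ≤ u) {g : (Fin d → ℝ) → ℝ} (hg : IsLinearTest g) (ω : Ω) :
    centeredJump P Z g s u ω = centeredJump P Z g s t ω + centeredJump P Z g t u ω := by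
  simp only [centeredJump, hZ.jumpFunctional_add_interval hg.1.vanishes hst htu]
  rw [integral_add ((hZ.memLp_jumpFunctional' hst hg).integrable (by norm_num))
    ((hZ.memLp_jumpFunctional' htu hg).integrable (by norm_num))]
  ring

lemma IsRegularLevy.centeredLp_add_interval (hZ : IsRegularLevy P Z) {u : ℝ≥0} (hst : s ≤ t)
    (htu : t ≤ u) {g : (Fin d → ℝ) → ℝ} (hg : IsLinearTest g) :
    centeredLp P Z g s u = centeredLp P Z g s t + centeredLp P Z g t u := by
  refine Lp.ext ?_
  filter_upwards [hZ.centeredLp_coeFn (hst.trans htu) hg, hZ.centeredLp_coeFn hst hg,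
    hZ.centeredLp_coeFn htu hg, Lp.coeFn_add (centeredLp P Z g s t) (centeredLp P Z g t u)]
    with ω h1 h2 h3 h4
  rw [h1, h4, Pi.add_apply, h2, h3, hZ.centeredJump_add_interval hst htu hg]

omit [IsProbabilityMeasure P] in
lemma norm_sq_Lp_eq (Y : Lp ℝ 2 P) : ‖Y‖ ^ 2 = ∫ ω, Y ω ^ 2 ∂P := by
  rw [← real_inner_self_eq_norm_sq, L2.inner_def]
  simp [sq]

lemma IsRegularLevy.norm_sq_centeredLp (hZ : IsRegularLevy P Z) (hst : s ≤ t)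
    {g : (Fin d → ℝ) → ℝ} (hg : IsLinearTest g) :
    ‖centeredLp P Z g s t‖ ^ 2 = ∫ ω, centeredJump P Z g s t ω ^ 2 ∂P := by
  rw [norm_sq_Lp_eq]
  refine integral_congr_ae ?_
  filter_upwards [hZ.centeredLp_coeFn hst hg] with ω h
  rw [h]

lemma IsRegularLevy.integral_sq_centeredJump_le (hZ : IsRegularLevy P Z) (hst : s ≤ t)
    {g : (Fin d → ℝ) → ℝ} (hg : IsLinearTest g) :
    ∫ ω, centeredJump P Z g s t ω ^ 2 ∂P ≤
      ∫ ω, jumpFunctional Z (fun x => g x ^ 2) s t ω ∂P := by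
  have hm := hZ.memLp_jumpFunctional' hst hg
  obtain ⟨h1, C, hC, h2⟩ := hg
  have := (hZ.memLp_jumpFunctional hst h1 hC h2).2
  rwa [variance_eq_integral hm.1.aemeasurable] at this

/-- The squared norm is at most `E ∑ h i (ΔZ)²`, which tends to `0` by domination with `C² ‖x‖²`.
The functions `h i` need not vanish on a common neighbourhood of `0`, so truncation levels may tend
to `0`. -/
lemma IsRegularLevy.tendsto_centeredLp_zero (hZ : IsRegularLevy P Z) (hst : s ≤ t)
    {ι : Type*} {l : Filter ι} [l.IsCountablyGenerated] {h : ι → (Fin d → ℝ) → ℝ} {C : ℝ}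
    (hC : 0 ≤ C) (hh : ∀ᶠ i in l, IsJumpTest (h i)) (hb : ∀ᶠ i in l, ∀ x, |h i x| ≤ C * ‖x‖)
    (hlim : ∀ x, Tendsto (fun i => h i x) l (𝓝 0)) :
    Tendsto (fun i => centeredLp P Z (h i) s t) l (𝓝 0) := by
  rw [tendsto_zero_iff_norm_tendsto_zero]
  have key : Tendsto (fun i => ‖centeredLp P Z (h i) s t‖ ^ 2) l (𝓝 0) := by
    refine squeeze_zero' (Eventually.of_forall fun i => sq_nonneg _) ?_
      (hZ.tendsto_integral_jumpFunctional_zero hst (sq_nonneg C) (h := fun i x => h i x ^ 2)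
        (hh.mono fun i hi => hi.comp (by fun_prop : Continuous fun y : ℝ => y ^ 2) (by simp))
        (hb.mono fun i hi => sq_le_of_abs_le hi)
        (fun x => by simpa using (hlim x).pow 2))
    filter_upwards [hh, hb] with i h1 h2
    have hl : IsLinearTest (h i) := ⟨h1, C, hC, h2⟩
    rw [hZ.norm_sq_centeredLp hst hl]
    exact hZ.integral_sq_centeredJump_le hst hl
  have := (Real.continuous_sqrt.tendsto 0).comp key
  simpa [Function.comp_def, Real.sqrt_sq (norm_nonneg _)] using this

/-- The compensated jump sums over `{|ℓ x| > ε}` converge in `L²` as `ε ↓ 0`. -/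
lemma IsRegularLevy.exists_tendsto_centeredLp (hZ : IsRegularLevy P Z) (hst : s ≤ t)
    (ℓ : (Fin d → ℝ) →L[ℝ] ℝ) :
    ∃ Y, Tendsto (fun ε => centeredLp P Z (fun x => trunc ε (ℓ x)) s t) (𝓝[>] 0) (𝓝 Y) := by
  refine cauchy_map_iff_exists_tendsto.1 (cauchy_map_iff.2 ⟨inferInstance, ?_⟩)
  rw [tendsto_uniformity_iff_dist_tendsto_zero]
  have hpos : ∀ᶠ p in (𝓝[>] (0 : ℝ)) ×ˢ (𝓝[>] (0 : ℝ)), 0 < p.1 ∧ 0 < p.2 :=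
    have h0 : ∀ᶠ ε in 𝓝[>] (0 : ℝ), 0 < ε := self_mem_nhdsWithin
    h0.prod_mk h0
  have hlin : ∀ᶠ p in (𝓝[>] (0 : ℝ)) ×ˢ (𝓝[>] (0 : ℝ)),
      IsLinearTest (fun x => 1 * trunc p.1 (ℓ x) + (-1) * trunc p.2 (ℓ x)) :=
    hpos.mono fun p hp => (isLinearTest_trunc ℓ hp.1).lin (isLinearTest_trunc ℓ hp.2) 1 (-1)
  -- Cauchy criterion: the difference of two truncations tends to `ℓ x - ℓ x = 0` pointwise and is
  -- at most `2 ‖ℓ‖ ‖x‖`.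
  have := hZ.tendsto_centeredLp_zero hst
    (h := fun (p : ℝ × ℝ) x => 1 * trunc p.1 (ℓ x) + (-1) * trunc p.2 (ℓ x))
    (C := 2 * ‖ℓ‖) (by positivity) (hlin.mono fun p hp => hp.1)
    (Eventually.of_forall fun p x => ?_) (fun x => ?_)
  · rw [tendsto_zero_iff_norm_tendsto_zero] at this
    refine this.congr' ?_
    filter_upwards [hpos] with p hp
    rw [hZ.centeredLp_lin hst (isLinearTest_trunc ℓ hp.1) (isLinearTest_trunc ℓ hp.2), dist_eq_norm]
    congr 1
    simp [sub_eq_add_neg]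
  · have h1 := abs_trunc_clm_le ℓ p.1 x
    have h2 := abs_trunc_clm_le ℓ p.2 x
    rw [abs_le] at *
    constructor <;> linarith
  · have h1 := ((tendsto_trunc (ℓ x)).comp
      (tendsto_fst (f := 𝓝[>] (0 : ℝ)) (g := 𝓝[>] (0 : ℝ)))).const_mul 1
    have h2 := ((tendsto_trunc (ℓ x)).comp
      (tendsto_snd (f := 𝓝[>] (0 : ℝ)) (g := 𝓝[>] (0 : ℝ)))).const_mul (-1)
    simpa using h1.add h2

/-- The `L²`-limits depend linearly on the functional. -/
lemma IsRegularLevy.lin_of_tendsto_centeredLp (hZ : IsRegularLevy P Z) (hst : s ≤ t)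
    {ℓ₁ ℓ₂ : (Fin d → ℝ) →L[ℝ] ℝ} {a b : ℝ} {Y₁ Y₂ Y : Lp ℝ 2 P}
    (h₁ : Tendsto (fun ε => centeredLp P Z (fun x => trunc ε (ℓ₁ x)) s t) (𝓝[>] 0) (𝓝 Y₁))
    (h₂ : Tendsto (fun ε => centeredLp P Z (fun x => trunc ε (ℓ₂ x)) s t) (𝓝[>] 0) (𝓝 Y₂))
    (h : Tendsto (fun ε => centeredLp P Z (fun x => trunc ε ((a • ℓ₁ + b • ℓ₂) x)) s t)
      (𝓝[>] 0) (𝓝 Y)) : Y = a • Y₁ + b • Y₂ := by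
  set ℓ := a • ℓ₁ + b • ℓ₂ with hℓ
  have hpos : ∀ᶠ ε in 𝓝[>] (0 : ℝ), 0 < ε := self_mem_nhdsWithin
  have hl1 : ∀ ε : ℝ, 0 < ε →
      IsLinearTest (fun x => a * trunc ε (ℓ₁ x) + b * trunc ε (ℓ₂ x)) := fun ε hε =>
    (isLinearTest_trunc ℓ₁ hε).lin (isLinearTest_trunc ℓ₂ hε) a b
  -- Truncation is not linear, but its defect of linearity vanishes pointwise as `ε ↓ 0` and has
  -- linear growth uniformly in `ε`.
  have hz := hZ.tendsto_centeredLp_zero hst (l := 𝓝[>] (0 : ℝ))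
    (h := fun ε x => 1 * trunc ε (ℓ x) + (-1) * (a * trunc ε (ℓ₁ x) + b * trunc ε (ℓ₂ x)))
    (C := ‖ℓ‖ + |a| * ‖ℓ₁‖ + |b| * ‖ℓ₂‖) (by positivity)
    (hpos.mono fun ε hε => ((isLinearTest_trunc ℓ hε).lin (hl1 ε hε) 1 (-1)).1)
    (Eventually.of_forall fun ε x => ?_) (fun x => ?_)
  · refine eq_of_sub_eq_zero (tendsto_nhds_unique ((h.sub ((h₁.const_smul a).add
      (h₂.const_smul b))).congr' ?_) hz)
    filter_upwards [hpos] with ε hε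
    rw [hZ.centeredLp_lin hst (isLinearTest_trunc ℓ hε) (hl1 ε hε),
      hZ.centeredLp_lin hst (isLinearTest_trunc ℓ₁ hε) (isLinearTest_trunc ℓ₂ hε)]
    simp [sub_eq_add_neg, add_comm]
  · have e0 := abs_trunc_clm_le ℓ ε x
    have e1 := mul_le_mul_of_nonneg_left (abs_trunc_clm_le ℓ₁ ε x) (abs_nonneg a)
    have e2 := mul_le_mul_of_nonneg_left (abs_trunc_clm_le ℓ₂ ε x) (abs_nonneg b)
    rw [← abs_mul] at e1 e2
    have e3 := abs_add_le (1 * trunc ε (ℓ x)) (-1 * (a * trunc ε (ℓ₁ x) + b * trunc ε (ℓ₂ x)))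
    have e4 := abs_add_le (a * trunc ε (ℓ₁ x)) (b * trunc ε (ℓ₂ x))
    rw [neg_one_mul, abs_neg, one_mul] at e3
    rw [neg_one_mul, one_mul]
    linarith
  · have e1 := ((tendsto_trunc (ℓ₁ x)).const_mul a).add ((tendsto_trunc (ℓ₂ x)).const_mul b)
    have e2 := ((tendsto_trunc (ℓ x)).const_mul 1).add (e1.const_mul (-1))
    have : 1 * ℓ x + -1 * (a * ℓ₁ x + b * ℓ₂ x) = 0 := by simp [hℓ]
    rwa [this] at e2

/-- Centred jump sums over consecutive intervals are independent. -/
lemma IsRegularLevy.iIndepFun_centeredJump (hZ : IsRegularLevy P Z) {τ : ℕ → ℝ≥0}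
    (hτ : Monotone τ) {g : ℕ → (Fin d → ℝ) → ℝ} (hg : ∀ j, IsLinearTest (g j)) :
    iIndepFun (fun j => centeredJump P Z (g j) (τ j) (τ (j + 1))) P :=
  (hZ.iIndepFun_jumpFunctional hτ fun j => (hg j).1).comp
    (fun j y => y - ∫ ω, jumpFunctional Z (g j) (τ j) (τ (j + 1)) ω ∂P)
    fun _ => measurable_id.sub_const _

lemma IsRegularLevy.identDistrib_centeredJump (hZ : IsRegularLevy P Z) {g : (Fin d → ℝ) → ℝ}
    (hg : IsLinearTest g) (s h : ℝ≥0) :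
    IdentDistrib (centeredJump P Z g s (s + h)) (centeredJump P Z g 0 h) P P := by
  have h1 := hZ.identDistrib_jumpFunctional hg.1 s h
  have h2 := h1.comp (u := fun y => y - ∫ ω, jumpFunctional Z g 0 h ω ∂P)
    (measurable_id.sub_const _)
  convert! h2 using 2
  rw [← h1.integral_eq]; rfl

lemma IsRegularLevy.inner_centeredLp (hZ : IsRegularLevy P Z) (hst : s ≤ t)
    {g h : (Fin d → ℝ) → ℝ} (hg : IsLinearTest g) (hh : IsLinearTest h) :
    inner ℝ (centeredLp P Z g 0 s) (centeredLp P Z h s t) = 0 := by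
  rw [L2.inner_def]
  -- Eventually constant times, so that the statement for sequences covers the two intervals `(0,
  -- s]` and `(s, t]`.
  let τ : ℕ → ℝ≥0
    | 0 => 0
    | 1 => s
    | _ => t
  have hτ : Monotone τ := monotone_nat_of_le_succ fun n => by
    match n with
    | 0 => exact zero_le
    | 1 => exact hst
    | n + 2 => exact le_rfl
  have hi := (hZ.iIndepFun_centeredJump hτ (g := fun j => if j = 0 then g else h)
    (fun j => by split_ifs <;> assumption)).indepFun (i := 0) (j := 1) (by norm_num)
  simp only [if_true, one_ne_zero, if_false] at hi
  change IndepFun (centeredJump P Z g 0 s) (centeredJump P Z h s t) P at hi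
  have : ∫ ω, inner ℝ (centeredLp P Z g 0 s ω) (centeredLp P Z h s t ω) ∂P =
      ∫ ω, centeredJump P Z g 0 s ω * centeredJump P Z h s t ω ∂P := by
    refine integral_congr_ae ?_
    filter_upwards [hZ.centeredLp_coeFn zero_le hg, hZ.centeredLp_coeFn hst hh] with ω h1 h2
    rw [h1, h2]; simp [mul_comm]
  rw [this, hi.integral_fun_mul_eq_mul_integral
    (hZ.memLp_centeredJump zero_le hg).1 (hZ.memLp_centeredJump hst hh).1,
    hZ.integral_centeredJump zero_le hg, zero_mul]

end Centered

/-! ### The jump measure of a real functional of a regular Lévy process -/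

section JumpMeasure

variable {d : ℕ} {f : ℝ≥0 → Fin d → ℝ}

lemma IsCadlagPath.jump_clm (hf : IsCadlagPath f) (ℓ : (Fin d → ℝ) →L[ℝ] ℝ) (r : ℝ≥0) :
    jump (fun t => ℓ (f t)) r = ℓ (jumpVec f r) := by
  -- At `0` there is no left limit to compute; both jumps vanish by convention.
  rcases eq_or_lt_of_le (zero_le : 0 ≤ r) with h | h
  · rw [← h, jump_zero, jumpVec_zero, map_zero]
  · have : (𝓝[<] r).NeBot := nhdsLT_neBot_of_exists_lt ⟨0, h⟩
    have h1 : Tendsto (fun t => ℓ (f t)) (𝓝[<] r) (𝓝 (ℓ (f r - jumpVec f r))) :=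
      (ℓ.continuous.tendsto _).comp (hf.tendsto_left r)
    rw [jump, leftLim_eq_of_tendsto h1, ← map_sub, sub_sub_cancel]

/-- A nonnegative function of the jumps, vanishing near `0`, integrates to its jump sum. -/
lemma IsCadlagPath.lintegral_jumpMeasure (hf : IsCadlagPath f) (ℓ : (Fin d → ℝ) →L[ℝ] ℝ)
    {k : ℝ → ℝ} (hv : VanishesNearZero fun x : Fin d → ℝ => k (ℓ x)) (h0 : k 0 = 0)
    (hk : ∀ y, 0 ≤ k y) (t : ℝ≥0) :
    ∫⁻ y, ENNReal.ofReal (k y) ∂(jumpMeasure (fun s => ℓ (f s)) t) =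
      ENNReal.ofReal (jumpSum (fun x => k (ℓ x)) f 0 t) := by
  rw [jumpMeasure, lintegral_sum_measure]
  simp only [lintegral_dirac]
  refine (tsum_subtype {s : ℝ≥0 | s ≤ t ∧ jump (fun s => ℓ (f s)) s ≠ 0}
    (fun s => ENNReal.ofReal (k (jump (fun s => ℓ (f s)) s)))).trans ?_
  rw [jumpSum,
    ENNReal.ofReal_tsum_of_nonneg (fun r => Set.indicator_nonneg (fun r _ => hk _) r)
      (hf.summable_jumps hv 0 t)]
  refine tsum_congr fun r => ?_
  simp only [Set.indicator, Set.mem_ofPred_eq, hf.jump_clm ℓ, Set.mem_Ioc]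
  by_cases hr : r ≤ t
  · by_cases hj : ℓ (jumpVec f r) = 0
    · simp [hj, h0]
    · have hr0 : 0 < r := by
        rcases eq_or_lt_of_le (zero_le : 0 ≤ r) with h | h
        · rw [← h, jumpVec_zero, map_zero] at hj; exact absurd rfl hj
        · exact h
      simp [hr, hj, hr0]
  · simp [hr]

/-- Both parts have a finite integral because the right-hand sides are `ENNReal.ofReal` of real
numbers. Integrability is thus a consequence. -/
lemma integral_eq_sub_of_lintegral {α : Type*} [MeasurableSpace α] {μ : Measure α} {h : α → ℝ}
    (hm : Measurable h) {A B : ℝ} (hA : 0 ≤ A) (hB : 0 ≤ B)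
    (h1 : ∫⁻ y, ENNReal.ofReal (max (h y) 0) ∂μ = ENNReal.ofReal A)
    (h2 : ∫⁻ y, ENNReal.ofReal (max (-h y) 0) ∂μ = ENNReal.ofReal B) :
    ∫ y, h y ∂μ = A - B := by
  have e : ∀ z : ℝ, ENNReal.ofReal (max z 0) = ENNReal.ofReal z := fun z => by
    rcases le_total z 0 with hz | hz
    · rw [max_eq_right hz, ENNReal.ofReal_zero, ENNReal.ofReal_of_nonpos hz]
    · rw [max_eq_left hz]
  have hi : Integrable h μ := by
    refine ⟨hm.aestronglyMeasurable, ?_⟩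
    rw [hasFiniteIntegral_iff_norm]
    have : ∀ y, ENNReal.ofReal ‖h y‖ = ENNReal.ofReal (max (h y) 0)
        + ENNReal.ofReal (max (-h y) 0) := fun y => by
      rw [← ENNReal.ofReal_add (le_max_right _ _) (le_max_right _ _), Real.norm_eq_abs]
      congr 1
      rcases le_total (h y) 0 with hz | hz
      · rw [abs_of_nonpos hz, max_eq_right hz, max_eq_left (by linarith)]; ring
      · rw [abs_of_nonneg hz, max_eq_left hz, max_eq_right (by linarith)]; ring
    simp_rw [this]
    rw [lintegral_add_left (hm.max measurable_const).ennreal_ofReal, h1, h2]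
    exact ENNReal.add_lt_top.2 ⟨ENNReal.ofReal_lt_top, ENNReal.ofReal_lt_top⟩
  simp only [e] at h1 h2
  rw [integral_eq_lintegral_pos_part_sub_lintegral_neg_part hi, h1, h2,
    ENNReal.toReal_ofReal hA, ENNReal.toReal_ofReal hB]

lemma measurable_trunc (ε : ℝ) : Measurable (trunc ε) :=
  Measurable.ite (measurableSet_lt measurable_const measurable_id.abs) measurable_id
    measurable_const

lemma setIntegral_eq_integral_trunc (μ : Measure ℝ) (ε : ℝ) :
    ∫ β in {β : ℝ | ε < |β|}, β ∂μ = ∫ β, trunc ε β ∂μ := by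
  have hm : MeasurableSet {β : ℝ | ε < |β|} :=
    measurableSet_lt measurable_const measurable_id.abs
  rw [← integral_indicator hm]
  rfl

lemma jumpTest_pos_trunc (ℓ : (Fin d → ℝ) →L[ℝ] ℝ) {ε : ℝ} (hε : 0 < ε) :
    IsJumpTest (fun x => max (trunc ε (ℓ x)) 0) ∧ IsJumpTest (fun x => max (-trunc ε (ℓ x)) 0) :=
  ⟨(isJumpTest_trunc ℓ hε).comp (φ := fun y => max y 0) (by fun_prop) (by simp),
    (isJumpTest_trunc ℓ hε).comp (φ := fun y => max (-y) 0) (by fun_prop) (by simp)⟩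

lemma IsCadlagPath.jumpSum_trunc (hf : IsCadlagPath f) (ℓ : (Fin d → ℝ) →L[ℝ] ℝ) {ε : ℝ}
    (hε : 0 < ε) (t : ℝ≥0) :
    jumpSum (fun x => trunc ε (ℓ x)) f 0 t = jumpSum (fun x => max (trunc ε (ℓ x)) 0) f 0 t -
      jumpSum (fun x => max (-trunc ε (ℓ x)) 0) f 0 t := by
  obtain ⟨h1, h2⟩ := jumpTest_pos_trunc ℓ hε
  have := hf.jumpSum_lin h1.vanishes h2.vanishes 1 (-1) 0 t
  rw [one_mul, neg_one_mul, ← sub_eq_add_neg] at this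
  rw [← this]
  congr 1
  funext x
  rcases le_total (trunc ε (ℓ x)) 0 with h | h
  · rw [max_eq_right h, max_eq_left (by linarith)]; ring
  · rw [max_eq_left h, max_eq_right (by linarith)]; ring

lemma IsCadlagPath.setIntegral_jumpMeasure (hf : IsCadlagPath f) (ℓ : (Fin d → ℝ) →L[ℝ] ℝ) {ε : ℝ}
    (hε : 0 < ε) (t : ℝ≥0) :
    ∫ β in {β : ℝ | ε < |β|}, β ∂(jumpMeasure (fun s => ℓ (f s)) t) =
      jumpSum (fun x => trunc ε (ℓ x)) f 0 t := by
  obtain ⟨h1, h2⟩ := jumpTest_pos_trunc ℓ hε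
  rw [setIntegral_eq_integral_trunc, hf.jumpSum_trunc ℓ hε]
  exact integral_eq_sub_of_lintegral (measurable_trunc ε)
    (jumpSum_nonneg fun x => le_max_right _ _) (jumpSum_nonneg fun x => le_max_right _ _)
    (hf.lintegral_jumpMeasure ℓ (k := fun y => max (trunc ε y) 0) h1.vanishes
      (by simp [trunc_zero]) (fun y => le_max_right _ _) t)
    (hf.lintegral_jumpMeasure ℓ (k := fun y => max (-trunc ε y) 0) h2.vanishes
      (by simp [trunc_zero]) (fun y => le_max_right _ _) t)

/-- The distance to the complement is positive exactly on the open set `O`, so its multiples capped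
at `1` tend to the indicator. -/
lemma isJumpTest_indicator (ℓ : (Fin d → ℝ) →L[ℝ] ℝ) {O : Set ℝ} (hO : IsOpen O) {ε : ℝ}
    (hε : 0 < ε) (hOε : ∀ y ∈ O, ε < |y|) :
    IsJumpTest fun x => O.indicator (fun _ => (1 : ℝ)) (ℓ x) := by
  have h0 : ∀ {y : ℝ}, |y| ≤ ε → y ∈ Oᶜ := fun hy h => absurd (hOε _ h) (not_lt.2 hy)
  have hne : (Oᶜ).Nonempty := ⟨0, h0 (by simpa using hε.le)⟩
  refine ⟨ε / (‖ℓ‖ + 1), by positivity, fun k x => min 1 (k * Metric.infDist (ℓ x) Oᶜ),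
    fun k => ?_, fun k x hx => ?_, fun x => ?_⟩
  · exact continuous_const.min (continuous_const.mul
      ((Metric.continuous_infDist_pt _).comp ℓ.continuous))
  · simp [Metric.infDist_zero_of_mem (h0 (norm_clm_le hx))]
  · simp only
    by_cases hx : ℓ x ∈ O
    · rw [Set.indicator_of_mem hx]
      have hpos : 0 < Metric.infDist (ℓ x) Oᶜ :=
        (hO.isClosed_compl.notMem_iff_infDist_pos hne).1 (not_not.2 hx)
      refine tendsto_const_nhds.congr' ?_
      filter_upwards [eventually_ge_atTop ⌈1 / Metric.infDist (ℓ x) Oᶜ⌉₊] with k hk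
      rw [min_eq_left]
      rw [← div_le_iff₀ hpos]
      exact (Nat.le_ceil _).trans (by exact_mod_cast hk)
    · rw [Set.indicator_of_notMem hx]
      simp [Metric.infDist_zero_of_mem (show ℓ x ∈ Oᶜ from hx)]

variable {Ω : Type*} {mΩ : MeasurableSpace Ω} {P : Measure Ω} {Z : ℝ≥0 → Ω → Fin d → ℝ}

lemma IsCadlagPath.jumpMeasure_of_isOpen (hf : IsCadlagPath f) (ℓ : (Fin d → ℝ) →L[ℝ] ℝ)
    {O : Set ℝ} (hO : IsOpen O) {ε : ℝ} (hε : 0 < ε) (hOε : ∀ y ∈ O, ε < |y|) (t : ℝ≥0) :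
    jumpMeasure (fun s => ℓ (f s)) t O =
      ENNReal.ofReal (jumpSum (fun x => O.indicator (fun _ => (1 : ℝ)) (ℓ x)) f 0 t) := by
  rw [← hf.lintegral_jumpMeasure ℓ (k := O.indicator (fun _ => (1 : ℝ)))
    (isJumpTest_indicator ℓ hO hε hOε).vanishes
    (Set.indicator_of_notMem (fun h => by simpa using hε.trans (hOε 0 h)) _)
    (fun y => Set.indicator_nonneg (fun _ _ => zero_le_one) y), ← lintegral_indicator_one
      hO.measurableSet]
  refine lintegral_congr fun y => ?_
  by_cases hy : y ∈ O <;> simp [hy]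

lemma jumpMeasure_zero (f : ℝ≥0 → ℝ) (t : ℝ≥0) : jumpMeasure f t {0} = 0 := by
  rw [jumpMeasure, Measure.sum_apply _ (measurableSet_singleton 0)]
  refine ENNReal.tsum_eq_zero.2 fun s => ?_
  rw [Measure.dirac_apply' _ (measurableSet_singleton 0)]
  exact Set.indicator_of_notMem (s := {0}) (fun h => s.2.2 h) _

lemma isOpen_lt_abs (c : ℝ) : IsOpen {y : ℝ | c < |y|} :=
  isOpen_lt continuous_const continuous_abs

/-- Needed to integrate against the `Measure.bind` that defines the Lévy measure. The jump measure
may be infinite near `0`, so the π-system argument runs on its finite restrictions to `{1 / (k + 1)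
< |y|}`; these exhaust it because `{0}` is null. -/
lemma IsRegularLevy.measurable_jumpMeasure (hZ : IsRegularLevy P Z) (ℓ : (Fin d → ℝ) →L[ℝ] ℝ)
    (t : ℝ≥0) : Measurable fun ω => jumpMeasure (fun s => ℓ (Z s ω)) t := by
  set κ : Ω → Measure ℝ := fun ω => jumpMeasure (fun s => ℓ (Z s ω)) t with hκ
  set A : ℕ → Set ℝ := fun k => {y : ℝ | 1 / ((k : ℝ) + 1) < |y|} with hA
  have hpos : ∀ k : ℕ, (0 : ℝ) < 1 / ((k : ℝ) + 1) := fun k => Nat.one_div_pos_of_nat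
  have hAo : ∀ k, IsOpen (A k) := fun k => isOpen_lt_abs _
  have hAmono : Monotone A := fun k l hkl y hy =>
    lt_of_le_of_lt (Nat.one_div_le_one_div hkl : (1 : ℝ) / (l + 1) ≤ 1 / (k + 1)) hy
  have hAU : ⋃ k, A k = {0}ᶜ := by
    ext y
    simp only [Set.mem_iUnion, Set.mem_compl_iff, Set.mem_singleton_iff, hA, Set.mem_ofPred_eq]
    constructor
    · rintro ⟨k, hk⟩ rfl
      rw [abs_zero] at hk
      exact absurd (hpos k) (not_lt.2 hk.le)
    · intro hy
      exact exists_nat_one_div_lt (abs_pos.2 hy)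
  have hopen : ∀ k {O : Set ℝ}, IsOpen O → Measurable fun ω => κ ω (O ∩ A k) := by
    intro k O hO
    have hOA : ∀ y ∈ O ∩ A k, 1 / ((k : ℝ) + 1) < |y| := fun y hy => hy.2
    simp only [hκ, fun ω => (hZ.cadlag ω).jumpMeasure_of_isOpen ℓ (hO.inter (hAo k)) (hpos k) hOA t]
    exact (hZ.measurable_jumpFunctional (isJumpTest_indicator ℓ (hO.inter (hAo k)) (hpos k) hOA)
      zero_le).ennreal_ofReal
  have hfin : ∀ k ω, IsFiniteMeasure ((κ ω).restrict (A k)) := fun k ω => ⟨by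
    rw [Measure.restrict_apply_univ, hκ]
    simp only
    rw [(hZ.cadlag ω).jumpMeasure_of_isOpen ℓ (hAo k) (hpos k) (fun y hy => hy) t]
    exact ENNReal.ofReal_lt_top⟩
  have hrestr : ∀ k, Measurable fun ω => (κ ω).restrict (A k) := by
    intro k
    have := hfin k
    refine Measurable.measure_of_isPiSystem BorelSpace.measurable_eq isPiSystem_isOpen
      (fun O hO => ?_) ?_
    · have hO' : IsOpen O := hO
      simp only [Measure.restrict_apply hO'.measurableSet]
      exact hopen k hO'
    · simp only [Measure.restrict_apply MeasurableSet.univ]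
      exact hopen k isOpen_univ
  refine Measure.measurable_of_measurable_coe _ fun B hB => ?_
  have : ∀ ω, κ ω B = ⨆ k, (κ ω).restrict (A k) B := by
    intro ω
    have h1 : κ ω B = κ ω (⋃ k, B ∩ A k) := by
      rw [← Set.inter_iUnion, hAU, ← Set.sdiff_eq]
      exact (measure_sdiff_null (jumpMeasure_zero _ _)).symm
    rw [h1, Monotone.measure_iUnion (fun k l hkl => Set.inter_subset_inter_right _ (hAmono hkl))]
    exact iSup_congr fun k => (Measure.restrict_apply hB).symm
  change Measurable fun ω => κ ω B
  simp_rw [this]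
  exact Measurable.iSup fun k => (Measure.measurable_coe hB).comp (hrestr k)

variable [IsProbabilityMeasure P]

/-- Integrating against the mean jump measure is taking the mean of the jump sums. This is done for
the positive and negative parts as lower integrals, both finite. -/
lemma IsRegularLevy.setIntegral_levyMeasure (hZ : IsRegularLevy P Z) (ℓ : (Fin d → ℝ) →L[ℝ] ℝ)
    {X : ℝ≥0 → Ω → ℝ} (hX : ∀ᵐ ω ∂P, ∀ t, X t ω = ℓ (Z t ω)) {ε : ℝ} (hε : 0 < ε) :
    ∫ β in {β : ℝ | ε < |β|}, β ∂(levyMeasure P X) =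
      ∫ ω, jumpFunctional Z (fun x => trunc ε (ℓ x)) 0 1 ω ∂P := by
  have hcongr : levyMeasure P X = P.bind fun ω => jumpMeasure (fun s => ℓ (Z s ω)) 1 := by
    refine Measure.bind_congr_right ?_
    filter_upwards [hX] with ω hω
    simp only [hω]
  obtain ⟨h1, h2⟩ := jumpTest_pos_trunc ℓ hε
  have hlin := isLinearTest_trunc ℓ hε
  obtain ⟨δ, hδ, hv⟩ := hlin.1.vanishes
  have hbd := abs_le_mul_sq_of_vanishes hδ (norm_nonneg ℓ) hv (abs_trunc_clm_le ℓ ε)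
  have hi1 := hZ.integrable_jumpFunctional (s := 0) (t := 1) zero_le h1
    (C := ‖ℓ‖ / δ) (by positivity) (fun x => le_trans (by
      rw [abs_of_nonneg (le_max_right _ _)]
      exact max_le (le_abs_self _) (abs_nonneg _)) (hbd x))
  have hi2 := hZ.integrable_jumpFunctional (s := 0) (t := 1) zero_le h2
    (C := ‖ℓ‖ / δ) (by positivity) (fun x => le_trans (by
      rw [abs_of_nonneg (le_max_right _ _)]
      exact max_le (neg_le_abs _) (abs_nonneg _)) (hbd x))
  have hlint : ∀ k : ℝ → ℝ, Measurable k → k 0 = 0 → (∀ y, 0 ≤ k y) →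
      IsJumpTest (fun x => k (ℓ x)) → Integrable (jumpFunctional Z (fun x => k (ℓ x)) 0 1) P →
      ∫⁻ y, ENNReal.ofReal (k y) ∂(levyMeasure P X) =
        ENNReal.ofReal (∫ ω, jumpFunctional Z (fun x => k (ℓ x)) 0 1 ω ∂P) := by
    intro k hkm hk0 hkn hkt hki
    rw [hcongr, Measure.lintegral_bind (hZ.measurable_jumpMeasure ℓ 1).aemeasurable
      hkm.ennreal_ofReal.aemeasurable,
      ofReal_integral_eq_lintegral_ofReal hki (ae_of_all _ fun ω => jumpSum_nonneg fun x => hkn _)]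
    exact lintegral_congr fun ω => (hZ.cadlag ω).lintegral_jumpMeasure ℓ hkt.vanishes hk0 hkn 1
  rw [setIntegral_eq_integral_trunc]
  have hsub : ∫ ω, jumpFunctional Z (fun x => trunc ε (ℓ x)) 0 1 ω ∂P =
      ∫ ω, jumpFunctional Z (fun x => max (trunc ε (ℓ x)) 0) 0 1 ω ∂P -
      ∫ ω, jumpFunctional Z (fun x => max (-trunc ε (ℓ x)) 0) 0 1 ω ∂P := by
    rw [← integral_sub hi1 hi2]
    exact integral_congr_ae (ae_of_all _ fun ω => (hZ.cadlag ω).jumpSum_trunc ℓ hε 1)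
  rw [hsub]
  exact integral_eq_sub_of_lintegral (measurable_trunc ε)
    (integral_nonneg fun ω => jumpSum_nonneg fun x => le_max_right _ _)
    (integral_nonneg fun ω => jumpSum_nonneg fun x => le_max_right _ _)
    (hlint (fun y => max (trunc ε y) 0) ((measurable_trunc ε).max measurable_const)
      (by simp [trunc_zero]) (fun y => le_max_right _ _) h1 hi1)
    (hlint (fun y => max (-trunc ε y) 0) ((measurable_trunc ε).neg.max measurable_const)
      (by simp [trunc_zero]) (fun y => le_max_right _ _) h2 hi2)

/-- The compensated integral over the large jumps is the centred jump sum. -/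
lemma IsRegularLevy.truncatedJumpIntegral_ae_eq (hZ : IsRegularLevy P Z)
    (ℓ : (Fin d → ℝ) →L[ℝ] ℝ) {X : ℝ≥0 → Ω → ℝ} (hX : ∀ᵐ ω ∂P, ∀ t, X t ω = ℓ (Z t ω)) {ε : ℝ}
    (hε : 0 < ε) (t : ℝ≥0) :
    truncatedJumpIntegral P X ε t =ᵐ[P] centeredJump P Z (fun x => trunc ε (ℓ x)) 0 t := by
  have hlin := isLinearTest_trunc ℓ hε
  obtain ⟨δ, hδ, hv⟩ := hlin.1.vanishes
  have hbd := abs_le_mul_sq_of_vanishes hδ (norm_nonneg ℓ) hv (abs_trunc_clm_le ℓ ε)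
  filter_upwards [hX] with ω hω
  -- The compensator, `t` times a mean at time `1`, is the mean at time `t`.
  rw [truncatedJumpIntegral, centeredJump, hZ.setIntegral_levyMeasure ℓ hX hε,
    hZ.integral_jumpFunctional hlin.1 (by positivity) hbd t]
  simp only [hω]
  rw [(hZ.cadlag ω).setIntegral_jumpMeasure ℓ hε t]
  rfl

lemma IsRegularLevy.isCompensatedJumpIntegral_iff (hZ : IsRegularLevy P Z)
    (ℓ : (Fin d → ℝ) →L[ℝ] ℝ) {X : ℝ≥0 → Ω → ℝ} (hX : ∀ᵐ ω ∂P, ∀ t, X t ω = ℓ (Z t ω))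
    (t : ℝ≥0) (Y : Lp ℝ 2 P) :
    IsCompensatedJumpIntegral P X t Y ↔
      Tendsto (fun ε => centeredLp P Z (fun x => trunc ε (ℓ x)) 0 t) (𝓝[>] 0) (𝓝 Y) := by
  rw [IsCompensatedJumpIntegral, tendsto_iff_edist_tendsto_0]
  refine tendsto_congr' ?_
  filter_upwards [self_mem_nhdsWithin] with ε hε
  rw [Lp.edist_def]
  refine eLpNorm_congr_ae ?_
  filter_upwards [hZ.truncatedJumpIntegral_ae_eq ℓ hX hε t,
    hZ.centeredLp_coeFn zero_le (isLinearTest_trunc ℓ hε)] with ω h1 h2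
  rw [h1, Pi.sub_apply, h2]

/-- Existence of the limit selects the meaningful branch of `compensatedJumpIntegral`. -/
lemma IsRegularLevy.isCompensatedJumpIntegral (hZ : IsRegularLevy P Z)
    (ℓ : (Fin d → ℝ) →L[ℝ] ℝ) {X : ℝ≥0 → Ω → ℝ} (hX : ∀ᵐ ω ∂P, ∀ t, X t ω = ℓ (Z t ω))
    (t : ℝ≥0) : IsCompensatedJumpIntegral P X t (compensatedJumpIntegral P X t) := by
  have h : ∃ Y, IsCompensatedJumpIntegral P X t Y := by
    obtain ⟨Y, hY⟩ := hZ.exists_tendsto_centeredLp (s := 0) (t := t) zero_le ℓ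
    exact ⟨Y, (hZ.isCompensatedJumpIntegral_iff ℓ hX t Y).2 hY⟩
  rw [compensatedJumpIntegral, dif_pos h]
  exact h.choose_spec

lemma IsRegularLevy.tendsto_compensatedJumpIntegral (hZ : IsRegularLevy P Z)
    (ℓ : (Fin d → ℝ) →L[ℝ] ℝ) {X : ℝ≥0 → Ω → ℝ} (hX : ∀ᵐ ω ∂P, ∀ t, X t ω = ℓ (Z t ω))
    (t : ℝ≥0) : Tendsto (fun ε => centeredLp P Z (fun x => trunc ε (ℓ x)) 0 t) (𝓝[>] 0)
      (𝓝 (compensatedJumpIntegral P X t)) :=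
  (hZ.isCompensatedJumpIntegral_iff ℓ hX t _).1 (hZ.isCompensatedJumpIntegral ℓ hX t)

end JumpMeasure

/-! ### Operations on càdlàg functions -/

section CadlagOps

/-- Locally uniform limits of càdlàg functions are càdlàg. -/
lemma isCadlag_of_uniform_approx {f : ℝ≥0 → ℝ}
    (h : ∀ T : ℝ≥0, ∀ η > 0, ∃ g, IsCadlag g ∧ ∀ t < T, |f t - g t| ≤ η) : IsCadlag f := by
  intro t
  have hT : ∀ᶠ u in 𝓝 t, u < t + 1 := gt_mem_nhds (lt_add_of_pos_right t one_pos)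
  constructor
  · rw [ContinuousWithinAt, Metric.tendsto_nhds]
    intro η hη
    obtain ⟨g, hg, hfg⟩ := h (t + 1) (η / 4) (by positivity)
    have h1 := (Metric.tendsto_nhds.1 (hg t).1) (η / 4) (by positivity)
    filter_upwards [h1, nhdsWithin_le_nhds hT] with u hu huT
    have h2 := hfg u huT
    have h3 := hfg t (lt_add_of_pos_right t one_pos)
    rw [Real.dist_eq, abs_lt] at *
    rw [abs_le] at h2 h3
    constructor <;> linarith
  · rcases (𝓝[<] t).eq_or_neBot with hb | hb
    · exact ⟨0, by simp [hb]⟩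
    · refine cauchy_map_iff_exists_tendsto.1 (Metric.cauchy_iff.2 ⟨inferInstance, fun η hη => ?_⟩)
      obtain ⟨g, hg, hfg⟩ := h (t + 1) (η / 5) (by positivity)
      obtain ⟨l, hl⟩ := (hg t).2
      have h1 := (Metric.tendsto_nhds.1 hl) (η / 5) (by positivity)
      refine ⟨_, image_mem_map (h1.and (nhdsWithin_le_nhds hT)), ?_⟩
      rintro _ ⟨u, ⟨hu, huT⟩, rfl⟩ _ ⟨v, ⟨hv, hvT⟩, rfl⟩
      have h2 := hfg u huT
      have h3 := hfg v hvT
      rw [Real.dist_eq, abs_lt] at *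
      rw [abs_le] at h2 h3
      constructor <;> linarith

lemma isCadlag_of_continuous {f : ℝ≥0 → ℝ} (hf : Continuous f) : IsCadlag f := fun t =>
  ⟨hf.continuousWithinAt, f t, hf.continuousWithinAt⟩

lemma isCadlag_sub {f g : ℝ≥0 → ℝ} (hf : IsCadlag f) (hg : IsCadlag g) :
    IsCadlag fun t => f t - g t := fun t => by
  obtain ⟨l, hl⟩ := (hf t).2
  obtain ⟨l', hl'⟩ := (hg t).2
  exact ⟨(hf t).1.sub (hg t).1, l - l', hl.sub hl'⟩

lemma isCadlag_sum {ι : Type*} {f : ι → ℝ≥0 → ℝ} (s : Finset ι) (hf : ∀ i, IsCadlag (f i)) :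
    IsCadlag fun t => ∑ i ∈ s, f i t := fun t => by
  choose l hl using fun i => (hf i t).2
  exact ⟨tendsto_finsetSum _ fun i _ => (hf i t).1, ∑ i ∈ s, l i,
    tendsto_finsetSum _ fun i _ => hl i⟩

lemma isCadlag_step (r : ℝ≥0) (c : ℝ) : IsCadlag fun t => if r ≤ t then c else 0 := by
  intro t
  constructor
  · rcases le_or_gt r t with h | h
    · refine tendsto_const_nhds.congr' ?_
      filter_upwards [self_mem_nhdsWithin] with u hu
      rw [if_pos h, if_pos (h.trans hu)]
    · refine tendsto_const_nhds.congr' ?_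
      filter_upwards [nhdsWithin_le_nhds (gt_mem_nhds h)] with u hu
      rw [if_neg (not_le.2 h), if_neg (not_le.2 hu)]
  · rcases lt_or_ge r t with h | h
    · refine ⟨c, tendsto_const_nhds.congr' ?_⟩
      filter_upwards [nhdsWithin_le_nhds (lt_mem_nhds h)] with u hu
      rw [if_pos (le_of_lt hu)]
    · refine ⟨0, tendsto_const_nhds.congr' ?_⟩
      filter_upwards [self_mem_nhdsWithin] with u hu
      rw [if_neg (not_le.2 (lt_of_lt_of_le hu h))]

/-- Before any time `T` the jump sum is exactly a finite sum of step functions. -/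
lemma IsCadlagPath.isCadlag_jumpSum {d : ℕ} {f : ℝ≥0 → Fin d → ℝ} (hf : IsCadlagPath f)
    {g : (Fin d → ℝ) → ℝ} (hg : VanishesNearZero g) : IsCadlag fun t => jumpSum g f 0 t := by
  classical
  obtain ⟨ε, hε, hv⟩ := hg
  refine isCadlag_of_uniform_approx fun T η hη => ?_
  have hR := hf.finite_bigJumps hε 0 T
  refine ⟨fun t => ∑ r ∈ hR.toFinset, if r ≤ t then g (jumpVec f r) else 0,
    isCadlag_sum _ fun r => isCadlag_step r _, fun t ht => ?_⟩
  have hRt := hf.finite_bigJumps hε 0 t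
  beta_reduce
  rw [jumpSum_eq_sum hv hRt, ← Finset.sum_filter]
  have : hRt.toFinset = hR.toFinset.filter (fun r => r ≤ t) := by
    ext r
    simp only [Set.Finite.mem_toFinset, Finset.mem_filter, Set.mem_ofPred_eq, Set.mem_Ioc]
    constructor
    · rintro ⟨⟨h1, h2⟩, h3⟩
      exact ⟨⟨⟨h1, h2.trans ht.le⟩, h3⟩, h2⟩
    · rintro ⟨⟨⟨h1, _⟩, h3⟩, h2⟩
      exact ⟨⟨h1, h2⟩, h3⟩
  rw [this, sub_self, abs_zero]
  exact hη.le

end CadlagOps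

/-! ### Paths and increments of centred jump sums -/

section CenteredPaths

variable {Ω : Type*} {mΩ : MeasurableSpace Ω} {P : Measure Ω} {d : ℕ}
  {Z : ℝ≥0 → Ω → Fin d → ℝ} {s t : ℝ≥0} [IsProbabilityMeasure P]

/-- The compensator is linear in `t`, hence continuous. -/
lemma IsRegularLevy.isCadlag_centeredJump (hZ : IsRegularLevy P Z) {g : (Fin d → ℝ) → ℝ}
    (hg : IsLinearTest g) (ω : Ω) : IsCadlag fun t => centeredJump P Z g 0 t ω := by
  obtain ⟨h1, C, hC, h2⟩ := hg
  obtain ⟨δ, hδ, hv⟩ := h1.vanishes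
  refine isCadlag_sub ((hZ.cadlag ω).isCadlag_jumpSum h1.vanishes) (isCadlag_of_continuous ?_)
  have h := funext fun t => hZ.integral_jumpFunctional h1 (div_nonneg hC hδ.le)
    (abs_le_mul_sq_of_vanishes hδ hC hv h2) t
  rw [h]
  fun_prop

omit [IsProbabilityMeasure P] in
lemma centeredJump_self (g : (Fin d → ℝ) → ℝ) (s : ℝ≥0) (ω : Ω) :
    centeredJump P Z g s s ω = 0 := by
  simp [centeredJump, jumpFunctional, jumpSum_self]

/-- Doob's maximal inequality for centred jump sums. -/
lemma IsRegularLevy.measureReal_sup_centeredJump_le (hZ : IsRegularLevy P Z)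
    {g : (Fin d → ℝ) → ℝ} (hg : IsLinearTest g) (T : ℝ≥0) {c : ℝ} (hc : 0 < c) :
    P {ω | ∃ t ≤ T, c < |centeredJump P Z g 0 t ω|} ≤
      ENNReal.ofReal ((∫ ω, centeredJump P Z g 0 T ω ^ 2 ∂P) / c ^ 2) := by
  set b := ENNReal.ofReal ((∫ ω, centeredJump P Z g 0 T ω ^ 2 ∂P) / c ^ 2) with hb
  set A : ℕ → Set Ω := fun n =>
    {ω | ∃ k ≤ n, c ≤ |centeredJump P Z g 0 (grid 0 T n k) ω|} with hA
  have hAle : ∀ n, 0 < n → P (A n) ≤ b := by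
    intro n hn
    set ξ : ℕ → Ω → ℝ := fun k => centeredJump P Z g (grid 0 T n k) (grid 0 T n (k + 1)) with hξ
    have hmono := grid_mono 0 T n
    have hsum : ∀ k ω, ∑ i ∈ Finset.range k, ξ i ω = centeredJump P Z g 0 (grid 0 T n k) ω := by
      intro k ω
      induction k with
      | zero => rw [grid_zero, centeredJump_self, Finset.range_zero, Finset.sum_empty]
      | succ k ih =>
        rw [Finset.sum_range_succ, ih,
          hZ.centeredJump_add_interval (s := 0) zero_le (hmono (Nat.le_succ k)) hg]
    have := kolmogorov_maximal (P := P) (hZ.iIndepFun_centeredJump hmono fun _ => hg)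
      (fun i => hZ.measurable_centeredJump (hmono (Nat.le_succ i)) hg)
      (fun i => hZ.memLp_centeredJump (hmono (Nat.le_succ i)) hg)
      (fun i => hZ.integral_centeredJump (hmono (Nat.le_succ i)) hg) n hc
    change P.real {ω | ∃ k ≤ n, c ≤ |∑ i ∈ Finset.range k, ξ i ω|} ≤
      (∫ ω, (∑ i ∈ Finset.range n, ξ i ω) ^ 2 ∂P) / c ^ 2 at this
    simp only [hsum, grid_self (zero_le : 0 ≤ T) hn.ne'] at this
    rw [hb, ENNReal.le_ofReal_iff_toReal_le (measure_ne_top _ _)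
      (div_nonneg (integral_nonneg fun ω => sq_nonneg _) (sq_nonneg c))]
    exact this
  -- By right-continuity a strict excess at `t` persists at the next grid point once the mesh is
  -- small, so `ω` lies in `A n` for all large `n`. The times `0` and `T` are treated apart.
  have hsub : {ω | ∃ t ≤ T, c < |centeredJump P Z g 0 t ω|} ⊆
      ⋃ N : ℕ, ⋂ n ∈ Set.Ici (N + 1), A n := by
    rintro ω ⟨t, htT, ht⟩
    rw [Set.mem_iUnion]
    rcases eq_or_lt_of_le htT with rfl | htT
    · refine ⟨0, Set.mem_iInter₂.2 fun n hn => ⟨n, le_rfl, ?_⟩⟩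
      have : n ≠ 0 := by have : 1 ≤ n := hn; omega
      rw [grid_self zero_le this]
      exact ht.le
    have hev : ∀ᶠ u in 𝓝[≥] t, c < |centeredJump P Z g 0 u ω| :=
      ((hZ.isCadlag_centeredJump hg ω t).1.abs).eventually (lt_mem_nhds ht)
    rw [eventually_nhdsWithin_iff, Metric.eventually_nhds_iff] at hev
    obtain ⟨δ, hδ, H⟩ := hev
    have hmesh : ∀ᶠ n : ℕ in atTop, ((T - 0 : ℝ≥0) : ℝ) / n < δ :=
      (tendsto_order.1 (tendsto_const_div_atTop_nhds_zero_nat _)).2 _ hδ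
    obtain ⟨N, hN⟩ := eventually_atTop.1 hmesh
    refine ⟨N, Set.mem_iInter₂.2 fun n hn => ?_⟩
    have hNn : N + 1 ≤ n := hn
    have hn0 : n ≠ 0 := by omega
    rcases eq_or_lt_of_le (zero_le : 0 ≤ t) with rfl | h0
    · exact absurd ht (by rw [centeredJump_self, abs_zero]; exact not_lt.2 hc.le)
    obtain ⟨i, hin, hi⟩ := exists_grid_interval (zero_le : 0 ≤ T) hn0 ⟨h0, htT.le⟩
    refine ⟨i + 1, hin, (H ?_ hi.2).le⟩
    have a1 : (grid 0 T n i : ℝ) < t := by exact_mod_cast hi.1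
    have a2 : (t : ℝ) ≤ grid 0 T n (i + 1) := by exact_mod_cast hi.2
    refine lt_of_le_of_lt ?_ (hN n (by omega))
    rw [← dist_grid_succ 0 T n i, NNReal.dist_eq, NNReal.dist_eq, abs_of_nonneg (by linarith),
      abs_of_nonneg (by linarith)]
    linarith
  refine (measure_mono hsub).trans ?_
  -- The intersections increase with `N`, so the uniform bound on `P (A n)` passes to their union.
  rw [Monotone.measure_iUnion]
  · refine iSup_le fun N => (measure_mono ?_).trans (hAle (N + 1) N.succ_pos)
    exact Set.biInter_subset_of_mem (Set.mem_Ici.2 le_rfl)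
  · intro N M hNM
    exact Set.biInter_subset_biInter_left (Set.Ici_subset_Ici.2 (by omega))

end CenteredPaths

/-! ### The `L²`-limit as a process -/

section LimitProcess

variable {Ω : Type*} {mΩ : MeasurableSpace Ω} {P : Measure Ω} {d : ℕ}
  {Z : ℝ≥0 → Ω → Fin d → ℝ} {s t : ℝ≥0} [IsProbabilityMeasure P]

/-- `M` is the process of compensated jump sums of `ℓ(Z)`. -/
def IsJumpLimit (P : Measure Ω) (Z : ℝ≥0 → Ω → Fin d → ℝ) (ℓ : (Fin d → ℝ) →L[ℝ] ℝ)
    (M : ℝ≥0 → Lp ℝ 2 P) : Prop :=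
  ∀ t, Tendsto (fun ε => centeredLp P Z (fun x => trunc ε (ℓ x)) 0 t) (𝓝[>] 0) (𝓝 (M t))

variable {ℓ ℓ' : (Fin d → ℝ) →L[ℝ] ℝ} {M M' : ℝ≥0 → Lp ℝ 2 P}

lemma IsJumpLimit.tendsto_increment (hZ : IsRegularLevy P Z) (hM : IsJumpLimit P Z ℓ M)
    (hst : s ≤ t) :
    Tendsto (fun ε => centeredLp P Z (fun x => trunc ε (ℓ x)) s t) (𝓝[>] 0) (𝓝 (M t - M s)) := by
  refine ((hM t).sub (hM s)).congr' ?_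
  filter_upwards [self_mem_nhdsWithin] with ε hε
  rw [hZ.centeredLp_add_interval zero_le hst (isLinearTest_trunc ℓ hε), add_sub_cancel_left]

lemma IsJumpLimit.inner_increment (hZ : IsRegularLevy P Z) (hM : IsJumpLimit P Z ℓ M)
    (hM' : IsJumpLimit P Z ℓ' M') (hst : s ≤ t) : inner ℝ (M s) (M' t - M' s) = 0 := by
  refine tendsto_nhds_unique ((hM s).inner (hM'.tendsto_increment hZ hst)) ?_
  refine tendsto_const_nhds.congr' ?_
  filter_upwards [self_mem_nhdsWithin] with ε hε
  exact (hZ.inner_centeredLp hst (isLinearTest_trunc ℓ hε) (isLinearTest_trunc ℓ' hε)).symm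

lemma IsJumpLimit.norm_increment (hZ : IsRegularLevy P Z) (hM : IsJumpLimit P Z ℓ M)
    (s h : ℝ≥0) : ‖M (s + h) - M s‖ = ‖M h‖ := by
  refine tendsto_nhds_unique ((hM.tendsto_increment hZ le_self_add).norm) ?_
  refine (hM h).norm.congr' ?_
  filter_upwards [self_mem_nhdsWithin] with ε hε
  have hl := isLinearTest_trunc ℓ hε
  rw [← sq_eq_sq₀ (norm_nonneg _) (norm_nonneg _), hZ.norm_sq_centeredLp zero_le hl,
    hZ.norm_sq_centeredLp le_self_add hl]
  exact ((hZ.identDistrib_centeredJump hl s h).sq.integral_eq).symm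

/-- Orthogonal and stationary increments make `‖M t‖ ^ 2` additive in `t`. -/
lemma IsJumpLimit.norm_sq (hZ : IsRegularLevy P Z) (hM : IsJumpLimit P Z ℓ M) (t : ℝ≥0) :
    ‖M t‖ ^ 2 = t * ‖M 1‖ ^ 2 := by
  refine eq_mul_of_additive (φ := fun t => ‖M t‖ ^ 2) (fun t => sq_nonneg _) (fun s h => ?_) t
  have h1 := hM.inner_increment hZ hM (le_self_add : s ≤ s + h)
  have h2 := norm_add_sq_real (M s) (M (s + h) - M s)
  rw [add_sub_cancel, h1, hM.norm_increment hZ] at h2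
  rw [h2]; ring

lemma IsJumpLimit.norm_sq_sub (hZ : IsRegularLevy P Z) (hM : IsJumpLimit P Z ℓ M) (s t : ℝ≥0) :
    ‖M t - M s‖ ^ 2 = dist t s * ‖M 1‖ ^ 2 := by
  have key : ∀ {s t : ℝ≥0}, s ≤ t → ‖M t - M s‖ ^ 2 = dist t s * ‖M 1‖ ^ 2 := by
    intro s t hst
    obtain ⟨h, rfl⟩ := exists_add_of_le hst
    rw [hM.norm_increment hZ, hM.norm_sq hZ, NNReal.dist_eq]
    push_cast
    rw [add_sub_cancel_left, abs_of_nonneg h.coe_nonneg]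
  rcases le_total s t with h | h
  · exact key h
  · rw [norm_sub_rev, dist_comm]; exact key h

lemma IsJumpLimit.integral_eq_zero (hZ : IsRegularLevy P Z) (hM : IsJumpLimit P Z ℓ M)
    (t : ℝ≥0) : ∫ ω, M t ω ∂P = 0 := by
  -- The expectation is the inner product with the constant `1`, hence continuous on `L²`.
  have h1 : ∀ Y : Lp ℝ 2 P, inner ℝ (Lp.const 2 P (1 : ℝ)) Y = ∫ ω, Y ω ∂P := fun Y => by
    rw [L2.inner_def]
    refine integral_congr_ae ?_
    filter_upwards [Lp.coeFn_const (p := 2) (μ := P) (1 : ℝ)] with ω hω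
    rw [hω]
    simp
  rw [← h1]
  refine tendsto_nhds_unique (tendsto_const_nhds.inner (hM t)) ?_
  refine tendsto_const_nhds.congr' ?_
  filter_upwards [self_mem_nhdsWithin] with ε hε
  have hl := isLinearTest_trunc ℓ hε
  rw [h1, integral_congr_ae (hZ.centeredLp_coeFn zero_le hl), hZ.integral_centeredJump zero_le hl]

end LimitProcess

/-! ### A càdlàg Lévy version of the limit process -/

section CadlagVersion

/-- From any `K ≥ N` on, the sequence is uniformly geometrically Cauchy on `[0, K]`, so the
convergence is locally uniform. -/
lemma exists_isCadlag_limit {y : ℕ → ℝ≥0 → ℝ} (hy : ∀ k, IsCadlag (y k)) {N : ℕ}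
    (h : ∀ k ≥ N, ∀ t ≤ (k : ℝ≥0), |y (k + 1) t - y k t| ≤ (1 / 2 : ℝ) ^ k) :
    ∃ f : ℝ≥0 → ℝ, IsCadlag f ∧ ∀ t, Tendsto (fun k => y k t) atTop (𝓝 (f t)) := by
  have hd : ∀ K ≥ N, ∀ t ≤ (K : ℝ≥0), ∀ k,
      dist (y (K + k) t) (y (K + (k + 1)) t) ≤ (1 / 2 : ℝ) ^ K * (1 / 2) ^ k := by
    intro K hK t ht k
    rw [dist_comm, Real.dist_eq, ← pow_add, ← add_assoc]
    exact h (K + k) (by omega) t (ht.trans (by exact_mod_cast Nat.le_add_right K k))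
  have hex : ∀ t, ∃ l, Tendsto (fun k => y k t) atTop (𝓝 l) := by
    intro t
    obtain ⟨n, hn⟩ := exists_nat_ge t
    have hK : t ≤ ((max N n : ℕ) : ℝ≥0) := hn.trans (by exact_mod_cast le_max_right N n)
    obtain ⟨l, hl⟩ := cauchySeq_tendsto_of_complete
      (cauchySeq_of_le_geometric _ _ (by norm_num) (hd _ (le_max_left N n) t hK))
    refine ⟨l, (tendsto_add_atTop_iff_nat (max N n)).1 ?_⟩
    simpa only [add_comm] using hl
  choose f hf using hex
  refine ⟨f, isCadlag_of_uniform_approx fun T η hη => ?_, hf⟩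
  obtain ⟨n, hn⟩ := exists_nat_ge T
  obtain ⟨p, hp⟩ := exists_pow_lt_of_lt_one (half_pos hη) (by norm_num : (1 / 2 : ℝ) < 1)
  set K := max N (max n p) with hKdef
  have hKn : n ≤ K := (le_max_left _ _).trans (le_max_right _ _)
  have hKp : p ≤ K := (le_max_right _ _).trans (le_max_right _ _)
  refine ⟨y K, hy K, fun t ht => ?_⟩
  have htK : t ≤ (K : ℝ≥0) := ht.le.trans (hn.trans (by exact_mod_cast hKn))
  have hlim : Tendsto (fun k => y (K + k) t) atTop (𝓝 (f t)) := by
    simpa only [add_comm] using (tendsto_add_atTop_iff_nat K).2 (hf t)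
  have := dist_le_of_le_geometric_of_tendsto₀ _ _ (by norm_num)
    (hd K (le_max_left _ _) t htK) hlim
  rw [add_zero, dist_comm, Real.dist_eq] at this
  have h2 : (1 / 2 : ℝ) ^ K ≤ (1 / 2) ^ p :=
    pow_le_pow_of_le_one (by norm_num) (by norm_num) hKp
  refine this.trans ?_
  rw [div_le_iff₀ (by norm_num)]
  linarith

variable {Ω : Type*} {mΩ : MeasurableSpace Ω} {P : Measure Ω} {d : ℕ}
  {Z : ℝ≥0 → Ω → Fin d → ℝ} [IsProbabilityMeasure P]
  {ℓ : (Fin d → ℝ) →L[ℝ] ℝ} {M : ℝ≥0 → Lp ℝ 2 P}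

/-- Truncation levels decreasing so fast that the maximal inequality makes the exceptional events
summable, even though the horizon `k` grows with the step. Borel–Cantelli concludes. -/
lemma IsJumpLimit.exists_approximation (hZ : IsRegularLevy P Z) (hM : IsJumpLimit P Z ℓ M) :
    ∃ ε : ℕ → ℝ, (∀ k, 0 < ε k) ∧ Tendsto ε atTop (𝓝 0) ∧
      ∀ᵐ ω ∂P, ∃ N : ℕ, ∀ k ≥ N, ∀ t ≤ (k : ℝ≥0),
        |centeredJump P Z (fun x => trunc (ε (k + 1)) (ℓ x)) 0 t ω -
          centeredJump P Z (fun x => trunc (ε k) (ℓ x)) 0 t ω| ≤ (1 / 2 : ℝ) ^ k := by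
  have hu : Tendsto (fun n : ℕ => 1 / ((n : ℝ) + 1)) atTop (𝓝[>] 0) :=
    tendsto_nhdsWithin_iff.2 ⟨tendsto_one_div_add_atTop_nhds_zero_nat,
      Eventually.of_forall fun n => Set.mem_Ioi.2 (by positivity)⟩
  have hex : ∀ k : ℕ, ∃ N : ℕ, ∀ n : ℕ, N ≤ n → ∀ n' : ℕ, n ≤ n' →
      ‖centeredLp P Z (fun x => trunc (1 / ((n' : ℝ) + 1)) (ℓ x)) 0 k - M k‖ ≤ (1 / 8) ^ k := by
    intro k
    have h1 := ((hM k).comp hu).eventually (Metric.closedBall_mem_nhds _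
      (by positivity : (0 : ℝ) < (1 / 8) ^ k))
    obtain ⟨N, hN⟩ := eventually_atTop.1 h1
    exact ⟨N, fun n hn n' hn' => by simpa [dist_eq_norm] using hN n' (hn.trans hn')⟩
  obtain ⟨φ, hφ, hφb⟩ := extraction_forall_of_eventually' hex
  set ε : ℕ → ℝ := fun k => 1 / ((φ k : ℝ) + 1) with hε
  have hpos : ∀ k, 0 < ε k := fun k => by positivity
  refine ⟨ε, hpos, (hu.mono_right nhdsWithin_le_nhds).comp hφ.tendsto_atTop, ?_⟩
  have hl : ∀ k, IsLinearTest fun x => trunc (ε k) (ℓ x) := fun k => isLinearTest_trunc ℓ (hpos k)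
  set D : ℕ → (Fin d → ℝ) → ℝ := fun k x =>
    1 * trunc (ε (k + 1)) (ℓ x) + (-1) * trunc (ε k) (ℓ x) with hD
  have hlD : ∀ k, IsLinearTest (D k) := fun k => (hl (k + 1)).lin (hl k) 1 (-1)
  have hnorm : ∀ k : ℕ, ‖centeredLp P Z (D k) 0 k‖ ≤ 2 * (1 / 8) ^ k := by
    intro k
    rw [hD, hZ.centeredLp_lin zero_le (hl (k + 1)) (hl k), one_smul, neg_one_smul,
      ← sub_eq_add_neg]
    have h1 := hφb k (φ (k + 1)) (hφ (Nat.lt_succ_self k)).le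
    have h2 := hφb k (φ k) le_rfl
    calc _ ≤ _ := norm_sub_le_norm_sub_add_norm_sub _ (M k) _
      _ ≤ (1 / 8) ^ k + (1 / 8) ^ k := add_le_add h1 (by rw [norm_sub_rev]; exact h2)
      _ = 2 * (1 / 8) ^ k := by ring
  -- The squared norm is at most `4 · 64⁻ᵏ`, and dividing by the squared level `4⁻ᵏ` leaves `4 ·
  -- 16⁻ᵏ`.
  have hmeas : ∀ k : ℕ,
      P {ω | ∃ t ≤ (k : ℝ≥0), (1 / 2 : ℝ) ^ k < |centeredJump P Z (D k) 0 t ω|} ≤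
        ENNReal.ofReal (4 * (1 / 16) ^ k) := by
    intro k
    refine (hZ.measureReal_sup_centeredJump_le (hlD k) k (by positivity)).trans
      (ENNReal.ofReal_le_ofReal ?_)
    rw [← hZ.norm_sq_centeredLp zero_le (hlD k), div_le_iff₀ (by positivity)]
    calc _ ≤ (2 * (1 / 8 : ℝ) ^ k) ^ 2 := pow_le_pow_left₀ (norm_nonneg _) (hnorm k) 2
      _ = 4 * (1 / 16) ^ k * ((1 / 2) ^ k) ^ 2 := by
        rw [mul_pow, ← pow_mul, ← pow_mul, mul_comm k 2, pow_mul, pow_mul, mul_assoc, ← mul_pow]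
        norm_num
  have hsum : ∑' k : ℕ, P {ω | ∃ t ≤ (k : ℝ≥0),
      (1 / 2 : ℝ) ^ k < |centeredJump P Z (D k) 0 t ω|} ≠ ∞ := by
    have hs : Summable fun k : ℕ => 4 * (1 / 16 : ℝ) ^ k :=
      (summable_geometric_of_lt_one (by norm_num) (by norm_num)).mul_left 4
    exact ne_top_of_le_ne_top hs.tsum_ofReal_ne_top (ENNReal.tsum_le_tsum hmeas)
  filter_upwards [ae_eventually_notMem hsum] with ω hω
  obtain ⟨N, hN⟩ := eventually_atTop.1 hω
  refine ⟨N, fun k hk t ht => ?_⟩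
  by_contra hcon
  refine hN k hk ⟨t, ht, ?_⟩
  rw [hD, hZ.centeredJump_lin zero_le (hl (k + 1)) (hl k)]
  rw [one_mul, neg_one_mul, ← sub_eq_add_neg]
  exact not_le.1 hcon

/-- The process of compensated jump sums has a version that is a càdlàg Lévy process. -/
theorem IsJumpLimit.exists_cadlag_version (hZ : IsRegularLevy P Z) (hM : IsJumpLimit P Z ℓ M) :
    ∃ m : ℝ≥0 → Ω → ℝ, IsLevyProcess P m ∧ (∀ ω, IsCadlag fun t => m t ω) ∧
      ∀ t, m t =ᵐ[P] M t := by
  classical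
  obtain ⟨ε, hpos, hε0, hae⟩ := hM.exists_approximation hZ
  have hl : ∀ k, IsLinearTest fun x => trunc (ε k) (ℓ x) := fun k => isLinearTest_trunc ℓ (hpos k)
  set Y : ℕ → ℝ≥0 → ℝ≥0 → Ω → ℝ := fun k => centeredJump P Z (fun x => trunc (ε k) (ℓ x)) with hY
  -- On the exceptional set the path is replaced by `0`, so that every path is càdlàg.
  have hpath : ∀ ω, ∃ f : ℝ≥0 → ℝ, IsCadlag f ∧
      ((∃ N : ℕ, ∀ k ≥ N, ∀ t ≤ (k : ℝ≥0), |Y (k + 1) 0 t ω - Y k 0 t ω| ≤ (1 / 2 : ℝ) ^ k) →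
        ∀ t, Tendsto (fun k => Y k 0 t ω) atTop (𝓝 (f t))) := by
    intro ω
    by_cases h : ∃ N : ℕ, ∀ k ≥ N, ∀ t ≤ (k : ℝ≥0),
        |Y (k + 1) 0 t ω - Y k 0 t ω| ≤ (1 / 2 : ℝ) ^ k
    · obtain ⟨N, hN⟩ := h
      obtain ⟨f, hf, hlim⟩ := exists_isCadlag_limit
        (fun k => hZ.isCadlag_centeredJump (hl k) ω) hN
      exact ⟨f, hf, fun _ => hlim⟩
    · exact ⟨fun _ => 0, isCadlag_of_continuous continuous_const, fun h' => absurd h' h⟩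
  choose m hcad hm using hpath
  have hlim : ∀ᵐ ω ∂P, ∀ t, Tendsto (fun k => Y k 0 t ω) atTop (𝓝 (m ω t)) := by
    filter_upwards [hae] with ω hω using hm ω hω
  have hYmeas : ∀ k t, Measurable (Y k 0 t) := fun k t => hZ.measurable_centeredJump zero_le (hl k)
  have hmeas : ∀ t, AEMeasurable (fun ω => m ω t) P := fun t =>
    aemeasurable_of_tendsto_metrizable_ae' (fun k => (hYmeas k t).aemeasurable)
      (hlim.mono fun ω h => h t)
  -- The almost sure limit and the `L²`-limit are both limits in measure.
  have hver : ∀ t, (fun ω => m ω t) =ᵐ[P] M t := by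
    intro t
    have h1 : TendstoInMeasure P (fun k => Y k 0 t) atTop (fun ω => m ω t) :=
      tendstoInMeasure_of_tendsto_ae (fun k => (hYmeas k t).aestronglyMeasurable)
        (hlim.mono fun ω h => h t)
    have h2 := tendstoInMeasure_of_tendsto_Lp ((hM t).comp
      (tendsto_nhdsWithin_iff.2 ⟨hε0, Eventually.of_forall hpos⟩))
    refine tendstoInMeasure_ae_unique h1 (h2.congr_left fun k => ?_)
    exact hZ.centeredLp_coeFn zero_le (hl k)
  have hincr : ∀ {s t : ℝ≥0}, s ≤ t →
      ∀ᵐ ω ∂P, Tendsto (fun k => Y k s t ω) atTop (𝓝 (m ω t - m ω s)) := by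
    intro s t hst
    filter_upwards [hlim] with ω hω
    refine ((hω t).sub (hω s)).congr fun k => ?_
    rw [hY]
    simp only [hZ.centeredJump_add_interval zero_le hst (hl k), add_sub_cancel_left]
  refine ⟨fun t ω => m ω t, ⟨hmeas, ?_, ?_, fun s h => ?_, fun t => ?_⟩, hcad, hver⟩
  · filter_upwards [hlim] with ω hω
    refine tendsto_nhds_unique (hω 0) (tendsto_const_nhds.congr fun k => ?_)
    exact (centeredJump_self _ _ _).symm
  · refine HasIndepIncrements.of_nat fun τ hτ _ => ?_
    exact iIndepFun_of_tendsto_ae' (Y := fun k i => Y k (τ i) (τ (i + 1)))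
      (fun k i => (hZ.measurable_centeredJump (hτ i.le_succ) (hl k)).aemeasurable)
      (fun k => hZ.iIndepFun_centeredJump hτ fun _ => hl k) fun i => hincr (hτ i.le_succ)
  · exact identDistrib_of_tendsto_ae (fun k => hZ.identDistrib_centeredJump (hl k) s h)
      (hincr le_self_add) (hincr zero_le)
  -- Stochastic continuity follows from `L²`-continuity, since `‖M t - M s‖² = |t - s| ‖M 1‖²`.
  · refine TendstoInMeasure.congr (fun s => (hver s).symm) (hver t).symm
      (tendstoInMeasure_of_tendsto_Lp ?_)
    rw [tendsto_iff_norm_sub_tendsto_zero]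
    have h1 : Tendsto (fun s => √(dist t s * ‖M 1‖ ^ 2)) (𝓝 t) (𝓝 0) := by
      have : Continuous fun s => √(dist t s * ‖M 1‖ ^ 2) := by fun_prop
      simpa using this.tendsto t
    refine h1.congr fun s => ?_
    rw [← hM.norm_sq_sub hZ, Real.sqrt_sq (norm_nonneg _), norm_sub_rev]

end CadlagVersion

/-! ### Regular versions of Lévy processes -/

section Regularization

/-- Rational times approaching `t` from the right; through them a càdlàg path is determined by
countably many values. -/
lemma tendsto_dyadic_right (t : ℝ≥0) :
    Tendsto (fun n : ℕ => ((⌊t * (n + 1)⌋₊ + 1 : ℕ) : ℝ≥0) / (n + 1)) atTop (𝓝[≥] t) := by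
  have h1 : ∀ n : ℕ, t ≤ ((⌊t * (n + 1)⌋₊ + 1 : ℕ) : ℝ≥0) / (n + 1) := fun n => by
    rw [le_div_iff₀ (by positivity)]
    exact_mod_cast (Nat.lt_floor_add_one (t * (n + 1))).le
  have h2 : ∀ n : ℕ, ((⌊t * (n + 1)⌋₊ + 1 : ℕ) : ℝ≥0) / (n + 1) ≤ t + 1 / (n + 1) := fun n => by
    rw [Nat.cast_add, Nat.cast_one, add_div]
    gcongr
    rw [div_le_iff₀ (by positivity)]
    exact Nat.floor_le zero_le
  refine tendsto_nhdsWithin_iff.2 ⟨?_, Eventually.of_forall h1⟩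
  refine tendsto_of_tendsto_of_tendsto_of_le_of_le tendsto_const_nhds ?_ h1 h2
  simpa using (tendsto_const_nhds (x := t)).add
    (tendsto_one_div_add_atTop_nhds_zero_nat (𝕜 := ℝ≥0))

lemma tendsto_of_isCadlag {f : ℝ≥0 → ℝ} (hf : IsCadlag f) (t : ℝ≥0) :
    Tendsto (fun n : ℕ => f (((⌊t * (n + 1)⌋₊ + 1 : ℕ) : ℝ≥0) / (n + 1))) atTop (𝓝 (f t)) :=
  (hf t).1.tendsto.comp (tendsto_dyadic_right t)

lemma eq_of_isCadlag {f g : ℝ≥0 → ℝ} (hf : IsCadlag f) (hg : IsCadlag g)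
    (h : ∀ k n : ℕ, f ((k : ℝ≥0) / (n + 1)) = g ((k : ℝ≥0) / (n + 1))) (t : ℝ≥0) : f t = g t :=
  tendsto_nhds_unique (tendsto_of_isCadlag hf t)
    ((tendsto_of_isCadlag hg t).congr fun n => (h _ n).symm)

lemma isCadlag_const_mul {f : ℝ≥0 → ℝ} (hf : IsCadlag f) (c : ℝ) : IsCadlag fun t => c * f t :=
  fun t => ⟨(hf t).1.const_mul c, by
    obtain ⟨l, hl⟩ := (hf t).2
    exact ⟨c * l, hl.const_mul c⟩⟩

lemma isCadlag_add {f g : ℝ≥0 → ℝ} (hf : IsCadlag f) (hg : IsCadlag g) :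
    IsCadlag fun t => f t + g t :=
  fun t => ⟨(hf t).1.add (hg t).1, by
    obtain ⟨l, hl⟩ := (hf t).2
    obtain ⟨l', hl'⟩ := (hg t).2
    exact ⟨l + l', hl.add hl'⟩⟩

variable {Ω : Type*} {mΩ : MeasurableSpace Ω} {P : Measure Ω}

/-- On a measurable set of full measure the path is càdlàg and agrees at rational times with
measurable representatives; elsewhere it is set to `0`. Each marginal is then a limit of measurable
functions. -/
lemma exists_measurable_cadlag {X : ℝ≥0 → Ω → ℝ} (hX : ∀ t, AEMeasurable (X t) P)
    (hcad : ∀ᵐ ω ∂P, IsCadlag fun t => X t ω) :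
    ∃ Y : ℝ≥0 → Ω → ℝ, (∀ t, Measurable (Y t)) ∧ (∀ ω, IsCadlag fun t => Y t ω) ∧
      ∀ᵐ ω ∂P, ∀ t, Y t ω = X t ω := by
  classical
  have hae : ∀ᵐ ω ∂P, (IsCadlag fun t => X t ω) ∧
      ∀ k n : ℕ, X ((k : ℝ≥0) / (n + 1)) ω = (hX ((k : ℝ≥0) / (n + 1))).mk _ ω :=
    hcad.and (ae_all_iff.2 fun k => ae_all_iff.2 fun n => (hX _).ae_eq_mk)
  obtain ⟨G, hGae, hG, hGs⟩ := IsMeasurablyGenerated.exists_measurable_subset hae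
  have hcadG : ∀ ω, IsCadlag fun t => G.indicator (X t) ω := fun ω => by
    by_cases hω : ω ∈ G
    · simpa only [Set.indicator_of_mem hω] using (hGs hω).1
    · simpa only [Set.indicator_of_notMem hω] using isCadlag_of_continuous continuous_const
  refine ⟨fun t => G.indicator (X t), fun t => ?_, hcadG, ?_⟩
  · refine measurable_of_tendsto_metrizable (f := fun n : ℕ =>
      G.indicator (X (((⌊t * (n + 1)⌋₊ + 1 : ℕ) : ℝ≥0) / (n + 1)))) (fun n => ?_)
      (tendsto_pi_nhds.2 fun ω => tendsto_of_isCadlag (hcadG ω) t)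
    have : G.indicator (X (((⌊t * (n + 1)⌋₊ + 1 : ℕ) : ℝ≥0) / (n + 1))) =
        G.indicator ((hX (((⌊t * (n + 1)⌋₊ + 1 : ℕ) : ℝ≥0) / (n + 1))).mk _) :=
      Set.indicator_congr fun ω hω => (hGs hω).2 _ n
    rw [this]
    exact (hX _).measurable_mk.indicator hG
  · filter_upwards [hGae] with ω hω t
    exact Set.indicator_of_mem hω _

lemma CylLevy.IsLevyProcess.congr_ae {E : Type*} [NormedAddCommGroup E] [MeasurableSpace E]
    {X Y : ℝ≥0 → Ω → E} (hX : IsLevyProcess P X)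
    (h : ∀ t, X t =ᵐ[P] Y t) : IsLevyProcess P Y where
  aemeasurable t := (hX.aemeasurable t).congr (h t)
  zero := by filter_upwards [hX.zero, h 0] with ω h1 h2 using h2 ▸ h1
  indep n t ht := (hX.indep n t ht).congr fun i => (h _).sub (h _)
  stationary s r := by
    have h1 := hX.stationary s r
    exact ⟨h1.aemeasurable_fst.congr ((h _).sub (h _)),
      h1.aemeasurable_snd.congr ((h _).sub (h _)), by
        rw [← Measure.map_congr ((h (s + r)).sub (h s)), ← Measure.map_congr ((h r).sub (h 0))]
        exact h1.map_eq⟩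
  stochCont t := (hX.stochCont t).congr (fun s => h s) (h t)

lemma exists_isRegularLevy {d : ℕ} {X : Fin d → ℝ≥0 → Ω → ℝ}
    (hX : IsLevyProcess P fun t ω i => X i t ω)
    (hcad : ∀ i, ∀ᵐ ω ∂P, IsCadlag fun t => X i t ω) (h2 : ∀ i t, MemLp (X i t) 2 P) :
    ∃ Z : ℝ≥0 → Ω → Fin d → ℝ, IsRegularLevy P Z ∧ ∀ᵐ ω ∂P, ∀ i t, Z t ω i = X i t ω := by
  choose Y hYm hYc hYX using fun i => exists_measurable_cadlag
    (fun t => (h2 i t).1.aemeasurable) (hcad i)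
  have hae : ∀ᵐ ω ∂P, ∀ i t, Y i t ω = X i t ω := ae_all_iff.2 hYX
  refine ⟨fun t ω i => Y i t ω, ⟨hX.congr_ae fun t => ?_, fun t => ?_, fun ω i => hYc i ω,
    fun t i => ?_⟩, hae⟩
  · filter_upwards [hae] with ω hω
    exact funext fun i => (hω i t).symm
  · exact measurable_pi_lambda _ fun i => hYm i t
  · refine (h2 i t).ae_eq ?_
    filter_upwards [hae] with ω hω using (hω i t).symm

end Regularization

/-! ### The cylindrical process `M₂` -/

section CylindricalJumps

variable {Ω : Type v} {mΩ : MeasurableSpace Ω} {P : Measure Ω} [IsProbabilityMeasure P]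
  {𝓕 : Filtration ℝ≥0 mΩ} {U : Type u} [NormedAddCommGroup U] [NormedSpace ℝ U]
  {L : ℝ≥0 → StrongDual ℝ U → Ω → ℝ}

omit [IsProbabilityMeasure P] in
lemma CylLevy.IsWeaklyCylindricalLevyProcess.exists_isRegularLevy
    (hL : IsWeaklyCylindricalLevyProcess P 𝓕 L) (hc : IsWeaklyCadlag P L)
    (h2 : IsWeakOrderTwo P L) {n : ℕ} (a : Fin n → StrongDual ℝ U) :
    ∃ Z : ℝ≥0 → Ω → Fin n → ℝ, IsRegularLevy P Z ∧ ∀ᵐ ω ∂P, ∀ i t, Z t ω i = L t (a i) ω :=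
  _root_.exists_isRegularLevy (X := fun i t => L t (a i)) (hL.levy n a) (fun i => hc (a i))
    fun i t => h2 t (a i)

-- For a fixed time linearity holds off a null set depending on the time. Jumps see whole paths, so
-- one null set is needed for all times, and càdlàg paths reduce this to rational times.
omit [IsProbabilityMeasure P] in
lemma ae_forall_map_lin (hL : IsCylindricalProcess P L) (hc : IsWeaklyCadlag P L)
    (a b : StrongDual ℝ U) (α β : ℝ) :
    ∀ᵐ ω ∂P, ∀ t, L t (α • a + β • b) ω = α * L t a ω + β * L t b ω := by
  have h : ∀ᵐ ω ∂P, ∀ k n : ℕ, L ((k : ℝ≥0) / (n + 1)) (α • a + β • b) ω =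
      α * L ((k : ℝ≥0) / (n + 1)) a ω + β * L ((k : ℝ≥0) / (n + 1)) b ω := by
    refine ae_all_iff.2 fun k => ae_all_iff.2 fun n => ?_
    filter_upwards [hL.map_add ((k : ℝ≥0) / (n + 1)) (α • a) (β • b),
      hL.map_smul ((k : ℝ≥0) / (n + 1)) α a, hL.map_smul ((k : ℝ≥0) / (n + 1)) β b]
      with ω h1 h2 h3
    rw [h1, Pi.add_apply, h2, h3]
    rfl
  filter_upwards [h, hc a, hc b, hc (α • a + β • b)] with ω hω ha hb hab
  exact eq_of_isCadlag hab (isCadlag_add (isCadlag_const_mul ha α) (isCadlag_const_mul hb β)) hω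

lemma IsRegularLevy.isJumpLimit_M₂ {n : ℕ} {Z : ℝ≥0 → Ω → Fin n → ℝ} (hZ : IsRegularLevy P Z)
    (ℓ : (Fin n → ℝ) →L[ℝ] ℝ) {c : StrongDual ℝ U}
    (hX : ∀ᵐ ω ∂P, ∀ t, L t c ω = ℓ (Z t ω)) : IsJumpLimit P Z ℓ fun t => M₂ P L t c :=
  fun t => hZ.tendsto_compensatedJumpIntegral ℓ hX t

/-- A finite family `a` is realised by a regular Lévy process, whose coordinates have `M₂(·)(a i)`
as their compensated jump sums. -/
lemma exists_isJumpLimit_family (hL : IsWeaklyCylindricalLevyProcess P 𝓕 L)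
    (hc : IsWeaklyCadlag P L) (h2 : IsWeakOrderTwo P L) {n : ℕ} (a : Fin n → StrongDual ℝ U) :
    ∃ Z : ℝ≥0 → Ω → Fin n → ℝ, IsRegularLevy P Z ∧ (∀ᵐ ω ∂P, ∀ i t, Z t ω i = L t (a i) ω) ∧
      ∀ i, IsJumpLimit P Z (ContinuousLinearMap.proj i) fun t => M₂ P L t (a i) := by
  obtain ⟨Z, hZ, hZL⟩ := hL.exists_isRegularLevy hc h2 a
  refine ⟨Z, hZ, hZL, fun i => hZ.isJumpLimit_M₂ _ ?_⟩
  filter_upwards [hZL] with ω hω t using (hω i t).symm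

lemma isCompensatedJumpIntegral_M₂ (hL : IsWeaklyCylindricalLevyProcess P 𝓕 L)
    (hc : IsWeaklyCadlag P L) (h2 : IsWeakOrderTwo P L) (t : ℝ≥0) (a : StrongDual ℝ U) :
    IsCompensatedJumpIntegral P (fun s => L s a) t (M₂ P L t a) := by
  obtain ⟨Z, hZ, hZL⟩ := hL.exists_isRegularLevy hc h2 (fun _ : Fin 1 => a)
  refine hZ.isCompensatedJumpIntegral (ContinuousLinearMap.proj 0) ?_ t
  filter_upwards [hZL] with ω hω t using (hω 0 t).symm

/-- One process in `ℝ²` realises `a` and `b` together, and `L(·)(α • a + β • b)` is a linear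
functional of its path. -/
lemma M₂_lin (hL : IsWeaklyCylindricalLevyProcess P 𝓕 L) (hc : IsWeaklyCadlag P L)
    (h2 : IsWeakOrderTwo P L) (t : ℝ≥0) (α β : ℝ) (a b : StrongDual ℝ U) :
    M₂ P L t (α • a + β • b) = α • M₂ P L t a + β • M₂ P L t b := by
  obtain ⟨Z, hZ, hZL, hlim⟩ := exists_isJumpLimit_family hL hc h2 ![a, b]
  refine hZ.lin_of_tendsto_centeredLp zero_le (hlim 0 t) (hlim 1 t)
    (hZ.isJumpLimit_M₂ _ ?_ t)
  filter_upwards [hZL, ae_forall_map_lin hL.toIsCylindricalProcess hc a b α β] with ω h1 h3 t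
  have e0 := h1 0 t
  have e1 := h1 1 t
  simp only [Matrix.cons_val_zero, Matrix.cons_val_one] at e0 e1
  simp [h3 t, e0, e1]

lemma M₂_add (hL : IsWeaklyCylindricalLevyProcess P 𝓕 L) (hc : IsWeaklyCadlag P L)
    (h2 : IsWeakOrderTwo P L) (t : ℝ≥0) (a b : StrongDual ℝ U) :
    M₂ P L t (a + b) = M₂ P L t a + M₂ P L t b := by
  simpa using M₂_lin hL hc h2 t 1 1 a b

lemma M₂_smul (hL : IsWeaklyCylindricalLevyProcess P 𝓕 L) (hc : IsWeaklyCadlag P L)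
    (h2 : IsWeakOrderTwo P L) (t : ℝ≥0) (α : ℝ) (a : StrongDual ℝ U) :
    M₂ P L t (α • a) = α • M₂ P L t a := by
  simpa using M₂_lin hL hc h2 t α 0 a 0

lemma norm_sq_M₂ (hL : IsWeaklyCylindricalLevyProcess P 𝓕 L) (hc : IsWeaklyCadlag P L)
    (h2 : IsWeakOrderTwo P L) (t : ℝ≥0) (a : StrongDual ℝ U) :
    ‖M₂ P L t a‖ ^ 2 = t * ‖M₂ P L 1 a‖ ^ 2 := by
  obtain ⟨Z, hZ, -, hlim⟩ := exists_isJumpLimit_family hL hc h2 fun _ : Fin 1 => a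
  exact (hlim 0).norm_sq hZ t

/-- Polarisation of `norm_sq_M₂`, using linearity of `M₂` in `a`. -/
lemma inner_M₂_self_time (hL : IsWeaklyCylindricalLevyProcess P 𝓕 L) (hc : IsWeaklyCadlag P L)
    (h2 : IsWeakOrderTwo P L) (t : ℝ≥0) (a b : StrongDual ℝ U) :
    inner ℝ (M₂ P L t a) (M₂ P L t b) = t * inner ℝ (M₂ P L 1 a) (M₂ P L 1 b) := by
  have h := norm_sq_M₂ hL hc h2 t
  rw [real_inner_eq_norm_add_mul_self_sub_norm_mul_self_sub_norm_mul_self_div_two,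
    real_inner_eq_norm_add_mul_self_sub_norm_mul_self_sub_norm_mul_self_div_two,
    ← M₂_add hL hc h2, ← M₂_add hL hc h2]
  simp only [← sq, h]
  ring

/-- The later increment is orthogonal to the past, so only the common time `min s t` contributes. -/
lemma inner_M₂ (hL : IsWeaklyCylindricalLevyProcess P 𝓕 L) (hc : IsWeaklyCadlag P L)
    (h2 : IsWeakOrderTwo P L) (s t : ℝ≥0) (a b : StrongDual ℝ U) :
    inner ℝ (M₂ P L s a) (M₂ P L t b) = (min s t : ℝ≥0) * inner ℝ (M₂ P L 1 a) (M₂ P L 1 b) := by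
  have key : ∀ {s t : ℝ≥0} (a b : StrongDual ℝ U), s ≤ t →
      inner ℝ (M₂ P L s a) (M₂ P L t b) = s * inner ℝ (M₂ P L 1 a) (M₂ P L 1 b) := by
    intro s t a b hst
    obtain ⟨Z, hZ, -, hlim⟩ := exists_isJumpLimit_family hL hc h2 ![a, b]
    have h := (hlim 0).inner_increment hZ (hlim 1) hst
    simp only [Matrix.cons_val_zero, Matrix.cons_val_one] at h
    rw [inner_sub_right, sub_eq_zero] at h
    rw [h, inner_M₂_self_time hL hc h2]
  rcases le_total s t with h | h
  · rw [min_eq_left h, key a b h]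
  · rw [min_eq_right h, real_inner_comm, key b a h, real_inner_comm]

lemma integral_M₂ (hL : IsWeaklyCylindricalLevyProcess P 𝓕 L) (hc : IsWeaklyCadlag P L)
    (h2 : IsWeakOrderTwo P L) (t : ℝ≥0) (a : StrongDual ℝ U) : ∫ ω, M₂ P L t a ω ∂P = 0 := by
  obtain ⟨Z, hZ, -, hlim⟩ := exists_isJumpLimit_family hL hc h2 fun _ : Fin 1 => a
  exact (hlim 0).integral_eq_zero hZ t

lemma exists_cadlag_version_M₂ (hL : IsWeaklyCylindricalLevyProcess P 𝓕 L)
    (hc : IsWeaklyCadlag P L) (h2 : IsWeakOrderTwo P L) (a : StrongDual ℝ U) :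
    ∃ m : ℝ≥0 → Ω → ℝ, IsLevyProcess P m ∧ (∀ ω, IsCadlag fun t => m t ω) ∧
      ∀ t, m t =ᵐ[P] M₂ P L t a := by
  obtain ⟨Z, hZ, -, hlim⟩ := exists_isJumpLimit_family hL hc h2 fun _ : Fin 1 => a
  exact (hlim 0).exists_cadlag_version hZ

omit [IsProbabilityMeasure P] in
lemma covariance_eq_inner {X Y : Ω → ℝ} {F G : Lp ℝ 2 P} (hX : X =ᵐ[P] F) (hY : Y =ᵐ[P] G)
    (hF : ∫ ω, F ω ∂P = 0) (hG : ∫ ω, G ω ∂P = 0) : cov[X, Y; P] = inner ℝ F G := by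
  rw [covariance, integral_congr_ae hX, integral_congr_ae hY, hF, hG, real_inner_comm,
    L2.inner_def]
  refine integral_congr_ae ?_
  filter_upwards [hX, hY] with ω h1 h2
  simp [h1, h2]

end CylindricalJumps

/-! ### The Hilbert space generated by a cylindrical random variable -/

section KernelSpace

variable {U : Type*} [NormedAddCommGroup U] [NormedSpace ℝ U]
  {E : Type*} [NormedAddCommGroup E] [InnerProductSpace ℝ E]

/-- The closure of the range of `T`. -/
abbrev kernelSpace (T : StrongDual ℝ U →ₗ[ℝ] E) : Submodule ℝ E :=
  (LinearMap.range T).topologicalClosure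

variable {T : StrongDual ℝ U →ₗ[ℝ] E} {Q : StrongDual ℝ U → U}

lemma mem_kernelSpace (T : StrongDual ℝ U →ₗ[ℝ] E) (a : StrongDual ℝ U) : T a ∈ kernelSpace T :=
  Submodule.le_topologicalClosure _ (LinearMap.mem_range_self T a)

lemma eq_zero_of_mem_kernelSpace {x : E} (hx : x ∈ kernelSpace T)
    (h : ∀ b, inner ℝ x (T b) = 0) : x = 0 := by
  have hcl : IsClosed {y : E | inner ℝ x y = 0} := isClosed_eq (by fun_prop) continuous_const
  have hsub : closure (LinearMap.range T : Set E) ⊆ {y : E | inner ℝ x y = 0} :=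
    closure_minimal (by rintro _ ⟨b, rfl⟩; exact h b) hcl
  exact inner_self_eq_zero.1 (hsub hx)

/-- Closed graph. If `a n → x` and `T (a n) → y`, then `⟨T (a n), T b⟩ = a n (Q b)` tends to `x (Q
b) = ⟨T x, T b⟩`. Hence `y - T x`, which lies in the closure of the range, is orthogonal to the
range. That `Q b` is a vector of `U` is essential here. -/
lemma continuous_of_covariance [CompleteSpace E] (hQ : ∀ a b, b (Q a) = inner ℝ (T a) (T b)) :
    Continuous T := by
  refine T.continuous_of_seq_closed_graph fun a x y ha hy => ?_
  have hmem : y - T x ∈ kernelSpace T := by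
    refine Submodule.sub_mem _ ?_ (mem_kernelSpace T x)
    exact (LinearMap.range T).isClosed_topologicalClosure.mem_of_tendsto hy
      (Eventually.of_forall fun n => mem_kernelSpace T _)
  refine sub_eq_zero.1 (eq_zero_of_mem_kernelSpace hmem fun b => ?_)
  have h1 : Tendsto (fun n => inner ℝ (T (a n)) (T b)) atTop (𝓝 (inner ℝ y (T b))) :=
    hy.inner tendsto_const_nhds
  have h2 : Tendsto (fun n => inner ℝ (T (a n)) (T b)) atTop (𝓝 (inner ℝ (T x) (T b))) := by
    have h3 : Tendsto (fun n => (a n) (Q b)) atTop (𝓝 (x (Q b))) :=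
      ((ContinuousLinearMap.apply ℝ ℝ (Q b)).continuous.tendsto x).comp ha
    simpa only [hQ, real_inner_comm] using h3
  rw [inner_sub_left, tendsto_nhds_unique h1 h2, sub_self]

/-- The map is `T a ↦ Q a`. By Hahn–Banach and boundedness of `T` it satisfies `‖Q a‖ ≤ C ‖T a‖`, so
it extends to the closure because `U` is complete. -/
lemma exists_kernel_embedding [CompleteSpace U] [CompleteSpace E]
    (hQ : ∀ a b, b (Q a) = inner ℝ (T a) (T b)) :
    ∃ i : kernelSpace T →L[ℝ] U, ∀ (k : kernelSpace T) (b : StrongDual ℝ U), b (i k) = inner ℝ (k : E) (T b) := by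
  obtain ⟨C, hC, hTC⟩ : ∃ C, 0 ≤ C ∧ ∀ b, ‖T b‖ ≤ C * ‖b‖ := by
    let Tc : StrongDual ℝ U →L[ℝ] E := ⟨T, continuous_of_covariance hQ⟩
    exact ⟨‖Tc‖, Tc.opNorm_nonneg, Tc.le_opNorm⟩
  have hbound : ∀ {u : U} {x : E}, (∀ b, b u = inner ℝ x (T b)) → ‖u‖ ≤ C * ‖x‖ := by
    intro u x h
    refine NormedSpace.norm_le_dual_bound ℝ u (by positivity) fun b => ?_
    rw [h, mul_comm C, mul_assoc]
    exact (norm_inner_le_norm _ _).trans (by gcongr; exact hTC b)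
  have hmem : ∀ k : kernelSpace T, ∃ u, ∀ b, b u = inner ℝ (k : E) (T b) := by
    intro k
    obtain ⟨y, hy, hlim⟩ := mem_closure_iff_seq_limit.1 k.2
    choose a ha using hy
    have hcau : CauchySeq fun n => Q (a n) := by
      have h1 := hlim.cauchySeq
      rw [cauchySeq_iff_tendsto_dist_atTop_0] at h1 ⊢
      refine squeeze_zero (fun _ => dist_nonneg) (fun p => ?_)
        (by simpa using h1.const_mul C : Tendsto (fun p => C * dist (y p.1) (y p.2)) _ (𝓝 0))
      rw [dist_eq_norm, dist_eq_norm]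
      refine hbound fun b => ?_
      rw [map_sub, hQ, hQ, inner_sub_left, ← ha p.1, ← ha p.2]
    obtain ⟨u, hu⟩ := cauchySeq_tendsto_of_complete hcau
    refine ⟨u, fun b => tendsto_nhds_unique ((b.continuous.tendsto u).comp hu) ?_⟩
    refine (hlim.inner tendsto_const_nhds).congr fun n => ?_
    rw [Function.comp_apply, hQ, ← ha n]
  choose i hi using hmem
  have hext : ∀ {u w : U}, (∀ b : StrongDual ℝ U, b u = b w) → u = w := fun h =>
    (SeparatingDual.eq_iff_forall_dual_eq (R := ℝ)).2 h
  exact ⟨LinearMap.mkContinuous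
    { toFun := i
      map_add' := fun x y => hext fun b => by
        rw [map_add, hi, hi, hi, Submodule.coe_add, inner_add_left]
      map_smul' := fun c x => hext fun b => by
        rw [map_smul, hi, hi, Submodule.coe_smul, real_inner_smul_left]; rfl } C
    fun x => hbound (hi x), hi⟩

/-- Norming functionals of a dense sequence: if `b n u = 0` and `w` is the `n`-th dense point, then
`‖w‖ = b n (w - u) ≤ ‖w - u‖`, which is small for `w` close to `u`. -/
lemma exists_separating_sequence [TopologicalSpace.SeparableSpace U] :
    ∃ b : ℕ → StrongDual ℝ U, ∀ u, (∀ n, b n u = 0) → u = 0 := by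
  choose b hb1 hb using fun n : ℕ => exists_dual_vector'' ℝ (TopologicalSpace.denseSeq U n)
  refine ⟨b, fun u hu => norm_le_zero_iff.1 (le_of_forall_pos_le_add fun ε hε => ?_)⟩
  obtain ⟨n, hn⟩ := (TopologicalSpace.denseRange_denseSeq U).exists_dist_lt u (half_pos hε)
  set w := TopologicalSpace.denseSeq U n
  have h1 : ‖w‖ ≤ ‖w - u‖ := by
    have h2 := (b n).le_of_opNorm_le (hb1 n) (w - u)
    rw [map_sub, hu n, sub_zero, hb n, one_mul] at h2
    simpa using h2
  have h3 : ‖u‖ ≤ ‖u - w‖ + ‖w‖ := by simpa using norm_add_le (u - w) w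
  rw [norm_sub_rev] at h1
  rw [dist_eq_norm] at hn
  linarith

/-- The dual need not be separable, so totality comes through the embedding `i`: if `x` is
orthogonal to all `T (b n)`, then every `b n` vanishes at `i x`, so `i x = 0`. Gram–Schmidt stays in
the range of `T` and yields `0` at dependent vectors, whence the subtype. -/
lemma exists_orthonormal_sequence [CompleteSpace U] [CompleteSpace E]
    [TopologicalSpace.SeparableSpace U] (hQ : ∀ a b, b (Q a) = inner ℝ (T a) (T b)) :
    ∃ a : ℕ → StrongDual ℝ U, (Orthonormal ℝ fun n : {n // T (a n) ≠ 0} => T (a n)) ∧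
      ∀ x ∈ kernelSpace T, (∀ n, inner ℝ x (T (a n)) = 0) → x = 0 := by
  obtain ⟨i, hi⟩ := exists_kernel_embedding hQ
  obtain ⟨b, hb⟩ := exists_separating_sequence (U := U)
  have hspan : Submodule.span ℝ (Set.range fun n => T (b n)) ≤ LinearMap.range T :=
    Submodule.span_le.2 (by rintro _ ⟨n, rfl⟩; exact ⟨b n, rfl⟩)
  have hgs : Submodule.span ℝ (Set.range (InnerProductSpace.gramSchmidtNormed ℝ fun n => T (b n))) =
      Submodule.span ℝ (Set.range fun n => T (b n)) := by
    rw [InnerProductSpace.span_gramSchmidtNormed_range, InnerProductSpace.span_gramSchmidt]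
  have hex : ∀ n, ∃ a, T a = InnerProductSpace.gramSchmidtNormed ℝ (fun n => T (b n)) n :=
    fun n => hspan (hgs ▸ Submodule.subset_span (Set.mem_range_self n))
  choose a ha using hex
  refine ⟨a, ?_, fun x hx h => ?_⟩
  · have := InnerProductSpace.gramSchmidtNormed_orthonormal' (𝕜 := ℝ) (fun n => T (b n))
    rw [← funext ha] at this
    exact this
  · have h1 : ∀ y ∈ Submodule.span ℝ (Set.range fun n => T (b n)), inner ℝ x y = 0 := by
      intro y hy
      rw [← hgs] at hy
      induction hy using Submodule.span_induction with
      | mem y hy => obtain ⟨n, rfl⟩ := hy; rw [← ha]; exact h n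
      | zero => exact inner_zero_right _
      | add y z _ _ h1 h2 => rw [inner_add_right, h1, h2, add_zero]
      | smul c y _ h1 => rw [inner_smul_right, h1, mul_zero]
    have h2 : i ⟨x, hx⟩ = 0 := hb _ fun n => by
      rw [hi]; exact h1 _ (Submodule.subset_span ⟨n, rfl⟩)
    refine eq_zero_of_mem_kernelSpace hx fun c => ?_
    have := hi ⟨x, hx⟩ c
    rw [h2, map_zero] at this
    exact this.symm

lemma exists_hilbertBasis_kernelSpace [CompleteSpace E] {ι : Type*} {a : ι → StrongDual ℝ U}
    (ho : Orthonormal ℝ fun n => T (a n))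
    (ht : ∀ x ∈ kernelSpace T, (∀ n, inner ℝ x (T (a n)) = 0) → x = 0) :
    ∃ b : HilbertBasis ι ℝ (kernelSpace T), ∀ n, (b n : E) = T (a n) := by
  let v : ι → kernelSpace T := fun n => ⟨T (a n), mem_kernelSpace T _⟩
  have hv : Orthonormal ℝ v := (kernelSpace T).subtypeₗᵢ.orthonormal_comp_iff.1 ho
  refine ⟨HilbertBasis.mkOfOrthogonalEqBot hv ?_, fun n => ?_⟩
  · rw [Submodule.eq_bot_iff]
    intro x hx
    refine Subtype.ext (ht x x.2 fun n => ?_)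
    have := (Submodule.mem_orthogonal' _ _).1 hx (v n) (Submodule.subset_span ⟨n, rfl⟩)
    exact this
  · rw [HilbertBasis.coe_mkOfOrthogonalEqBot]

lemma hasSum_of_hilbertBasis {ι : Type*} {a : ι → StrongDual ℝ U}
    (b : HilbertBasis ι ℝ (kernelSpace T)) (hb : ∀ n, (b n : E) = T (a n)) {x : E}
    (hx : x ∈ kernelSpace T) : HasSum (fun n => inner ℝ (T (a n)) x • T (a n)) x := by
  have h := (b.hasSum_repr ⟨x, hx⟩).mapL (kernelSpace T).subtypeL
  simpa [b.repr_apply_apply, hb] using h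

/-- The vanishing vectors contribute nothing, so the basis expansion may be indexed by all of `ℕ`.
-/
lemma hasSum_of_orthonormal_nonzero [CompleteSpace E] {a : ℕ → StrongDual ℝ U}
    (ho : Orthonormal ℝ fun n : {n // T (a n) ≠ 0} => T (a n))
    (ht : ∀ x ∈ kernelSpace T, (∀ n, inner ℝ x (T (a n)) = 0) → x = 0) {x : E}
    (hx : x ∈ kernelSpace T) : HasSum (fun n => inner ℝ (T (a n)) x • T (a n)) x := by
  obtain ⟨b, hb⟩ := exists_hilbertBasis_kernelSpace (a := fun n : {n // T (a n) ≠ 0} => a n) ho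
    fun y hy h => ht y hy fun n => by
      by_cases hn : T (a n) = 0
      · rw [hn, inner_zero_right]
      · exact h ⟨n, hn⟩
  have h := hasSum_of_hilbertBasis b hb hx
  refine (hasSum_subtype_iff_of_support_subset (s := {n | T (a n) ≠ 0}) fun n hn h0 => hn ?_).1 h
  simp only [h0, smul_zero]

/-- The map `ℓ² → K`, `e n ↦ T (a n)`. -/
lemma exists_synthesis [CompleteSpace E] {a : ℕ → StrongDual ℝ U}
    (ho : Orthonormal ℝ fun n : {n // T (a n) ≠ 0} => T (a n))
    (ht : ∀ x ∈ kernelSpace T, (∀ n, inner ℝ x (T (a n)) = 0) → x = 0) :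
    ∃ S : lp (fun _ : ℕ => ℝ) 2 →L[ℝ] kernelSpace T,
      ∀ n, (S (lp.single 2 n 1) : E) = T (a n) := by
  have hsum : ∀ x : kernelSpace T, HasSum (fun n => inner ℝ (T (a n)) (x : E) ^ 2) (‖x‖ ^ 2) := by
    intro x
    have h := (hasSum_of_orthonormal_nonzero ho ht x.2).mapL (innerSL ℝ (x : E))
    simp only [innerSL_apply_apply, inner_smul_right, real_inner_self_eq_norm_sq] at h
    simp only [real_inner_comm, ← sq] at h ⊢
    exact h
  have hmem : ∀ x : kernelSpace T, Memℓp (fun n => inner ℝ (T (a n)) (x : E)) 2 := fun x =>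
    memℓp_gen (by simpa using (hsum x).summable)
  -- The coefficient map, bounded by Parseval. The required map is its adjoint.
  let R : kernelSpace T →L[ℝ] lp (fun _ : ℕ => ℝ) 2 :=
    LinearMap.mkContinuous
      { toFun := fun x => ⟨fun n => inner ℝ (T (a n)) (x : E), hmem x⟩
        map_add' := fun x y => by ext n; exact inner_add_right _ _ _
        map_smul' := fun c x => by ext n; exact inner_smul_right _ _ _ } 1 fun x => by
          rw [one_mul, ← sq_le_sq₀ (norm_nonneg _) (norm_nonneg _), ← (hsum x).tsum_eq,
            ← real_inner_self_eq_norm_sq, lp.inner_eq_tsum]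
          simp [sq]
  refine ⟨R.adjoint, fun n => ?_⟩
  suffices h : R.adjoint (lp.single 2 n 1) = ⟨T (a n), mem_kernelSpace T _⟩ by rw [h]
  refine ext_inner_right ℝ fun x => ?_
  rw [ContinuousLinearMap.adjoint_inner_left, lp.inner_single_left]
  simp [R]

end KernelSpace

/-! ### Series representations of `M₂` -/

section SeriesRepresentation

variable {Ω : Type v} {mΩ : MeasurableSpace Ω} {P : Measure Ω} [IsProbabilityMeasure P]
  {𝓕 : Filtration ℝ≥0 mΩ} {U : Type u} [NormedAddCommGroup U] [NormedSpace ℝ U]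
  {L : ℝ≥0 → StrongDual ℝ U → Ω → ℝ}

/-- `M₂(t)` as a linear map from the dual of `U` to `L²`. -/
noncomputable def linearMapM₂ (hL : IsWeaklyCylindricalLevyProcess P 𝓕 L)
    (hc : IsWeaklyCadlag P L) (h2 : IsWeakOrderTwo P L) (t : ℝ≥0) :
    StrongDual ℝ U →ₗ[ℝ] Lp ℝ 2 P where
  toFun := M₂ P L t
  map_add' := M₂_add hL hc h2 t
  map_smul' := M₂_smul hL hc h2 t

/-- By linearity the error of a partial sum at time `t` is some `M₂(t)d`, whose norm is `√t` times
that of `M₂(1)d`. -/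
lemma hasSum_M₂ (hL : IsWeaklyCylindricalLevyProcess P 𝓕 L) (hc : IsWeaklyCadlag P L)
    (h2 : IsWeakOrderTwo P L) {ι : Type*} {a : ι → StrongDual ℝ U} {c : ι → ℝ}
    {b : StrongDual ℝ U} (h : HasSum (fun k => c k • M₂ P L 1 (a k)) (M₂ P L 1 b)) (t : ℝ≥0) :
    HasSum (fun k => c k • M₂ P L t (a k)) (M₂ P L t b) := by
  have hlin : ∀ (t : ℝ≥0) (s : Finset ι), ∑ k ∈ s, c k • M₂ P L t (a k) - M₂ P L t b =
      M₂ P L t (∑ k ∈ s, c k • a k - b) := fun t s => by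
    change ∑ k ∈ s, c k • linearMapM₂ hL hc h2 t (a k) - linearMapM₂ hL hc h2 t b =
      linearMapM₂ hL hc h2 t _
    simp only [map_sub, map_sum, map_smul]
  have hnorm : ∀ d, ‖M₂ P L t d‖ = √t * ‖M₂ P L 1 d‖ := fun d => by
    rw [← Real.sqrt_sq (norm_nonneg (M₂ P L t d)), norm_sq_M₂ hL hc h2,
      Real.sqrt_mul t.coe_nonneg, Real.sqrt_sq (norm_nonneg _)]
  rw [HasSum, tendsto_iff_norm_sub_tendsto_zero] at h ⊢
  simp only [hlin] at h ⊢
  simp only [hnorm _]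
  simpa using h.const_mul √(t : ℝ)

lemma isSeriesRepresentation_M₂ (hL : IsWeaklyCylindricalLevyProcess P 𝓕 L)
    (hc : IsWeaklyCadlag P L) (h2 : IsWeakOrderTwo P L) {ι H : Type*} [NormedAddCommGroup H]
    [InnerProductSpace ℝ H] {e : HilbertBasis ι ℝ H} {F : H →L[ℝ] U} {m : ι → ℝ≥0 → Ω → ℝ}
    {a : ι → StrongDual ℝ U} (hm : ∀ k, IsLevyProcess P (m k))
    (hcad : ∀ k ω, IsCadlag fun t => m k t ω) (hver : ∀ k t, m k t =ᵐ[P] M₂ P L t (a k))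
    (hF : ∀ k (b : StrongDual ℝ U), b (F (e k)) = inner ℝ (M₂ P L 1 (a k)) (M₂ P L 1 b))
    (horth : ∀ k l, k ≠ l → inner ℝ (M₂ P L 1 (a k)) (M₂ P L 1 (a l)) = 0)
    (hsum : ∀ b, HasSum (fun k => inner ℝ (M₂ P L 1 (a k)) (M₂ P L 1 b) • M₂ P L 1 (a k))
      (M₂ P L 1 b)) : IsSeriesRepresentation P L e F m where
  levy := hm
  cadlag := hcad
  memLp k t := (Lp.memLp (M₂ P L t (a k))).ae_eq (hver k t).symm
  uncorrelated k l hkl s t := by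
    rw [covariance_eq_inner (hver k s) (hver l t) (integral_M₂ hL hc h2 s _)
      (integral_M₂ hL hc h2 t _), inner_M₂ hL hc h2, horth k l hkl, mul_zero]
  hasSum t b := by
    refine (hasSum_M₂ hL hc h2 (hsum b) t).congr_fun fun k => ?_
    rw [hF]
    congr 1
    exact Lp.ext ((MemLp.coeFn_toLp _).trans (hver k t))

lemma covariance_linearMapM₂ (hL : IsWeaklyCylindricalLevyProcess P 𝓕 L)
    (hc : IsWeaklyCadlag P L) (h2 : IsWeakOrderTwo P L) {Q : StrongDual ℝ U → U}
    (hQ : IsCovarianceOperator P L Q) (a b : StrongDual ℝ U) :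
    b (Q a) = inner ℝ (linearMapM₂ hL hc h2 1 a) (linearMapM₂ hL hc h2 1 b) := by
  rw [hQ a b, L2.inner_def]
  refine integral_congr_ae (Eventually.of_forall fun ω => ?_)
  simp [linearMapM₂, mul_comm]

end SeriesRepresentation

/-! ### The reproducing kernel Hilbert space -/

section ReproducingKernel

variable {U : Type*} [NormedAddCommGroup U] [NormedSpace ℝ U]
  {E : Type*} [NormedAddCommGroup E] [InnerProductSpace ℝ E]
  {T : StrongDual ℝ U →ₗ[ℝ] E} {Q : StrongDual ℝ U → U}

/-- Injectivity: if `i k = 0` then `k` is orthogonal to the range of `T`, in whose closure it lies.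
The isometry `J` allows a model of `kernelSpace T` in another universe. -/
lemma isReproducingKernelHilbertSpace_of_isometry
    (hQ : ∀ a b, b (Q a) = inner ℝ (T a) (T b)) {i : kernelSpace T →L[ℝ] U}
    (hi : ∀ (k : kernelSpace T) (b : StrongDual ℝ U), b (i k) = inner ℝ (k : E) (T b))
    {H : Type*} [NormedAddCommGroup H] [InnerProductSpace ℝ H] [CompleteSpace H]
    (J : H ≃ₗᵢ[ℝ] kernelSpace T) :
    IsReproducingKernelHilbertSpace Q (i.comp (J.toContinuousLinearEquiv : H →L[ℝ] _)) := by
  have hinj : Function.Injective (i.comp (J.toContinuousLinearEquiv : H →L[ℝ] _)) := by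
    rw [injective_iff_map_eq_zero]
    intro h hh
    have h0 : i (J h) = 0 := hh
    have h1 : (J h : E) = 0 := eq_zero_of_mem_kernelSpace (J h).2 fun b => by
      rw [← hi, h0, map_zero]
    exact (LinearIsometryEquiv.map_eq_zero_iff J).1 (Subtype.ext h1)
  have hval : ∀ a, i ⟨T a, mem_kernelSpace T a⟩ = Q a := fun a =>
    (SeparatingDual.eq_iff_forall_dual_eq (R := ℝ)).2 fun b => by rw [hi, hQ]
  have hval' : ∀ a, (i.comp (J.toContinuousLinearEquiv : H →L[ℝ] _))
      (J.symm ⟨T a, mem_kernelSpace T a⟩) = Q a := fun a => by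
    rw [← hval a]
    exact congrArg i (J.apply_symm_apply _)
  refine ⟨hinj, fun a => ⟨_, hval' a⟩, ?_, fun a b h k hh hk => ?_⟩
  · have hd : Dense {x : kernelSpace T | ∃ a, (x : E) = T a} := by
      intro x
      rw [closure_subtype]
      refine closure_mono ?_ x.2
      rintro _ ⟨a, rfl⟩
      exact ⟨⟨T a, mem_kernelSpace T a⟩, ⟨a, rfl⟩, rfl⟩
    have hd' := hd.preimage J.toHomeomorph.isOpenMap
    refine hd'.mono ?_
    rintro h ⟨a, ha⟩
    refine ⟨a, ?_⟩
    rw [← hval a]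
    exact congrArg i (Subtype.ext ha)
  · rw [hinj (hh.trans (hval' a).symm), hinj (hk.trans (hval' b).symm), J.symm.inner_map_map, hQ]
    rfl

end ReproducingKernel

theorem mainTheorem4 {Ω : Type v} {mΩ : MeasurableSpace Ω} (P : Measure Ω)
    [IsProbabilityMeasure P] (𝓕 : Filtration ℝ≥0 mΩ)
    {U : Type u} [NormedAddCommGroup U] [NormedSpace ℝ U] [CompleteSpace U]
    [TopologicalSpace.SeparableSpace U]
    (L : ℝ≥0 → StrongDual ℝ U → Ω → ℝ)
    (hL : IsWeaklyCylindricalLevyProcess P 𝓕 L)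
    (hcadlag : IsWeaklyCadlag P L)
    (hL2 : IsWeakOrderTwo P L)
    (hstrong : IsStrong P L) :
    -- the `L²`-limit that defines `M₂(t)a` exists
    (∀ t a, IsCompensatedJumpIntegral P (fun s => L s a) t (M₂ P L t a)) ∧
    -- a series representation with an orthonormal basis indexed by `ℕ`
    (∃ (H : Type) (_ : NormedAddCommGroup H) (_ : InnerProductSpace ℝ H) (_ : CompleteSpace H)
      (e : HilbertBasis ℕ ℝ H) (F : H →L[ℝ] U) (m : ℕ → ℝ≥0 → Ω → ℝ),
      IsSeriesRepresentation P L e F m) ∧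
    -- the representation in the reproducing kernel Hilbert space of the covariance operator `Q`,
    -- embedded by `i`, with `m k = M₂(·)(a k)`
    (∃ (Q : StrongDual ℝ U → U) (H : Type u) (_ : NormedAddCommGroup H)
      (_ : InnerProductSpace ℝ H) (_ : CompleteSpace H) (i : H →L[ℝ] U)
      (ι : Type) (_ : Countable ι) (e : HilbertBasis ι ℝ H) (m : ι → ℝ≥0 → Ω → ℝ)
      (a : ι → StrongDual ℝ U),
      IsCovarianceOperator P L Q ∧
      IsReproducingKernelHilbertSpace Q i ∧
      IsSeriesRepresentation P L e i m ∧
      (∀ k, i (e k) = Q (a k)) ∧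
      ∀ k t, m k t =ᵐ[P] M₂ P L t (a k)) := by
  obtain ⟨Q, hQ⟩ := hstrong
  set T := linearMapM₂ hL hcadlag hL2 1 with hT
  have hQT := covariance_linearMapM₂ hL hcadlag hL2 hQ
  obtain ⟨i, hi⟩ := exists_kernel_embedding hQT
  obtain ⟨a, ho, ht⟩ := exists_orthonormal_sequence hQT
  choose m hm hmc hmv using fun n => exists_cadlag_version_M₂ hL hcadlag hL2 (a n)
  have horth : ∀ k l, k ≠ l → inner ℝ (M₂ P L 1 (a k)) (M₂ P L 1 (a l)) = 0 := fun k l hkl => by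
    by_cases hk : T (a k) = 0
    · exact (congrArg (inner ℝ · (T (a l))) hk).trans (inner_zero_left _)
    by_cases hl : T (a l) = 0
    · exact (congrArg (inner ℝ (T (a k)) ·) hl).trans (inner_zero_right _)
    exact ho.2 (i := ⟨k, hk⟩) (j := ⟨l, hl⟩) fun h => hkl (congrArg Subtype.val h)
  refine ⟨isCompensatedJumpIntegral_M₂ hL hcadlag hL2, ?_, ?_⟩
  -- `H = ℓ²(ℕ)` and `F = i ∘ S`. Where `T (a n) = 0`, both `F (e n)` and the process `m n` vanish
  -- (the latter almost surely at each time), so the index set `ℕ` serves even in finite dimension.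
  · obtain ⟨S, hS⟩ := exists_synthesis ho ht
    let e : HilbertBasis ℕ ℝ (lp (fun _ : ℕ => ℝ) 2) :=
      HilbertBasis.ofRepr (LinearIsometryEquiv.refl ℝ _)
    have he : ∀ n, e n = lp.single 2 n 1 := fun n => by
      classical
      rw [← e.repr_symm_single]
      rfl
    refine ⟨lp (fun _ : ℕ => ℝ) 2, inferInstance, inferInstance, inferInstance, e, i.comp S, m,
      isSeriesRepresentation_M₂ hL hcadlag hL2 hm hmc hmv (fun k b => ?_) horth fun b =>
        hasSum_of_orthonormal_nonzero ho ht (mem_kernelSpace T b)⟩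
    rw [he, ContinuousLinearMap.comp_apply, hi, hS]
    rfl
  · have ht' : ∀ x ∈ kernelSpace T,
        (∀ n : {n // T (a n) ≠ 0}, inner ℝ x (T (a n)) = 0) → x = 0 := fun x hx h =>
      ht x hx fun n => by
        by_cases hn : T (a n) = 0
        · rw [hn, inner_zero_right]
        · exact h ⟨n, hn⟩
    obtain ⟨f, hf⟩ := exists_hilbertBasis_kernelSpace (a := fun n : {n // T (a n) ≠ 0} => a n)
      ho ht'
    -- `kernelSpace T` lives in the universe of `Ω`. Lifting the index set gives an isometric `ℓ²`
    -- model in the universe of `U`, while the basis itself keeps the unlifted indices.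
    obtain ⟨g, -⟩ := exists_hilbertBasis_kernelSpace
      (a := fun n : ULift.{u} {n // T (a n) ≠ 0} => a n.down)
      (ho.comp ULift.down ULift.down_injective) fun x hx h => ht' x hx fun n => h ⟨n⟩
    let J : lp (fun _ : ULift.{u} {n // T (a n) ≠ 0} => ℝ) 2 ≃ₗᵢ[ℝ] kernelSpace T := g.repr.symm
    let e : HilbertBasis {n // T (a n) ≠ 0} ℝ (lp (fun _ : ULift.{u} {n // T (a n) ≠ 0} => ℝ) 2) :=
      HilbertBasis.ofRepr (J.trans f.repr)
    have he : ∀ n, J (e n) = f n := fun n => by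
      classical
      rw [← e.repr_symm_single, ← f.repr_symm_single]
      exact J.apply_symm_apply _
    let F : lp (fun _ : ULift.{u} {n // T (a n) ≠ 0} => ℝ) 2 →L[ℝ] U :=
      i.comp (J.toContinuousLinearEquiv : _ →L[ℝ] kernelSpace T)
    have hF : ∀ (k) (b : StrongDual ℝ U),
        b (F (e k)) = inner ℝ (M₂ P L 1 (a k)) (M₂ P L 1 b) := fun k b => by
      have h1 : F (e k) = i (f k) := congrArg i (he k)
      rw [h1, hi, hf]
      rfl
    have hsum : ∀ b, HasSum (fun k : {n // T (a n) ≠ 0} =>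
        inner ℝ (M₂ P L 1 (a k)) (M₂ P L 1 b) • M₂ P L 1 (a k)) (M₂ P L 1 b) := fun b =>
      hasSum_of_hilbertBasis (a := fun n : {n // T (a n) ≠ 0} => a n) f hf (mem_kernelSpace T b)
    have hker : IsReproducingKernelHilbertSpace Q F :=
      isReproducingKernelHilbertSpace_of_isometry hQT hi J
    have hrep : IsSeriesRepresentation P L e F fun k : {n // T (a n) ≠ 0} => m k :=
      isSeriesRepresentation_M₂ hL hcadlag hL2 (a := fun k : {n // T (a n) ≠ 0} => a k)
        (fun k => hm k) (fun k => hmc k) (fun k => hmv k) hF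
        (fun k l hkl => horth k l fun h => hkl (Subtype.ext h)) hsum
    have hFe : ∀ k, F (e k) = Q (a k) := fun k =>
      (SeparatingDual.eq_iff_forall_dual_eq (R := ℝ)).2 fun b => by rw [hF, hQT]; rfl
    exact ⟨Q, _, _, _, _, F, _, inferInstance, e, fun k => m k, fun k => a k, hQ, hker, hrep, hFe,
      fun k => hmv k⟩
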